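/- **Conventions.** Pseudo-metrics and semi-norms take values in $[0,\infty]$. Let $k$ be a field. A *triangulated persistence category* (TPC) over $k$ is a $k$-linear category $\mathcal C$ enriched in persistence modules (morphism modules $\hom^{\alpha}(X,Y)$, $\alpha\in\mathbb R$, structure maps $i_{\alpha,\beta}:\hom^\alpha\to\hom^\beta$ for $\alpha\le\beta$, compatible bilinear compositions $\hom^\alpha\times\hom^\beta\to\hom^{\alpha+\beta}$), whose category $\mathcal C_0$ of morphisms of shift $0$ is triangulated with suspension $T$, together with shift functors $\Sigma^r$ ($r\in\mathbb R$), triangulated on $\mathcal C_0$, and natural isomorphisms $\eta_{r,s}:\Sigma^rX\to\Sigma^sX$ in $\hom^{s-r}$ ($\Sigma^0=\mathrm{id}$ and $\Sigma^r\Sigma^s=\Sigma^{r+s}$ via these), such that for $r\ge 0$ the morphism $\eta_r^X=i_{-r,0}(\eta_{r,0}):\Sigma^rX\to X$ embeds in an exact triangle of $\mathcal C_0$ with $r$-acyclic third object; $K$ is *$r$-acyclic* if $r\ge0$ and $i_{0,r}(1_K)=0$. $K(\mathcal C)$ is the Grothendieck group of $\mathcal C_0$: generated by the objects, with $[B]=[A]+[D]$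 for each exact triangle $A\to B\to D\to TA$ of $\mathcal C_0$. *Persistence weight and fragmentation.* A morphism of $\mathcal C_0$ is an $r$-isomorphism if it embeds in an exact triangle with $r$-acyclic third object. A triangle $A\xrightarrow{u}B\xrightarrow{v}D\xrightarrow{w}\Sigma^{-r}TA$ of $\mathcal C_0$ is *strict exact of weight $r\ge0$* if there are an exact triangle $A\xrightarrow{u}B\xrightarrow{v'}D'\xrightarrow{w'}TA$ of $\mathcal C_0$, an $r$-isomorphism $\phi:D'\to D$ and $\psi:\Sigma^rD\to D'$ with $\phi\psi=\eta^D_r$, $v=\phi v'$, $w'\psi=\Sigma^rw$. Let $\mathcal C_\infty$ have the same objects and morphisms $\varinjlim_\alpha\hom^\alpha$. A triangle $\Delta:A\to B\to D\to TA$ of $\mathcal C_\infty$ is exact, of unstable weight $\le r$, if its maps have representatives in $\hom^{s_1},\hom^{s_2-s_1},\hom^{r-s_2}$ with $0\le s_1\le s_2\le r$, which, composed with the $\eta$'s, give a strict exact triangle $A\to\Sigma^{-s_1}B\to\Sigma^{-s_2}D\to\Sigma^{-r}TA$ of weight $r$; $w_\infty(\Delta)$ is the infimum of such $r$, and $\bar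 w(\Delta)=\inf_{s\ge0}w_\infty(\Sigma^{s,0,0,s}\Delta)$, where $\Sigma^{s,0,0,s}\Delta$ is the triangle $\Sigma^sA\to B\to D\to\Sigma^sTA$ obtained from $\Delta$ by composing with the $\eta$'s. For a family $\mathcal F$ of objects, $\delta^{\mathcal F}(X,X')$ is the infimum of $\sum_i\bar w(\Delta_i)$ over all sequences of exact triangles $\Delta_i:X_i\to Y_{i-1}\to Y_i\to TX_i$ ($1\le i\le n$) of $\mathcal C_\infty$ with $Y_0=0$, $Y_n=X$, where one of the $X_i$ is $T^{-1}X'$ and all others are in $\mathcal F$; and $d^{\mathcal F}(X,X')=\max\{\delta^{\mathcal F}(X,X'),\delta^{\mathcal F}(X',X)\}$. *Filtered complexes.* $\mathcal C^{\rm fg}$ is the TPC of bounded complexes of finite-dimensional filtered $k$-vector spaces, $\hom^\alpha(X,Y)$ being the chain maps that raise levels by at most $\alpha$, modulo homotopies that raise levels by at most $\alpha$; $\Sigma^r$ raises levels by $r$. $E_1(a)$ has one generator, of degree $0$ and level $a$; $E_2(b,c)$, $b\le c$, has generators $x$ (degree $0$, level $b$) and $y$ (degree $1$, level $c$) with $\partial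 y=x$; $X[s]=T^sX$. Every object is isomorphic to a finite direct sum of shifts of complexes $E_1(a)$ and $E_2(b,c)$, $b<c$; the corresponding multiset of intervals $[a,\infty)$ and $[b,c)$ is its barcode. The bottleneck distance $d_{\rm bot}(X,Y)$ is the infimum of the $\tau>0$ such that, after deleting from the two barcodes some finite intervals $[b,c)$ with $c-b\le2\tau$, there is a bijection between the remaining intervals which matches finite intervals with finite intervals and infinite ones with infinite ones, moving all end points by at most $\tau$. (Bijections may be required to preserve the degrees of the intervals or not; the statement holds in both versions.) $\Lambda_P$ is the ring of finite sums $\sum n_it^{a_i}$, $n_i\in\mathbb Z$, $a_i\in\mathbb R$. **Proposition.** (i) Let $\mathcal C$ be a TPC and $d$ a pseudo-metric on its objects with $d(X\oplus X',Y\oplus Y')\le d(X,Y)+d(X',Y')$. Then $$\bar d(x,y)=\inf\{d(X,Y)\mid [X]=x,\ [Y]=y\}$$ is a pseudo-metric on $K(\mathcal C)$, and $\bar d(x+z,y+z)=\bar d(x,y)$ for all $x,y,z$. If $d$ is finite, so is $\bar d$. There is an isomorphism of groups $\lambda:K(\mathcal C^{\rm fg})\cong\Lambda_P$ with $\lambda[E_1(a)]=t^a$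 for all $a\in\mathbb R$, and: (ii) $\bar d_{\rm bot}$ is a pseudo-metric on $K(\mathcal C^{\rm fg})$ that takes only the values $0$ and $\infty$, and $\bar d_{\rm bot}([E_1(0)],0)=\infty$. (iii) For $\mathcal F=\{E_1(0)[s]\}_{s\in\mathbb Z}$, the induced pseudo-metric $\bar d^{\mathcal F}$ on $K(\mathcal C^{\rm fg})$ vanishes. (iv) Let $\mathcal C$, $d$ be as in (i), and let $\mathcal S$ be a class of objects that is closed under direct sums and represents every element of $K(\mathcal C)$. If $d(0\oplus0,0)=0$ (for example if isomorphic objects are at distance $0$), then $$\|x\|_{d,\mathcal S}=\inf\{d(X,0)\mid X\in\mathcal S,\ [X]=x\}$$ satisfies $\|x+y\|_{d,\mathcal S}\le\|x\|_{d,\mathcal S}+\|y\|_{d,\mathcal S}$; it satisfies $\|0\|_{d,\mathcal S}=0$ if $0\in\mathcal S$, and $\|-x\|_{d,\mathcal S}=\|x\|_{d,\mathcal S}$ if $TX\in\mathcal S$ and $d(TX,0)=d(X,0)$ for all $X\in\mathcal S$; and it is finite if $d$ is finite. For $\mathcal C=\mathcal C^{\rm fg}$, $d=d^{\mathcal F}$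 with $\mathcal F$ as in (iii), and $\mathcal S$ the class of complexes with trivial differential, $\mathcal S$ is closed under direct sums (up to isomorphism) and represents every element of $K(\mathcal C^{\rm fg})$, and $\|\cdot\|_{d,\mathcal S}$ is a group semi-norm ($\|0\|=0$, $\|-x\|=\|x\|$, $\|x+y\|\le\|x\|+\|y\|$), is finite, and satisfies $$\|t^a\|_{d,\mathcal S}=|a|\qquad\text{for all }a<0,$$ where $t^a$ stands for $\lambda^{-1}(t^a)$. -/

import Mathlib

open CategoryTheory Limits Pretriangulated
open scoped ZeroObject ENNReal

universe u v w

/-- A finite-dimensional filtered vector space, described by the level of its elements: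
`V^{≤ r} = {x | lev x ≤ r}` is an increasing, exhaustive filtration by subspaces; only `0` has
level `-∞`, and the infimum defining the level is attained. -/
structure FiltVect (k : Type u) [Field k] where
  carrier : Type u
  [addCommGroup : AddCommGroup carrier]
  [module : Module k carrier]
  [finite : FiniteDimensional k carrier]
  lev : carrier → WithBot ℝ
  lev_eq_bot_iff : ∀ x, lev x = ⊥ ↔ x = 0
  lev_smul : ∀ (c : k) (x : carrier), c ≠ 0 → lev (c • x) = lev x
  lev_add_le : ∀ x y, lev (x + y) ≤ max (lev x) (lev y)

noncomputable section

namespace FiltVect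

variable {k : Type u} [Field k]

attribute [instance] addCommGroup module finite

theorem lev_zero (V : FiltVect k) : V.lev 0 = ⊥ := (V.lev_eq_bot_iff 0).2 rfl

theorem lev_smul_le (V : FiltVect k) (c : k) (x : V.carrier) : V.lev (c • x) ≤ V.lev x := by
  by_cases hc : c = 0
  · subst hc; simp [lev_zero]
  · exact (V.lev_smul c x hc).le

/-- The linear maps that do not raise the level. -/
def homs (V W : FiltVect k) : Submodule k (V.carrier →ₗ[k] W.carrier) where
  carrier := {f | ∀ x, W.lev (f x) ≤ V.lev x}
  add_mem' {f g} hf hg x := (W.lev_add_le _ _).trans (max_le (hf x) (hg x))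
  zero_mem' x := by simp [lev_zero]
  smul_mem' c f hf x := (W.lev_smul_le c _).trans (hf x)

/-- Filtered vector spaces and the linear maps that do not raise the level. -/
instance : Category (FiltVect k) where
  Hom V W := homs V W
  id V := ⟨LinearMap.id, fun _ => le_rfl⟩
  comp f g := ⟨g.1.comp f.1, fun x => (g.2 _).trans (f.2 x)⟩

/-- The underlying linear map. -/
def Hom.lin {V W : FiltVect k} (f : V ⟶ W) : V.carrier →ₗ[k] W.carrier := Subtype.val f

/-- A linear map that does not raise the level, as a morphism. -/
def mkHom {V W : FiltVect k} (f : V.carrier →ₗ[k] W.carrier) (hf : ∀ x, W.lev (f x) ≤ V.lev x) :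
    V ⟶ W := ⟨f, hf⟩

@[simp] theorem lin_mkHom {V W : FiltVect k} (f : V.carrier →ₗ[k] W.carrier)
    (hf : ∀ x, W.lev (f x) ≤ V.lev x) : Hom.lin (mkHom f hf) = f := rfl

@[ext] theorem hom_ext {V W : FiltVect k} {f g : V ⟶ W}
    (h : ∀ x, Hom.lin f x = Hom.lin g x) : f = g :=
  Subtype.ext (LinearMap.ext h)

instance (V W : FiltVect k) : AddCommGroup (V ⟶ W) := inferInstanceAs (AddCommGroup (homs V W))
instance (V W : FiltVect k) : Module k (V ⟶ W) := inferInstanceAs (Module k (homs V W))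

theorem le_lev {V W : FiltVect k} (f : V ⟶ W) (x : V.carrier) : W.lev (Hom.lin f x) ≤ V.lev x :=
  Subtype.prop f x

@[simp] theorem lin_id (V : FiltVect k) : Hom.lin (𝟙 V) = LinearMap.id := rfl
@[simp] theorem lin_comp {U V W : FiltVect k} (f : U ⟶ V) (g : V ⟶ W) :
    Hom.lin (f ≫ g) = (Hom.lin g).comp (Hom.lin f) := rfl
@[simp] theorem lin_zero (V W : FiltVect k) : Hom.lin (0 : V ⟶ W) = 0 := rfl
@[simp] theorem lin_add {V W : FiltVect k} (f g : V ⟶ W) :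
    Hom.lin (f + g) = Hom.lin f + Hom.lin g := rfl
@[simp] theorem lin_smul {V W : FiltVect k} (c : k) (f : V ⟶ W) :
    Hom.lin (c • f) = c • Hom.lin f := rfl

instance : Preadditive (FiltVect k) where
  add_comp _ _ _ f f' g := by ext x; simp
  comp_add _ _ _ f g g' := by ext x; simp

instance : Linear k (FiltVect k) where
  smul_comp _ _ _ c f g := by ext x; simp
  comp_smul _ _ _ f c g := by ext x; simp

/-- The zero space. -/
abbrev zero : FiltVect k where
  carrier := PUnit
  lev _ := ⊥
  lev_eq_bot_iff _ := ⟨fun _ => rfl, fun _ => rfl⟩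
  lev_smul _ _ _ := rfl
  lev_add_le _ _ := by simp

instance : HasZeroObject (FiltVect k) :=
  ⟨zero, ⟨fun _ => ⟨⟨⟨0⟩, fun f => hom_ext fun x =>
      (congrArg (Hom.lin f) (Subsingleton.elim (α := PUnit) x 0)).trans (map_zero (Hom.lin f))⟩⟩,
    fun _ => ⟨⟨⟨0⟩, fun _ => hom_ext fun _ => Subsingleton.elim (α := PUnit) _ _⟩⟩⟩⟩

/-- The direct sum, filtered by the maximum. -/
abbrev prod (V W : FiltVect k) : FiltVect k where
  carrier := V.carrier × W.carrier
  lev x := max (V.lev x.1) (W.lev x.2)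
  lev_eq_bot_iff x := by
    rw [max_eq_bot, lev_eq_bot_iff, lev_eq_bot_iff, Prod.ext_iff]; rfl
  lev_smul c x hc := by simp [lev_smul, hc]
  lev_add_le x y := by
    refine max_le ((V.lev_add_le _ _).trans ?_) ((W.lev_add_le _ _).trans ?_)
    · exact max_le_max (le_max_left _ _) (le_max_left _ _)
    · exact max_le_max (le_max_right _ _) (le_max_right _ _)

/-- The direct sum as a biproduct. -/
def bicone (V W : FiltVect k) : BinaryBicone V W where
  pt := prod V W
  fst := mkHom (LinearMap.fst k _ _) fun _ => le_max_left _ _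
  snd := mkHom (LinearMap.snd k _ _) fun _ => le_max_right _ _
  inl := mkHom (LinearMap.inl k _ _) fun _ => max_le le_rfl ((lev_zero W).le.trans bot_le)
  inr := mkHom (LinearMap.inr k _ _) fun _ => max_le ((lev_zero V).le.trans bot_le) le_rfl
  inl_fst := hom_ext fun _ => rfl
  inl_snd := hom_ext fun _ => rfl
  inr_fst := hom_ext fun _ => rfl
  inr_snd := hom_ext fun _ => rfl

instance : HasBinaryBiproducts (FiltVect k) where
  has_binary_biproduct V W := HasBinaryBiproduct.mk ⟨bicone V W,
    isBinaryBilimitOfTotal _ (by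
      ext x
      change ((x.1, (0 : W.carrier)) + ((0 : V.carrier), x.2) : V.carrier × W.carrier) = x
      exact (Prod.mk_add_mk _ _ _ _).trans (by rw [add_zero, zero_add]; rfl))⟩

open Classical in
/-- The one-dimensional space with a generator at level `a`. -/
abbrev line (k : Type u) [Field k] (a : ℝ) : FiltVect k where
  carrier := k
  lev x := if x = 0 then ⊥ else (a : WithBot ℝ)
  lev_eq_bot_iff x := by simp
  lev_smul c x hc := if_congr (smul_eq_zero_iff_right (M := k) hc) rfl rfl
  lev_add_le x y := by
    by_cases hx : x = 0
    · subst hx; rw [zero_add]; exact le_max_right _ _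
    · rw [if_neg hx]
      refine le_trans ?_ (le_max_left _ _)
      split_ifs
      · exact bot_le
      · exact le_rfl

theorem line_lev (a : ℝ) (x : k) (hx : x ≠ 0) : (line k a).lev x = (a : WithBot ℝ) := if_neg hx

/-- The identity of `k`, from the line at level `c` to the line at level `b ≤ c`. -/
def lineMap {b c : ℝ} (h : b ≤ c) : line k c ⟶ line k b :=
  mkHom (LinearMap.id : k →ₗ[k] k) fun (x : k) => by
    change (line k b).lev x ≤ (line k c).lev x
    by_cases hx : x = 0
    · subst hx; exact ((lev_zero (line k b)).trans (lev_zero (line k c)).symm).le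
    · rw [line_lev b x hx, line_lev c x hx]
      exact WithBot.coe_le_coe.2 h

/-- Raising all levels by `r`. -/
abbrev raiseObj (r : ℝ) (V : FiltVect k) : FiltVect k where
  carrier := V.carrier
  lev x := V.lev x + (r : WithBot ℝ)
  lev_eq_bot_iff x := by simp [WithBot.add_eq_bot, lev_eq_bot_iff]
  lev_smul c x hc := by rw [V.lev_smul c x hc]
  lev_add_le x y := by
    rw [max_add_add_right]
    exact add_le_add_left (V.lev_add_le x y) _

/-- Raising all levels by `r`, as a functor. -/
def raise (r : ℝ) : FiltVect k ⥤ FiltVect k where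
  obj V := raiseObj r V
  map {V W} f := mkHom (V := raiseObj r V) (W := raiseObj r W) (Hom.lin (V := V) (W := W) f) fun x =>
    add_le_add_left (le_lev f x) _

instance (r : ℝ) : (raise (k := k) r).Additive where
  map_add := rfl

instance (r : ℝ) : (raise (k := k) r).Linear k where
  map_smul _ _ := rfl

/-- For `s ≤ r`, the identity map from the space raised by `r` to the space raised by `s`. -/
def lower {r s : ℝ} (h : s ≤ r) : raise (k := k) r ⟶ raise s where
  app V := mkHom (V := raiseObj r V) (W := raiseObj s V) LinearMap.id fun _ =>
    add_le_add_right (WithBot.coe_le_coe.2 h) _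
  naturality _ _ _ := rfl

/-- Raising by zero is the identity. -/
def raiseZero : raise (k := k) 0 ≅ 𝟭 _ where
  hom :=
    { app := fun V => mkHom (V := raiseObj 0 V) (W := V) LinearMap.id fun x => by
        change V.lev x ≤ V.lev x + ((0 : ℝ) : WithBot ℝ)
        simp
      naturality := fun _ _ _ => rfl }
  inv :=
    { app := fun V => mkHom (V := V) (W := raiseObj 0 V) LinearMap.id fun x => by
        change V.lev x + ((0 : ℝ) : WithBot ℝ) ≤ V.lev x
        simp
      naturality := fun _ _ _ => rfl }
  hom_inv_id := rfl
  inv_hom_id := rfl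

/-- Raising by `r` and then by `s` is raising by `t = r + s`. -/
def raiseAdd {r s t : ℝ} (h : r + s = t) : raise (k := k) t ≅ raise r ⋙ raise s where
  hom :=
    { app := fun V => mkHom (V := raiseObj t V) (W := raiseObj s (raiseObj r V)) LinearMap.id
        fun x => by
          change V.lev x + (r : WithBot ℝ) + (s : WithBot ℝ) ≤ V.lev x + (t : WithBot ℝ)
          rw [← h, WithBot.coe_add, add_assoc]
      naturality := fun _ _ _ => rfl }
  inv :=
    { app := fun V => mkHom (V := raiseObj s (raiseObj r V)) (W := raiseObj t V) LinearMap.id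
        fun x => by
          change V.lev x + (t : WithBot ℝ) ≤ V.lev x + (r : WithBot ℝ) + (s : WithBot ℝ)
          rw [← h, WithBot.coe_add, add_assoc]
      naturality := fun _ _ _ => rfl }
  hom_inv_id := rfl
  inv_hom_id := rfl

end FiltVect

end

noncomputable section

variable (k : Type u) [Field k]

/-- The finitely generated filtered complexes: bounded complexes of finite-dimensional filtered
vector spaces. Homological degree `n` is cohomological degree `-n`, so that the suspension `⟦1⟧`
raises the homological degree by one. The morphisms of the homotopy category are the filtered chain
maps modulo the homotopies that do not raise the level. -/
def fgProperty : ObjectProperty (HomotopyCategory (FiltVect k) (ComplexShape.up ℤ)) :=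
  fun K => {n : ℤ | ¬ IsZero (K.as.X n)}.Finite

instance : (fgProperty k).ContainsZero where
  exists_zero := ⟨(HomotopyCategory.quotient _ _).obj 0, Functor.map_isZero _ (isZero_zero _), by
    have : {n : ℤ | ¬ IsZero (((HomotopyCategory.quotient (FiltVect k) (ComplexShape.up ℤ)).obj
        0).as.X n)} = ∅ := by
      ext n
      simp only [Set.mem_ofPred_eq, Set.mem_empty_iff_false, iff_false, not_not]
      exact (HomologicalComplex.eval (FiltVect k) (ComplexShape.up ℤ) n).map_isZero
        (isZero_zero (HomologicalComplex (FiltVect k) (ComplexShape.up ℤ)))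
    change Set.Finite _
    rw [this]
    exact Set.finite_empty⟩

instance : (fgProperty k).IsStableUnderShift ℤ where
  isStableUnderShiftBy n :=
    { le_shift K hK := by
        obtain ⟨K, rfl⟩ := HomotopyCategory.quotient_obj_surjective K
        rw [ObjectProperty.prop_shift_iff, HomotopyCategory.shift_quotient_obj]
        change Set.Finite {i : ℤ | ¬ IsZero (K.X (i + n))}
        exact Set.Finite.preimage (f := fun i : ℤ => i + n) (fun a _ b _ h => by simpa using h) hK }

instance : (fgProperty k).IsTriangulatedClosed₃ where
  ext₃' T hT h₁ h₂ := by
    obtain ⟨f, hf⟩ := (HomotopyCategory.quotient _ _).map_surjective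
      (X := T.obj₁.as) (Y := T.obj₂.as) T.mor₁
    refine ⟨(HomotopyCategory.quotient _ _).obj (CochainComplex.mappingCone f), ?_,
      ⟨Triangle.π₃.mapIso (isoTriangleOfIso₁₂ T _ hT
        (HomotopyCategory.mappingCone_triangleh_distinguished f)
        (Iso.refl _) (Iso.refl _) ?_)⟩⟩
    · change Set.Finite {i : ℤ | ¬ IsZero ((CochainComplex.mappingCone f).X i)}
      have h₁' : Set.Finite {i : ℤ | ¬ IsZero (T.obj₁.as.X (i + 1))} :=
        Set.Finite.preimage (f := fun i : ℤ => i + 1) (fun a _ b _ h => by simpa using h) h₁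
      refine (h₁'.union h₂).subset fun i hi => ?_
      simp only [Set.mem_ofPred_eq, CochainComplex.mappingCone.isZero_X_iff, not_and_or] at hi
      exact hi
    · exact (Category.comp_id _).trans (hf.symm.trans (Category.id_comp _).symm)

instance : (fgProperty k).IsTriangulated where
  toIsTriangulatedClosed₂ := .of_isTriangulatedClosed₃

/-- The level-zero category of the category of finitely generated filtered complexes. -/
abbrev FGCat := (fgProperty k).FullSubcategory

instance : IsTriangulated (FGCat k) := inferInstance
instance : Linear k (FGCat k) := inferInstance
instance : HasBinaryBiproducts (FGCat k) := inferInstance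

namespace FGCat
variable {k}

theorem fg_map (F : FiltVect k ⥤ FiltVect k) [F.Additive]
    (X : FGCat k) : fgProperty k ((F.mapHomotopyCategory (ComplexShape.up ℤ)).obj X.obj) := by
  refine Set.Finite.subset X.property fun n hn hX => hn ?_
  exact F.map_isZero hX

/-- The functor on filtered complexes induced by an additive functor on filtered spaces. -/
def mapFG (F : FiltVect k ⥤ FiltVect k) [F.Additive] : FGCat k ⥤ FGCat k :=
  (fgProperty k).lift ((fgProperty k).ι ⋙ F.mapHomotopyCategory (ComplexShape.up ℤ)) (fg_map F)

instance (F : FiltVect k ⥤ FiltVect k) [F.Additive] : (mapFG F).CommShift ℤ :=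
  inferInstanceAs (((fgProperty k).lift
    ((fgProperty k).ι ⋙ F.mapHomotopyCategory (ComplexShape.up ℤ)) _).CommShift ℤ)

instance (F : FiltVect k ⥤ FiltVect k) [F.Additive] : (mapFG F).IsTriangulated :=
  inferInstanceAs (((fgProperty k).lift
    ((fgProperty k).ι ⋙ F.mapHomotopyCategory (ComplexShape.up ℤ)) _).IsTriangulated)

instance (F : FiltVect k ⥤ FiltVect k) [F.Additive] : (mapFG F).Additive :=
  inferInstance

instance (F : FiltVect k ⥤ FiltVect k) [F.Additive] [F.Linear k] : (mapFG F).Linear k where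
  map_smul {X Y} f r := by
    ext
    exact (F.mapHomotopyCategory (ComplexShape.up ℤ)).map_smul r f.hom

end FGCat
end

noncomputable section

/-- A persistence structure on the `k`-linear category `C`, whose morphisms are those of level zero.
The real number `α` indexes the morphisms `hom^α(X, Y)` of shift at most `α`, `incl` is the
persistence structure map `i_{α,β}`, and `comp f g` is the composition, first `f` and then `g`; the
equation between levels is an argument of `comp` so that no casts are needed. -/
class PersistenceCategory (k : Type w) [Field k] (C : Type u) [Category.{v} C] [Preadditive C]
    [Linear k C] where
  phom : ℝ → C → C → Type v
  [phomAddCommGroup : ∀ α X Y, AddCommGroup (phom α X Y)]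
  [phomModule : ∀ α X Y, Module k (phom α X Y)]
  incl : ∀ {α β : ℝ}, α ≤ β → ∀ {X Y : C}, phom α X Y →ₗ[k] phom β X Y
  incl_refl : ∀ {α : ℝ} {X Y : C} (f : phom α X Y), incl (le_refl α) f = f
  incl_incl : ∀ {α β γ : ℝ} (h : α ≤ β) (h' : β ≤ γ) {X Y : C} (f : phom α X Y),
    incl h' (incl h f) = incl (h.trans h') f
  comp : ∀ {α β γ : ℝ}, α + β = γ → ∀ {X Y Z : C},
    phom α X Y →ₗ[k] phom β Y Z →ₗ[k] phom γ X Z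
  incl_comp : ∀ {α β γ α' β' γ' : ℝ} (h : α + β = γ) (h' : α' + β' = γ')
    (hα : α ≤ α') (hβ : β ≤ β') (hγ : γ ≤ γ') {X Y Z : C} (f : phom α X Y) (g : phom β Y Z),
    comp h' (incl hα f) (incl hβ g) = incl hγ (comp h f g)
  comp_assoc : ∀ {α β γ αβ βγ δ : ℝ} (h₁ : α + β = αβ) (h₂ : β + γ = βγ) (h₃ : αβ + γ = δ)
    (h₄ : α + βγ = δ) {W X Y Z : C} (f : phom α W X) (g : phom β X Y) (h : phom γ Y Z),
    comp h₃ (comp h₁ f g) h = comp h₄ f (comp h₂ g h)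
  level0 : ∀ {X Y : C}, (X ⟶ Y) ≃ₗ[k] phom 0 X Y
  level0_comp : ∀ {X Y Z : C} (f : X ⟶ Y) (g : Y ⟶ Z),
    level0 (f ≫ g) = comp (add_zero 0) (level0 f) (level0 g)
  id_comp : ∀ {α : ℝ} {X Y : C} (f : phom α X Y), comp (zero_add α) (level0 (𝟙 X)) f = f
  comp_id : ∀ {α : ℝ} {X Y : C} (f : phom α X Y), comp (add_zero α) f (level0 (𝟙 Y)) = f

attribute [reducible] PersistenceCategory.phomAddCommGroup PersistenceCategory.phomModule
attribute [instance] PersistenceCategory.phomAddCommGroup PersistenceCategory.phomModule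

open PersistenceCategory

/-- `K` is `r`-acyclic: the identity of `K` vanishes in `hom^r(K, K)`. -/
def IsAcyclic (k : Type w) [Field k] {C : Type u} [Category.{v} C] [Preadditive C]
    [Linear k C] [PersistenceCategory k C] (r : ℝ) (K : C) : Prop :=
  ∃ h : 0 ≤ r, incl (k := k) h (level0 (k := k) (𝟙 K)) = 0

/-- A triangulated persistence category: the level-zero category `C` is triangulated, there are shift
functors `sigma r = Σʳ` that are triangulated on `C`, with natural isomorphisms
`η_{r,0} : Σʳ X → X` of shift `-r` (`eta`), of inverse `η_{0,r} : X → Σʳ X` of shift `r` (`etaInv`),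
and for `0 ≤ r` the morphism `η_r^X : Σʳ X → X` of level zero, the image of `η_{r,0}` under the
structure map, embeds into an exact triangle of `C` with `r`-acyclic third object. The isomorphisms
`η_{r,s} : Σʳ X → Σˢ X` are the compositions of `η_{r,0}` and `η_{0,s}`; a morphism `f` of any level
is sent by `Σʳ` to its conjugate by `η`; and `Σʳ Σˢ ≅ Σʳ⁺ˢ`, `Σ⁰ ≅ 1`, by the isomorphisms made of
`η`, which have shift zero. -/
class TPC (k : Type w) [Field k] (C : Type u) [Category.{v} C] [Preadditive C] [Linear k C]
    [HasZeroObject C] [HasShift C ℤ] [∀ n : ℤ, (shiftFunctor C n).Additive]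
    [Pretriangulated C] [IsTriangulated C] extends PersistenceCategory k C where
  sigma : ℝ → C ⥤ C
  [sigmaCommShift : ∀ r, (sigma r).CommShift ℤ]
  [sigma_isTriangulated : ∀ r, (sigma r).IsTriangulated]
  eta : ∀ (r : ℝ) (X : C), phom (-r) ((sigma r).obj X) X
  etaInv : ∀ (r : ℝ) (X : C), phom r X ((sigma r).obj X)
  eta_etaInv : ∀ (r : ℝ) (X : C),
    comp (neg_add_cancel r) (eta r X) (etaInv r X) = level0 (𝟙 ((sigma r).obj X))
  etaInv_eta : ∀ (r : ℝ) (X : C),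
    comp (add_neg_cancel r) (etaInv r X) (eta r X) = level0 (𝟙 X)
  eta_naturality : ∀ (r : ℝ) {X Y : C} (f : X ⟶ Y),
    comp (zero_add (-r)) (level0 ((sigma r).map f)) (eta r Y) =
      comp (add_zero (-r)) (eta r X) (level0 f)
  exists_triangle : ∀ (r : ℝ) (hr : 0 ≤ r) (X : C),
    ∃ (K : C) (g : X ⟶ K) (h : K ⟶ ((sigma r).obj X)⟦(1 : ℤ)⟧),
      Triangle.mk (level0.symm (incl (neg_nonpos.2 hr) (eta r X))) g h ∈ distTriang C ∧
        IsAcyclic k r K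

attribute [reducible] TPC.sigmaCommShift
attribute [instance] TPC.sigmaCommShift TPC.sigma_isTriangulated

namespace TPC

variable (k : Type w) [Field k] {C : Type u} [Category.{v} C] [Preadditive C] [Linear k C]
    [HasZeroObject C] [HasShift C ℤ] [∀ n : ℤ, (shiftFunctor C n).Additive]
    [Pretriangulated C] [IsTriangulated C] [TPC k C]

/-- `Σʳ X`. -/
abbrev shiftObj (r : ℝ) (X : C) : C := (sigma (k := k) r).obj X

/-- The morphism `η_r^X : Σʳ X → X` of level zero, for `0 ≤ r`. -/
def etaPos (r : ℝ) (hr : 0 ≤ r) (X : C) : shiftObj k r X ⟶ X :=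
  (level0 (k := k)).symm (incl (neg_nonpos.2 hr) (eta (k := k) r X))

/-- `f` is an `r`-isomorphism: it embeds into an exact triangle `A → B → K → TA` of `C` with
`r`-acyclic `K`. -/
def IsRIso (r : ℝ) {A B : C} (f : A ⟶ B) : Prop :=
  ∃ (K : C) (g : B ⟶ K) (h : K ⟶ A⟦(1 : ℤ)⟧),
    Triangle.mk f g h ∈ distTriang C ∧ IsAcyclic k r K

/-- `A → B → D → Σ⁻ʳ T A` is a strict exact triangle of weight `r`: there are an exact triangle
`A → B → D' → T A` of `C`, an `r`-isomorphism `φ : D' → D` and a right `r`-inverse `ψ : Σʳ D → D'` of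
`φ` (that is, `φ ∘ ψ = η_r^D`) with `v = φ ∘ v'` and `w' ∘ ψ = Σʳ w`, where `Σʳ w` is read as
`η_{-r,0} ∘ w ∘ η_{r,0} : Σʳ D → T A`. -/
def IsStrictExact (r : ℝ) {A B D : C} (u : A ⟶ B) (v : B ⟶ D)
    (w : D ⟶ shiftObj k (-r) (A⟦(1 : ℤ)⟧)) : Prop :=
  ∃ (hr : 0 ≤ r) (D' : C) (v' : B ⟶ D') (w' : D' ⟶ A⟦(1 : ℤ)⟧) (φ : D' ⟶ D)
    (ψ : shiftObj k r D ⟶ D'),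
    Triangle.mk u v' w' ∈ distTriang C ∧ IsRIso k r φ ∧ ψ ≫ φ = etaPos k r hr D ∧
      v' ≫ φ = v ∧
      level0 (k := k) (ψ ≫ w') =
        comp (add_neg_cancel (-r)) (comp (add_zero (-r)) (eta (k := k) r D) (level0 w))
          (eta (k := k) (-r) (A⟦(1 : ℤ)⟧))

open Classical in
/-- The morphisms of `C_∞`. -/
abbrev InftyHom (X Y : C) : Type _ :=
  Module.DirectLimit (R := k) (fun α : ℝ => phom k α X Y) (fun _ _ h => incl h)

/-- The class in `C_∞`. -/
def toInfty {X Y : C} (α : ℝ) : phom k α X Y →ₗ[k] InftyHom k X Y :=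
  Module.DirectLimit.of k ℝ (fun α : ℝ => phom k α X Y) (fun _ _ h => incl h) α

theorem toInfty_incl {X Y : C} {α β : ℝ} (h : α ≤ β) (f : phom k α X Y) :
    toInfty k β (incl h f) = toInfty k α f :=
  Module.DirectLimit.of_f

/-- The composition of `C_∞`, induced by the composition of homogeneous morphisms. -/
def inftyComp {X Y Z : C} : InftyHom k X Y →ₗ[k] InftyHom k Y Z →ₗ[k] InftyHom k X Z :=
  Module.DirectLimit.lift k ℝ _ _
    (fun α => LinearMap.flip (Module.DirectLimit.lift k ℝ _ _
      (fun β => LinearMap.flip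
        ((comp (rfl : α + β = α + β)).compr₂ (toInfty k (X := X) (Y := Z) (α + β))))
      (fun β β' h g => by
        ext f
        have e := incl_comp (k := k) (rfl : α + β = α + β) (rfl : α + β' = α + β') le_rfl h
          (add_le_add_right h α) f g
        rw [incl_refl] at e
        change toInfty k _ (comp _ f (incl h g)) = toInfty k _ (comp _ f g)
        rw [e, toInfty_incl])))
    (fun α α' h f => by
      ext β g
      have e := incl_comp (k := k) (rfl : α + β = α + β) (rfl : α' + β = α' + β) h le_rfl
        (add_le_add_left h β) f g
      rw [incl_refl] at e
      simp only [LinearMap.comp_apply, LinearMap.flip_apply, Module.DirectLimit.lift_of,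
        LinearMap.compr₂_apply]
      rw [e, toInfty_incl])

theorem inftyComp_toInfty {X Y Z : C} {α β γ : ℝ} (h : α + β = γ) (f : phom k α X Y)
    (g : phom k β Y Z) :
    inftyComp k (toInfty k α f) (toInfty k β g) = toInfty k γ (comp h f g) := by
  subst h
  simp only [inftyComp, toInfty, Module.DirectLimit.lift_of, LinearMap.flip_apply,
    LinearMap.compr₂_apply]

variable (C) in
/-- A triangle `A → B → D → T A` of `C_∞`. -/
structure InftyTriangle where
  obj₁ : C
  obj₂ : C
  obj₃ : C
  mor₁ : InftyHom k obj₁ obj₂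
  mor₂ : InftyHom k obj₂ obj₃
  mor₃ : InftyHom k obj₃ (obj₁⟦(1 : ℤ)⟧)

variable {k}

/-- The triangle of `C_∞` is represented by a strict exact triangle of weight `r`. Its morphisms have
representatives `u`, `v`, `w` of shifts `s₁`, `s₂ - s₁` and `r - s₂`, for some
`0 ≤ s₁ ≤ s₂ ≤ r`, such that `A → Σ^{-s₁} B → Σ^{-s₂} D → Σ^{-r} T A`, obtained from them by
composition with the isomorphisms `η`, is strict exact of weight `r`. -/
def InftyTriangle.HasStrictLift (Δ : InftyTriangle k C) (r : ℝ) : Prop :=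
  ∃ (s₁ s₂ : ℝ) (u : phom k s₁ Δ.obj₁ Δ.obj₂) (v : phom k (s₂ - s₁) Δ.obj₂ Δ.obj₃)
    (w : phom k (r - s₂) Δ.obj₃ (Δ.obj₁⟦(1 : ℤ)⟧)),
    0 ≤ s₁ ∧ s₁ ≤ s₂ ∧ s₂ ≤ r ∧
      toInfty k _ u = Δ.mor₁ ∧ toInfty k _ v = Δ.mor₂ ∧ toInfty k _ w = Δ.mor₃ ∧
      IsStrictExact k r (A := Δ.obj₁) (B := shiftObj k (-s₁) Δ.obj₂)
        (D := shiftObj k (-s₂) Δ.obj₃)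
        (level0.symm (comp (add_neg_cancel s₁) u (etaInv (-s₁) Δ.obj₂)))
        (level0.symm (comp (add_neg_cancel s₂)
          (comp (by ring : -(-s₁) + (s₂ - s₁) = s₂) (eta (-s₁) Δ.obj₂) v)
          (etaInv (-s₂) Δ.obj₃)))
        (level0.symm (comp (add_neg_cancel r)
          (comp (by ring : -(-s₂) + (r - s₂) = r) (eta (-s₂) Δ.obj₃) w)
          (etaInv (-r) (Δ.obj₁⟦(1 : ℤ)⟧))))

/-- The exact triangles of `C_∞`. -/
def InftyTriangle.IsExact (Δ : InftyTriangle k C) : Prop := ∃ r, Δ.HasStrictLift r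

/-- The unstable weight: the infimum of the weights of the strict exact triangles that represent the
triangle. -/
def InftyTriangle.unstableWeight (Δ : InftyTriangle k C) : ℝ≥0∞ :=
  ⨅ (r : ℝ) (_ : Δ.HasStrictLift r), ENNReal.ofReal r

/-- The triangle `Σˢ A → B → D → Σˢ T A ≅ T Σˢ A`, of which the morphisms are composed with the
isomorphisms `η`. -/
def InftyTriangle.shift (s : ℝ) (Δ : InftyTriangle k C) : InftyTriangle k C where
  obj₁ := shiftObj k s Δ.obj₁
  obj₂ := Δ.obj₂
  obj₃ := Δ.obj₃
  mor₁ := inftyComp k (toInfty k _ (eta s Δ.obj₁)) Δ.mor₁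
  mor₂ := Δ.mor₂
  mor₃ := inftyComp k (inftyComp k Δ.mor₃ (toInfty k _ (etaInv s (Δ.obj₁⟦(1 : ℤ)⟧))))
    (toInfty k _ (level0 (((sigma (k := k) s).commShiftIso (1 : ℤ)).hom.app Δ.obj₁)))

/-- The weight: the infimum of the unstable weights of the shifted triangles, for `0 ≤ s`. -/
def InftyTriangle.weight (Δ : InftyTriangle k C) : ℝ≥0∞ :=
  ⨅ (s : ℝ) (_ : 0 ≤ s), (Δ.shift s).unstableWeight

variable (k)

/-- `HasConeDecomposition k [X₁, …, Xₙ] X ω`: there are exact triangles `X₁ → 0 → Y₁ → T X₁`,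
`X₂ → Y₁ → Y₂ → T X₂`, …, `Xₙ → Yₙ₋₁ → X → T Xₙ` of `C_∞`, and the sum of their weights is `ω`. -/
inductive HasConeDecomposition : List C → C → ℝ≥0∞ → Prop
  | nil : HasConeDecomposition [] 0 0
  | snoc {l : List C} {ω : ℝ≥0∞} (Δ : InftyTriangle k C) (hΔ : Δ.IsExact)
      (h : HasConeDecomposition l Δ.obj₂ ω) :
      HasConeDecomposition (l ++ [Δ.obj₁]) Δ.obj₃ (ω + Δ.weight)

/-- `δ^F(X, X')`: the infimum of the weights of the cone decompositions of `X` with linearization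
`(F₁, …, T⁻¹ X', …, Fₙ)`, where all `Fᵢ` are in `F`. -/
def fragDelta (F : Set C) (X X' : C) : ℝ≥0∞ :=
  ⨅ (l₁ : List C) (l₂ : List C) (ω : ℝ≥0∞) (_ : ∀ Z ∈ l₁, Z ∈ F) (_ : ∀ Z ∈ l₂, Z ∈ F)
    (_ : HasConeDecomposition k (l₁ ++ [X'⟦(-1 : ℤ)⟧] ++ l₂) X ω), ω

/-- The fragmentation pseudo-metric `d^F`. -/
def fragDist (F : Set C) (X X' : C) : ℝ≥0∞ := max (fragDelta k F X X') (fragDelta k F X' X)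

end TPC
end

noncomputable section
namespace FGCat
open FiltVect PersistenceCategory
variable {k : Type u} [Field k]

/-- The shift functor `Σʳ`, which raises all levels by `r`. -/
def sigmaFG (r : ℝ) : FGCat k ⥤ FGCat k := mapFG (raise r)

instance (r : ℝ) : (sigmaFG (k := k) r).CommShift ℤ := inferInstanceAs ((mapFG (raise r)).CommShift ℤ)
instance (r : ℝ) : (sigmaFG (k := k) r).IsTriangulated :=
  inferInstanceAs ((mapFG (raise r)).IsTriangulated)
instance (r : ℝ) : (sigmaFG (k := k) r).Additive := inferInstance
instance (r : ℝ) : (sigmaFG (k := k) r).Linear k :=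
  inferInstanceAs ((mapFG (raise r)).Linear k)

/-- The object given by a bounded complex. -/
def ofComplex (K : CochainComplex (FiltVect k) ℤ) (hK : {n : ℤ | ¬ IsZero (K.X n)}.Finite) :
    FGCat k := ⟨(HomotopyCategory.quotient _ _).obj K, hK⟩

/-- The homotopy class of a filtered chain map. -/
def mk {X Y : FGCat k} (f : X.obj.as ⟶ Y.obj.as) : X ⟶ Y :=
  ObjectProperty.homMk ((HomotopyCategory.quotient _ _).map f)

theorem mk_surjective {X Y : FGCat k} (f : X ⟶ Y) : ∃ g, mk g = f := by
  obtain ⟨g, hg⟩ := (HomotopyCategory.quotient _ _).map_surjective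
      (X := X.obj.as) (Y := Y.obj.as) f.hom
  exact ⟨g, ObjectProperty.hom_ext _ hg⟩

theorem mk_comp {X Y Z : FGCat k} (f : X.obj.as ⟶ Y.obj.as) (g : Y.obj.as ⟶ Z.obj.as) :
    mk f ≫ mk g = mk (X := X) (Y := Z) (f ≫ g) := by
  ext
  exact ((HomotopyCategory.quotient _ _).map_comp f g).symm

theorem mk_id (X : FGCat k) : mk (𝟙 X.obj.as) = 𝟙 X := by
  ext
  exact (HomotopyCategory.quotient _ _).map_id _

theorem sigmaFG_map_mk (r : ℝ) {X Y : FGCat k} (f : X.obj.as ⟶ Y.obj.as) :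
    (sigmaFG r).map (mk f) =
      mk (X := (sigmaFG r).obj X) (Y := (sigmaFG r).obj Y)
        (((raise r).mapHomologicalComplex (ComplexShape.up ℤ)).map f) := rfl

/-- The morphism of filtered complexes induced by a natural transformation. -/
def natMk {F G : FiltVect k ⥤ FiltVect k} [F.Additive] [G.Additive] (α : F ⟶ G) (X : FGCat k) :
    (mapFG F).obj X ⟶ (mapFG G).obj X :=
  mk (X := (mapFG F).obj X) (Y := (mapFG G).obj X)
    ((NatTrans.mapHomologicalComplex α (ComplexShape.up ℤ)).app X.obj.as)

/-- For `s ≤ r`, the identity map `Σʳ X → Σˢ X`. -/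
def lowerFG {r s : ℝ} (h : s ≤ r) (X : FGCat k) : (sigmaFG r).obj X ⟶ (sigmaFG s).obj X :=
  natMk (lower h) X

/-- `Σ⁰ X ≅ X`. -/
def zeroFG (X : FGCat k) : (sigmaFG 0).obj X ≅ X where
  hom := natMk raiseZero.hom X
  inv := natMk raiseZero.inv X
  hom_inv_id := rfl
  inv_hom_id := rfl

/-- `Σʳ⁺ˢ X ≅ Σˢ Σʳ X`. -/
def splitFG {r s t : ℝ} (h : r + s = t) (X : FGCat k) :
    (sigmaFG t).obj X ≅ (sigmaFG s).obj ((sigmaFG r).obj X) where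
  hom := natMk (raiseAdd h).hom X
  inv := natMk (raiseAdd h).inv X
  hom_inv_id := rfl
  inv_hom_id := rfl

/-- A map of shift at most `α` has shift at most `β` if `α ≤ β`. -/
def inclFG {α β : ℝ} (h : α ≤ β) {X Y : FGCat k} :
    ((sigmaFG α).obj X ⟶ Y) →ₗ[k] ((sigmaFG β).obj X ⟶ Y) :=
  Linear.leftComp k Y (lowerFG h X)

/-- The composition of maps of shift at most `α` and `β`. -/
def compFG {α β γ : ℝ} (h : α + β = γ) {X Y Z : FGCat k} :
    ((sigmaFG α).obj X ⟶ Y) →ₗ[k] ((sigmaFG β).obj Y ⟶ Z) →ₗ[k] ((sigmaFG γ).obj X ⟶ Z) :=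
  (Linear.comp _ _ _).comp
    ((Linear.leftComp k _ (splitFG h X).hom).comp ((sigmaFG β).mapLinearMap k))

/-- `hom^α(X, Y)` consists of the filtered maps `Σᵅ X → Y` up to filtered homotopy, that is of the
chain maps from `X` to `Y` that raise the level by at most `α`. -/
instance : PersistenceCategory k (FGCat k) where
  phom α X Y := (sigmaFG α).obj X ⟶ Y
  phomAddCommGroup _ _ _ := inferInstance
  phomModule _ _ _ := inferInstance
  incl h _ _ := inclFG h
  incl_refl {α X Y} f := by
    obtain ⟨f, rfl⟩ := mk_surjective f
    rfl
  incl_incl h h' X Y f := by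
    obtain ⟨f, rfl⟩ := mk_surjective f
    rfl
  comp h _ _ _ := compFG h
  incl_comp h h' hα hβ hγ X Y Z f g := by
    obtain ⟨f, rfl⟩ := mk_surjective f
    obtain ⟨g, rfl⟩ := mk_surjective g
    rfl
  comp_assoc h₁ h₂ h₃ h₄ W X Y Z f g h := by
    obtain ⟨f, rfl⟩ := mk_surjective f
    obtain ⟨g, rfl⟩ := mk_surjective g
    obtain ⟨h, rfl⟩ := mk_surjective h
    rfl
  level0 {X Y} := Linear.homCongr k (zeroFG X).symm (Iso.refl Y)
  level0_comp f g := by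
    obtain ⟨f, rfl⟩ := mk_surjective f
    obtain ⟨g, rfl⟩ := mk_surjective g
    rfl
  id_comp f := by
    obtain ⟨f, rfl⟩ := mk_surjective f
    rfl
  comp_id f := by
    obtain ⟨f, rfl⟩ := mk_surjective f
    rfl

/-- For `0 ≤ r`, the identity map from the space raised by `r` to the space itself. -/
def dropTo {r : ℝ} (hr : 0 ≤ r) : raise (k := k) r ⟶ 𝟭 _ := lower hr ≫ raiseZero.hom

/-- The component of `dropTo` at a filtered space. -/
def dropHom {r : ℝ} (hr : 0 ≤ r) (V : FiltVect k) : (raise r).obj V ⟶ V := (dropTo hr).app V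

theorem homotopy_aux {r : ℝ} (hr : 0 ≤ r) {C C₁ C' X X₁ : FiltVect k} (fst : C ⟶ (raise r).obj X₁)
    (snd : C ⟶ X) (snd₁ : C₁ ⟶ X₁) (d : C ⟶ C₁) (δ : X ⟶ X₁) (inl₁ : (raise r).obj X₁ ⟶ C)
    (inl₀ : (raise r).obj X ⟶ C') (d' : C' ⟶ C) (inr : X ⟶ C)
    (h₁ : d ≫ snd₁ = fst ≫ dropHom hr X₁ + snd ≫ δ)
    (h₂ : inl₀ ≫ d' = dropHom hr X ≫ inr - (raise r).map δ ≫ inl₁)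
    (h₃ : fst ≫ inl₁ + snd ≫ inr = 𝟙 C) :
    dropHom hr C =
      (raise r).map d ≫ ((raise r).map snd₁ ≫ inl₁) + ((raise r).map snd ≫ inl₀) ≫ d' := by
  have e₁ : (raise r).map (dropHom hr X₁) = dropHom hr ((raise r).obj X₁) := rfl
  have e₂ : ∀ {U V : FiltVect k} (f : U ⟶ V),
      (raise r).map f ≫ dropHom hr V = dropHom hr U ≫ f := fun _ => rfl
  rw [← Category.assoc, ← Functor.map_comp, h₁, Category.assoc, h₂, Functor.map_add,
    Functor.map_comp, Functor.map_comp, e₁, e₂, Preadditive.add_comp, Preadditive.comp_sub,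
    Category.assoc, Category.assoc, ← Category.assoc ((raise r).map snd) (dropHom hr X), e₂,
    Category.assoc, add_assoc, add_sub_cancel, ← Preadditive.comp_add, h₃]
  exact (Category.comp_id _).symm

open CochainComplex CochainComplex.HomComplex in
/-- The identity map from the cone of `Σʳ X → X`, raised by `r`, to this cone is null-homotopic. -/
theorem exists_homotopy {r : ℝ} (hr : 0 ≤ r) (K : CochainComplex (FiltVect k) ℤ)
    (φ : ((raise r).mapHomologicalComplex (ComplexShape.up ℤ)).obj K ⟶ K)
    (hφ : ∀ n, φ.f n = dropHom hr (K.X n))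
    (ψ : ((raise r).mapHomologicalComplex (ComplexShape.up ℤ)).obj (mappingCone φ) ⟶ mappingCone φ)
    (hψ : ∀ n, ψ.f n = dropHom hr ((mappingCone φ).X n)) :
    Nonempty (Homotopy ψ 0) := by
  let h : ∀ i j : ℤ, (((raise (k := k) r).mapHomologicalComplex (ComplexShape.up ℤ)).obj
      (mappingCone φ)).X i ⟶ (mappingCone φ).X j :=
    fun i j => if hij : j + 1 = i then
      (raise r).map ((mappingCone.snd φ).v i i (add_zero i)) ≫
        (mappingCone.inl φ).v i j (by omega) else 0
  refine ⟨{ hom := h, zero := fun i j hij => dif_neg hij, comm := fun i => ?_ }⟩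
  have hij : (ComplexShape.up ℤ).Rel i (i + 1) := rfl
  have hji : (ComplexShape.up ℤ).Rel (i - 1) i := by simp
  have e1 : h (i + 1) i = (raise r).map ((mappingCone.snd φ).v (i + 1) (i + 1) (add_zero _)) ≫
      (mappingCone.inl φ).v (i + 1) i (by omega) := dif_pos rfl
  have e2 : h i (i - 1) = (raise r).map ((mappingCone.snd φ).v i i (add_zero i)) ≫
      (mappingCone.inl φ).v i (i - 1) (by omega) := dif_pos (by omega)
  rw [dNext_eq h hij, prevD_eq h hji, e1, e2, hψ, HomologicalComplex.zero_f, add_zero]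
  refine homotopy_aux hr ((mappingCone.fst φ).1.v i (i + 1) rfl)
    ((mappingCone.snd φ).v i i (add_zero i)) _ _ (K.d i (i + 1)) _ _ _
    ((mappingCone.inr φ).f i) ?_ ?_ (mappingCone.id_X φ i (i + 1) rfl)
  · rw [← hφ]
    exact mappingCone.d_snd_v φ i (i + 1) rfl
  · rw [← hφ]
    exact mappingCone.inl_v_d φ i (i - 1) (i + 1) (by omega) (by omega)

theorem acyclic_of_iso {r : ℝ} {X Y : FGCat k} (e : X ≅ Y) (h : IsAcyclic k r Y) :
    IsAcyclic k r X := by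
  obtain ⟨hr, h⟩ := h
  refine ⟨hr, ?_⟩
  have h1 : lowerFG hr Y ≫ (zeroFG Y).hom = 0 := by
    have h2 : lowerFG hr Y ≫ (zeroFG Y).hom ≫ 𝟙 Y ≫ 𝟙 Y = 0 := h
    simpa using h2
  have h3 : (sigmaFG r).map e.hom ≫ (lowerFG hr Y ≫ (zeroFG Y).hom) =
      (lowerFG hr X ≫ (zeroFG X).hom) ≫ e.hom := by
    obtain ⟨f, hf⟩ := mk_surjective e.hom
    rw [← hf]
    rfl
  rw [h1, comp_zero] at h3
  have h4 : lowerFG hr X ≫ (zeroFG X).hom = 0 := by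
    rw [← cancel_mono e.hom, ← h3, zero_comp]
  change lowerFG hr X ≫ (zeroFG X).hom ≫ 𝟙 X ≫ 𝟙 X = 0
  simpa using h4

theorem exists_triangleFG (r : ℝ) (hr : 0 ≤ r) (X : FGCat k) :
    ∃ (K : FGCat k) (g : X ⟶ K) (h : K ⟶ ((sigmaFG r).obj X)⟦(1 : ℤ)⟧),
      Triangle.mk (natMk (dropTo hr) X : (sigmaFG r).obj X ⟶ X) g h ∈ distTriang (FGCat k) ∧
        IsAcyclic k r K := by
  obtain ⟨K, g, h, mem⟩ := distinguished_cocone_triangle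
    (natMk (dropTo hr) X : (sigmaFG r).obj X ⟶ X)
  refine ⟨K, g, h, mem, ?_⟩
  let φ : ((raise r).mapHomologicalComplex (ComplexShape.up ℤ)).obj X.obj.as ⟶ X.obj.as :=
    (NatTrans.mapHomologicalComplex (dropTo hr) (ComplexShape.up ℤ)).app X.obj.as
  have mem' := (fgProperty k).ι.map_distinguished _ mem
  let e : K.obj ≅ (HomotopyCategory.quotient _ _).obj (CochainComplex.mappingCone φ) :=
    Triangle.π₃.mapIso (isoTriangleOfIso₁₂ _ _ mem'
      (HomotopyCategory.mappingCone_triangleh_distinguished φ)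
      (Iso.refl _) (Iso.refl _) ((Category.comp_id _).trans (Category.id_comp _).symm))
  have hfin : {n : ℤ | ¬ IsZero ((CochainComplex.mappingCone φ).X n)}.Finite := by
    have h₁ : {i : ℤ | ¬ IsZero (X.obj.as.X (i + 1))}.Finite :=
      Set.Finite.preimage (f := fun i : ℤ => i + 1) (fun a _ b _ h => by simpa using h) X.property
    refine (h₁.union X.property).subset fun i hi => ?_
    simp only [Set.mem_ofPred_eq, CochainComplex.mappingCone.isZero_X_iff, not_and_or] at hi
    exact hi.imp_left fun h h' => h ((raise r).map_isZero h')
  refine acyclic_of_iso (Y := ofComplex _ hfin) ((fgProperty k).isoMk e) ⟨hr, ?_⟩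
  obtain ⟨H⟩ := exists_homotopy hr X.obj.as φ (fun _ => rfl)
    ((NatTrans.mapHomologicalComplex (dropTo hr) (ComplexShape.up ℤ)).app
      (CochainComplex.mappingCone φ)) (fun _ => rfl)
  have h0 := HomotopyCategory.eq_of_homotopy _ _ H
  rw [Functor.map_zero] at h0
  exact ObjectProperty.hom_ext _ h0

/-- `η_{r,0} : Σʳ X → X` and its inverse are given by the identity of the underlying complex. -/
instance : TPC k (FGCat k) where
  sigma := sigmaFG
  eta r X := (splitFG (add_neg_cancel r) X).inv ≫ (zeroFG X).hom
  etaInv r X := 𝟙 _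
  eta_etaInv r X := rfl
  etaInv_eta r X := rfl
  eta_naturality r X Y f := by
    obtain ⟨f, rfl⟩ := mk_surjective f
    rfl
  exists_triangle r hr X := exists_triangleFG r hr X
end FGCat
end

noncomputable section K0sec

variable (C : Type u) [Category.{v} C] [Preadditive C] [HasZeroObject C] [HasShift C ℤ]
    [∀ n : ℤ, (shiftFunctor C n).Additive] [Pretriangulated C]

/-- The Grothendieck group of a triangulated category: the free abelian group on its objects modulo
`[Y] = [X] + [Z]` for every exact triangle `X → Y → Z → TX`. -/
abbrev K0 : Type u :=
  FreeAbelianGroup C ⧸ AddSubgroup.closure {x : FreeAbelianGroup C | ∃ T ∈ distTriang C,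
    x = FreeAbelianGroup.of T.obj₂ - FreeAbelianGroup.of T.obj₁ - FreeAbelianGroup.of T.obj₃}

variable {C}

/-- The class `[X]` of an object. -/
def K0.cls (X : C) : K0 C := QuotientAddGroup.mk (FreeAbelianGroup.of X)

/-- `d̄(x, y) = inf { d(X, Y) | [X] = x, [Y] = y }`. -/
def inducedDist (d : C → C → ℝ≥0∞) (x y : K0 C) : ℝ≥0∞ :=
  ⨅ (X : C) (Y : C) (_ : K0.cls X = x) (_ : K0.cls Y = y), d X Y

/-- `‖x‖ = inf { d(X, 0) | X ∈ S, [X] = x }`. -/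
def strongNorm (d : C → C → ℝ≥0∞) (S : Set C) (x : K0 C) : ℝ≥0∞ :=
  ⨅ (X : C) (_ : X ∈ S) (_ : K0.cls X = x), d X 0

/-- `sum` is a choice of a direct sum for every pair of objects. -/
def IsDirectSum (sum : C → C → C) : Prop := ∀ X Y : C, Nonempty (sum X Y ≅ X ⊞ Y)

end K0sec

/-- A pseudo-metric, with the value `∞` allowed. -/
structure IsPseudoMetric {α : Type*} (d : α → α → ℝ≥0∞) : Prop where
  self : ∀ x, d x x = 0
  symm : ∀ x y, d x y = d y x
  triangle : ∀ x y z, d x z ≤ d x y + d y z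

/-- A group semi-norm, with the value `∞` allowed. -/
structure IsGroupSeminorm {A : Type*} [AddCommGroup A] (N : A → ℝ≥0∞) : Prop where
  zero : N 0 = 0
  neg : ∀ x, N (-x) = N x
  add_le : ∀ x y, N (x + y) ≤ N x + N y

noncomputable section
namespace FGCat
open FiltVect
variable (k : Type u) [Field k]

/-- `E₁(a)`: one generator, of degree `0` and level `a`. -/
def E₁ (a : ℝ) : FGCat k :=
  ofComplex ((HomologicalComplex.single (FiltVect k) (ComplexShape.up ℤ) 0).obj (line k a)) <| by
    refine (Set.finite_singleton (0 : ℤ)).subset fun n hn => ?_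
    by_contra h
    exact hn (HomologicalComplex.isZero_single_obj_X _ _ _ _ h)

/-- `E₂(b, c)`: a generator `x` of degree `0` and level `b` and a generator `y` of degree `1` and
level `c`, with differential `y ↦ x`. -/
def E₂ {b c : ℝ} (h : b ≤ c) : FGCat k :=
  ofComplex (HomologicalComplex.double (c := ComplexShape.up ℤ) (i₀ := -1) (i₁ := 0)
    (lineMap (k := k) h) (by simp)) <| by
    refine (Set.toFinite ({-1, 0} : Set ℤ)).subset fun n hn => ?_
    by_contra h'
    simp only [Set.mem_insert_iff, Set.mem_singleton_iff, not_or] at h'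
    exact hn (HomologicalComplex.isZero_double_X _ _ n h'.1 h'.2)

end FGCat

/-- The bars: the half-lines `[a, ∞)` and the intervals `[b, c)`. -/
inductive Bar : Type
  | ray (a : ℝ) : Bar
  | fin (b c : ℝ) (h : b < c) : Bar

namespace Bar

/-- The bars that may be left unmatched: those of length at most `2τ`. -/
def IsShort (τ : ℝ) : Bar → Prop
  | ray _ => False
  | fin b c _ => c - b ≤ 2 * τ

/-- The bars that may be matched: of the same kind, with end points at distance at most `τ`. -/
def IsClose (τ : ℝ) : Bar → Bar → Prop
  | ray a, ray c => |a - c| ≤ τ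
  | fin a b _, fin c d _ => max |a - c| |b - d| ≤ τ
  | _, _ => False

/-- The filtered complex with this bar in degree `0` as its barcode. -/
def toComplex (k : Type u) [Field k] : Bar → FGCat k
  | ray a => FGCat.E₁ k a
  | fin _ _ h => FGCat.E₂ k h.le

end Bar

/-- A barcode: a finite multiset of bars, each with its homological degree. -/
abbrev Barcode : Type := Multiset (ℤ × Bar)

/-- There is a `τ`-matching of the two barcodes: a bijection between sub-multisets of the two that
matches only `τ`-close bars (of the same degree if `graded` is true), and leaves out only bars of
length at most `2τ`. -/
def IsMatching (graded : Bool) (τ : ℝ) (B D : Barcode) : Prop :=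
  ∃ Bshort Blong Dshort Dlong : Barcode, B = Bshort + Blong ∧ D = Dshort + Dlong ∧
    (∀ x ∈ Bshort, x.2.IsShort τ) ∧ (∀ x ∈ Dshort, x.2.IsShort τ) ∧
    Multiset.Rel (fun x y => (graded = true → x.1 = y.1) ∧ x.2.IsClose τ y.2) Blong Dlong

namespace FGCat
variable {k : Type u} [Field k]

/-- The direct sum of the filtered complexes of the bars, shifted by their degrees. -/
def barSum : List (ℤ × Bar) → FGCat k
  | [] => 0
  | (n, I) :: l => (I.toComplex k)⟦n⟧ ⊞ barSum l

/-- `B` is the barcode of `X`. -/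
def HasBarcode (X : FGCat k) (B : Barcode) : Prop :=
  ∃ l : List (ℤ × Bar), (l : Multiset (ℤ × Bar)) = B ∧ Nonempty (X ≅ barSum l)

/-- The bottleneck distance: the infimum of the `τ > 0` such that the barcodes are `τ`-matched, with
matchings that preserve the degree (`graded = true`) or not (`graded = false`). -/
def bottleneckDist (graded : Bool) (X Y : FGCat k) : ℝ≥0∞ :=
  ⨅ (B : Barcode) (D : Barcode) (_ : HasBarcode X B) (_ : HasBarcode Y D)
    (τ : ℝ) (_ : 0 < τ) (_ : IsMatching graded τ B D), ENNReal.ofReal τ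

variable (k)

/-- The family of all `E₁(0)[s]`. -/
def stdFamily : Set (FGCat k) := {X | ∃ s : ℤ, X = (E₁ k 0)⟦s⟧}

/-- The complexes with trivial differential. -/
def trivialDifferential : Set (FGCat k) := {X | ∀ i j : ℤ, X.obj.as.d i j = 0}

end FGCat
end

/-! Part (i) and the general half of (iv) rest on two facts. Every element of `K0 C` is the class of
an object, since suspension gives negatives and direct sums give sums. And direct sums are
subadditive for `d`, which makes the induced distance invariant under translations; the triangle
inequality follows by comparing `X ⊕ Y'` with `Y ⊕ Z` when `[Y] = [Y']`, and cancelling the common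
class.

For filtered complexes, the Euler characteristic of the part of level at most `t` is additive on
exact triangles, and its value on `E₁(a)` is `1` if `a ≤ t` and `0` otherwise. Splitting off lines
shows that the classes of the `E₁(a)` generate, and the Euler characteristics show that they are
independent (`fromPoly_surjective`, `fromPoly_injective`). In particular `[E₂(b, c)] = t^b - t^c`,
so telescoping sums of classes of arbitrarily short bars turn any `t^a` into `t^0`: modulo short
bars only the augmentation `∑ nᵢ` survives (`sub_augmentation_mem`). Matchings preserve it, exactly
or modulo two according to whether degrees are respected, which gives (ii). For (iii), the remaining
multiple of `t^0` is represented by objects of the family, which can be attached at no cost, and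
sums of short bars are `r`-acyclic for small `r` (`inducedDist_fragDist`).

For the norm, the stable weight allows an attached object `A` to be replaced by `Σˢ A`, `0 ≤ s`, at
no cost (`exists_strictLift_shift`), so all `E₁(a)⟦n⟧` with `0 ≤ a` are free (`build_raySum`). A sum
of rays realized with levels at least `-r` is within `r` of `0`: raising its negative levels to zero
gives a free object. Conversely, suppose that all cycles of level below some `c ≤ 0` are boundaries.
This survives attaching an object without negative levels, except that a triangle of weight `r`
lowers `c` by `r` (`CyclesBound`). If the differential is trivial, every element is a cycle and only
`0` is a boundary. Hence the norm of `∑ nᵢ t^{aᵢ}`, over the exponents with non-zero coefficient, is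
the maximum of `0` and the `-aᵢ` (`strongNorm_eq`), and the remaining claims are read off from this
formula. -/

section GrothendieckGroup

variable {C : Type u} [Category.{v} C] [Preadditive C] [HasZeroObject C] [HasShift C ℤ]
    [∀ n : ℤ, (shiftFunctor C n).Additive] [Pretriangulated C]

/-! ### The Grothendieck group and the distances and norms induced on it -/

namespace K0

theorem cls_triangle {T : Triangle C} (hT : T ∈ distTriang C) :
    cls T.obj₂ = cls T.obj₁ + cls T.obj₃ := by
  have h : (QuotientAddGroup.mk (FreeAbelianGroup.of T.obj₂ - FreeAbelianGroup.of T.obj₁ -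
      FreeAbelianGroup.of T.obj₃) : K0 C) = 0 :=
    (QuotientAddGroup.eq_zero_iff _).2 (AddSubgroup.subset_closure ⟨T, hT, rfl⟩)
  have h' : cls T.obj₂ - cls T.obj₁ - cls T.obj₃ = (0 : K0 C) := h
  rwa [sub_sub, sub_eq_zero] at h'

theorem cls_zero : cls (0 : C) = (0 : K0 C) := by
  have h : (cls (0 : C) : K0 C) = cls (0 : C) + cls (0 : C) :=
    cls_triangle (contractible_distinguished (0 : C))
  simpa using h

theorem cls_iso {X Y : C} (e : X ≅ Y) : (cls X : K0 C) = cls Y := by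
  have h : (cls X : K0 C) = cls Y + cls (0 : C) :=
    cls_triangle (isomorphic_distinguished _ (contractible_distinguished X)
      (Triangle.mk e.inv (0 : X ⟶ 0) 0)
      (Triangle.isoMk _ _ e.symm (Iso.refl _) (Iso.refl _)
        ((Category.comp_id _).trans (Category.comp_id _).symm)
        (zero_comp.trans comp_zero.symm) (zero_comp.trans comp_zero.symm)))
  rwa [cls_zero, add_zero] at h

theorem cls_of_isZero {X : C} (h : IsZero X) : (cls X : K0 C) = 0 := by
  rw [cls_iso h.isoZero, cls_zero]

theorem cls_biprod [HasBinaryBiproducts C] (X Y : C) : (cls (X ⊞ Y) : K0 C) = cls X + cls Y :=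
  cls_triangle (binaryBiproductTriangle_distinguished X Y)

theorem cls_shift_one (X : C) : (cls (X⟦(1 : ℤ)⟧) : K0 C) = -cls X := by
  have h : (cls (0 : C) : K0 C) = cls X + cls (X⟦(1 : ℤ)⟧) :=
    cls_triangle (rot_of_distTriang _ (contractible_distinguished X))
  rw [cls_zero] at h
  exact eq_neg_of_add_eq_zero_right h.symm

theorem cls_shift (n : ℤ) (X : C) : (cls (X⟦n⟧) : K0 C) = n.negOnePow • cls X := by
  induction n using Int.induction_on with
  | zero => rw [cls_iso ((shiftFunctorZero C ℤ).app X)]; simp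
  | succ n ih =>
    rw [cls_iso ((shiftFunctorAdd C (n : ℤ) 1).app X)]
    dsimp
    rw [cls_shift_one, ih, Int.negOnePow_succ, Units.neg_smul]
  | pred n ih =>
    have h := cls_shift_one (X⟦(-(n : ℤ) - 1)⟧)
    have e : (cls (X⟦(-(n : ℤ))⟧) : K0 C) = cls ((X⟦(-(n : ℤ) - 1)⟧)⟦(1 : ℤ)⟧) :=
      cls_iso ((shiftFunctorAdd' C (-(n : ℤ) - 1) 1 (-n) (by ring)).app X)
    rw [← e, ih] at h
    rw [← neg_eq_iff_eq_neg.2 h, Int.negOnePow_sub, Int.negOnePow_one]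
    simp

/-- Formal differences are not needed, because `TX` represents `-[X]`. This makes the infima that
define the induced distance run over non-empty sets. -/
theorem exists_cls_eq [HasBinaryBiproducts C] (x : K0 C) : ∃ X : C, cls X = x := by
  obtain ⟨x, rfl⟩ := QuotientAddGroup.mk_surjective x
  induction x using FreeAbelianGroup.induction_on with
  | zero => exact ⟨0, cls_zero⟩
  | of X => exact ⟨X, rfl⟩
  | neg X h => exact ⟨X⟦(1 : ℤ)⟧, cls_shift_one X⟩
  | add x y hx hy =>
    obtain ⟨X, hX⟩ := hx
    obtain ⟨Y, hY⟩ := hy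
    exact ⟨X ⊞ Y, by rw [cls_biprod, hX, hY]; rfl⟩

/-- A function on objects that is additive on exact triangles induces a map of the Grothendieck
group. -/
noncomputable def lift {A : Type*} [AddCommGroup A] (f : C → A)
    (hf : ∀ T ∈ distTriang C, f T.obj₂ = f T.obj₁ + f T.obj₃) : K0 C →+ A :=
  QuotientAddGroup.lift _ (FreeAbelianGroup.lift f) (by
    rw [AddSubgroup.closure_le]
    rintro _ ⟨T, hT, rfl⟩
    simp [hf T hT])

@[simp] theorem lift_cls {A : Type*} [AddCommGroup A] (f : C → A)
    (hf : ∀ T ∈ distTriang C, f T.obj₂ = f T.obj₁ + f T.obj₃) (X : C) : lift f hf (cls X) = f X :=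
  FreeAbelianGroup.lift_apply_of f X

end K0

theorem inducedDist_le (d : C → C → ℝ≥0∞) (X Y : C) :
    inducedDist d (K0.cls X) (K0.cls Y) ≤ d X Y :=
  iInf₂_le_of_le X Y (iInf₂_le_of_le rfl rfl le_rfl)

theorem strongNorm_le (d : C → C → ℝ≥0∞) {S : Set C} {X : C} (hX : X ∈ S) :
    strongNorm d S (K0.cls X) ≤ d X 0 :=
  iInf₂_le_of_le X hX (iInf_le_of_le rfl le_rfl)

theorem strongNorm_zero {d : C → C → ℝ≥0∞} (hd : IsPseudoMetric d) {S : Set C} (h0 : (0 : C) ∈ S) :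
    strongNorm d S 0 = 0 := by
  have h := strongNorm_le d h0
  rw [K0.cls_zero, hd.self] at h
  exact le_antisymm h bot_le

theorem strongNorm_neg {d : C → C → ℝ≥0∞} {S : Set C}
    (hS : ∀ X ∈ S, X⟦(1 : ℤ)⟧ ∈ S ∧ d (X⟦(1 : ℤ)⟧) 0 = d X 0) (x : K0 C) :
    strongNorm d S (-x) = strongNorm d S x := by
  have h : ∀ x : K0 C, strongNorm d S (-x) ≤ strongNorm d S x := fun x => by
    refine le_iInf₂ fun X hX => le_iInf fun hx => ?_
    rw [← hx, ← K0.cls_shift_one, ← (hS X hX).2]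
    exact strongNorm_le d (hS X hX).1
  refine (h x).antisymm ?_
  simpa using h (-x)

theorem strongNorm_ne_top {d : C → C → ℝ≥0∞} {S : Set C} (hS : ∀ x : K0 C, ∃ X ∈ S, K0.cls X = x)
    (hd : ∀ X Y, d X Y ≠ ⊤) (x : K0 C) : strongNorm d S x ≠ ⊤ := by
  obtain ⟨X, hX, rfl⟩ := hS x
  exact ne_top_of_le_ne_top (hd X 0) (strongNorm_le d hX)

variable [HasBinaryBiproducts C] {sum : C → C → C} {d : C → C → ℝ≥0∞}

theorem IsDirectSum.cls_sum (hs : IsDirectSum sum) (X Y : C) :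
    (K0.cls (sum X Y) : K0 C) = K0.cls X + K0.cls Y := by
  rw [K0.cls_iso (hs X Y).some, K0.cls_biprod]

/-- Adding the same object `Z` to both representatives costs `d Z Z = 0`. -/
theorem inducedDist_add_right_le (hs : IsDirectSum sum) (hd : IsPseudoMetric d)
    (hadd : ∀ X X' Y Y' : C, d (sum X X') (sum Y Y') ≤ d X Y + d X' Y') (x y z : K0 C) :
    inducedDist d (x + z) (y + z) ≤ inducedDist d x y := by
  obtain ⟨Z, rfl⟩ := K0.exists_cls_eq z
  refine le_iInf₂ fun X Y => le_iInf₂ fun hX hY => ?_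
  subst hX hY
  rw [← hs.cls_sum, ← hs.cls_sum]
  refine (inducedDist_le d _ _).trans ((hadd _ _ _ _).trans ?_)
  rw [hd.self, add_zero]

theorem inducedDist_add_right (hs : IsDirectSum sum) (hd : IsPseudoMetric d)
    (hadd : ∀ X X' Y Y' : C, d (sum X X') (sum Y Y') ≤ d X Y + d X' Y') (x y z : K0 C) :
    inducedDist d (x + z) (y + z) = inducedDist d x y := by
  refine (inducedDist_add_right_le hs hd hadd x y z).antisymm ?_
  -- Translating back by `-z` gives the reverse inequality.
  simpa using inducedDist_add_right_le hs hd hadd (x + z) (y + z) (-z)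

theorem isPseudoMetric_inducedDist (hs : IsDirectSum sum) (hd : IsPseudoMetric d)
    (hadd : ∀ X X' Y Y' : C, d (sum X X') (sum Y Y') ≤ d X Y + d X' Y') :
    IsPseudoMetric (inducedDist d) where
  self x := by
    obtain ⟨X, rfl⟩ := K0.exists_cls_eq x
    exact le_antisymm ((inducedDist_le d X X).trans (hd.self X).le) bot_le
  symm := by
    have h : ∀ x y, inducedDist d x y ≤ inducedDist d y x := fun x y => by
      refine le_iInf₂ fun X Y => le_iInf₂ fun hX hY => ?_
      subst hX hY
      exact (inducedDist_le d _ _).trans (hd.symm _ _).le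
    exact fun x y => (h x y).antisymm (h y x)
  triangle x y z := by
    rw [inducedDist.eq_def d x y, inducedDist.eq_def d y z]
    simp only [ENNReal.iInf_add, ENNReal.add_iInf]
    refine le_iInf₂ fun Y' Z => le_iInf₂ fun hY' hZ => le_iInf₂ fun X Y => le_iInf₂ fun hX hY => ?_
    -- The middle representatives `Y` and `Y'` have the same class but may be far apart as objects.
    -- Comparing `X ⊕ Y'` with `Y ⊕ Z` only uses `d X Y` and `d Y' Z`, and the common class `y`
    -- cancels.
    rw [← inducedDist_add_right hs hd hadd x z y, add_comm z y, ← hX, ← hZ]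
    nth_rw 1 [← hY']
    rw [← hY, ← hs.cls_sum, ← hs.cls_sum]
    exact (inducedDist_le d _ _).trans (hadd _ _ _ _)

theorem inducedDist_ne_top (hd : ∀ X Y, d X Y ≠ ⊤) (x y : K0 C) : inducedDist d x y ≠ ⊤ := by
  obtain ⟨X, rfl⟩ := K0.exists_cls_eq x
  obtain ⟨Y, rfl⟩ := K0.exists_cls_eq y
  exact ne_top_of_le_ne_top (hd X Y) (inducedDist_le d X Y)

theorem strongNorm_add_le (hs : IsDirectSum sum) (hd : IsPseudoMetric d)
    (hadd : ∀ X X' Y Y' : C, d (sum X X') (sum Y Y') ≤ d X Y + d X' Y') {S : Set C}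
    (hS : ∀ X ∈ S, ∀ Y ∈ S, sum X Y ∈ S) (h0 : d (sum 0 0) 0 = 0) (x y : K0 C) :
    strongNorm d S (x + y) ≤ strongNorm d S x + strongNorm d S y := by
  rw [strongNorm.eq_def d S x, strongNorm.eq_def d S y]
  simp only [ENNReal.iInf_add, ENNReal.add_iInf]
  refine le_iInf₂ fun Y hY => le_iInf fun hy => le_iInf₂ fun X hX => le_iInf fun hx => ?_
  subst hx hy
  rw [← hs.cls_sum]
  -- Subadditivity compares `X ⊕ Y` with `0 ⊕ 0`, which need not be the object `0`; `h0` bridges the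
  -- two.
  refine (strongNorm_le d (hS X hX Y hY)).trans ((hd.triangle _ (sum 0 0) _).trans ?_)
  rw [h0, add_zero]
  exact hadd _ _ _ _

end GrothendieckGroup

/-! ### The shift of `FGCat k` in terms of the shift of complexes -/

theorem comp_eq_of_squares {C : Type*} [Category C] {A B D A' B' D' : C} {a : A ⟶ A'} {b : A' ⟶ B'}
    {m : B ⟶ B'} {b' : A ⟶ B} {c : B' ⟶ D'} {c' : B ⟶ D} {d : D ⟶ D'} (h₁ : a ≫ b = b' ≫ m)
    (h₂ : m ≫ c = c' ≫ d) : a ≫ b ≫ c = (b' ≫ c') ≫ d := by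
  rw [← Category.assoc, h₁, Category.assoc, h₂, Category.assoc]

theorem comp_eq_of_squares' {C : Type*} [Category C] {A B D E F H : C} {a : A ⟶ B} {b : B ⟶ D}
    {m : A ⟶ E} {g : E ⟶ D} {q' : E ⟶ F} {q : F ⟶ E} {p : F ⟶ H} {e : H ⟶ D} {e' : D ⟶ H}
    (h₁ : a ≫ b = m ≫ g) (h₂ : q ≫ g = p ≫ e) (hq : q' ≫ q = 𝟙 _) (he : e ≫ e' = 𝟙 _) :
    a ≫ b ≫ e' = (m ≫ q') ≫ p := by
  rw [← Category.assoc, h₁, Category.assoc, Category.assoc, ← Category.id_comp g, ← hq]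
  simp only [Category.assoc]
  rw [reassoc_of% h₂, he, Category.comp_id]

namespace FGCat
open FiltVect PersistenceCategory TPC
variable {k : Type u} [Field k]

theorem finite_shift (X : FGCat k) (n : ℤ) :
    {i : ℤ | ¬ IsZero (((X.obj.as : CochainComplex (FiltVect k) ℤ)⟦n⟧).X i)}.Finite :=
  Set.Finite.preimage (f := fun i : ℤ => i + n) (fun a _ b _ h => by simpa using h) X.property

/-- The shift of a complex, as an object of `FGCat k`. -/
noncomputable def shiftComplex (X : FGCat k) (n : ℤ) : FGCat k :=
  ofComplex ((X.obj.as : CochainComplex (FiltVect k) ℤ)⟦n⟧) (finite_shift X n)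

/-- The shift of `FGCat k` is the shift of the underlying complex. -/
noncomputable def shiftIso (X : FGCat k) (n : ℤ) : X⟦n⟧ ≅ shiftComplex X n :=
  (fgProperty k).isoMk (((fgProperty k).ι.commShiftIso n).app X ≪≫
    (((HomotopyCategory.quotient (FiltVect k) (ComplexShape.up ℤ)).commShiftIso n).app
      X.obj.as).symm)

theorem ι_shiftIso_hom (X : FGCat k) (n : ℤ) :
    (fgProperty k).ι.map (shiftIso X n).hom = ((fgProperty k).ι.commShiftIso n).hom.app X ≫
    ((HomotopyCategory.quotient (FiltVect k) (ComplexShape.up ℤ)).commShiftIso n).inv.app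
      X.obj.as := rfl

/-- Together with `commShiftIso_hom_app`, this transports the shift of `FGCat k`, which comes from
the homotopy category and its full subcategory, to the shift of complexes. There, maps built from
identities can be compared by `rfl`. -/
theorem shift_map_mk {X Y : FGCat k} (f : X.obj.as ⟶ Y.obj.as) (n : ℤ) :
    (mk f)⟦n⟧' = (shiftIso X n).hom ≫ mk (X := shiftComplex X n) (Y := shiftComplex Y n)
      ((shiftFunctor (CochainComplex (FiltVect k) ℤ) n).map f) ≫ (shiftIso Y n).inv := by
  rw [← Category.assoc, Iso.eq_comp_inv]
  apply (fgProperty k).ι.map_injective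
  rw [Functor.map_comp, Functor.map_comp, ι_shiftIso_hom, ι_shiftIso_hom]
  have h1 := ((fgProperty k).ι.commShiftIso n).hom.naturality (mk f)
  have h2 := ((HomotopyCategory.quotient (FiltVect k) (ComplexShape.up ℤ)).commShiftIso n).inv.naturality f
  exact comp_eq_of_squares h1 h2

/-- The commutation with the shift is inherited through two factorizations, one for the full
subcategory and one for the quotient by homotopy. Applying `NatTrans.shift_app_comm` to each gives
the two squares that are pasted at the end. -/
theorem commShiftIso_hom_app (F : FiltVect k ⥤ FiltVect k) [F.Additive] (n : ℤ) (X : FGCat k) :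
    ((mapFG F).commShiftIso n).hom.app X = (mapFG F).map (shiftIso X n).hom ≫
      mk (X := (mapFG F).obj (shiftComplex X n)) (Y := shiftComplex ((mapFG F).obj X) n)
      ((F.mapCochainComplexShiftIso n).hom.app X.obj.as) ≫ (shiftIso ((mapFG F).obj X) n).inv := by
  rw [← Category.assoc, Iso.eq_comp_inv]
  apply (fgProperty k).ι.map_injective
  have h1 := NatTrans.shift_app_comm ((fgProperty k).liftCompιIso ((fgProperty k).ι ⋙
    F.mapHomotopyCategory (ComplexShape.up ℤ)) (fg_map F)).hom n X
  rw [Functor.commShiftIso_comp_hom_app, Functor.commShiftIso_comp_hom_app] at h1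
  have h2 := NatTrans.shift_app_comm (F.mapHomotopyCategoryFactors (ComplexShape.up ℤ)).hom n
    (X.obj.as : CochainComplex (FiltVect k) ℤ)
  rw [Functor.commShiftIso_comp_hom_app, Functor.commShiftIso_comp_hom_app] at h2
  have h1' := ((congrArg _ (((shiftFunctor (HomotopyCategory (FiltVect k) (ComplexShape.up ℤ)) n).map_id _))).trans
    (Category.comp_id _)).symm.trans (h1.trans (Category.id_comp _))
  have h2' := ((congrArg _ (((shiftFunctor (HomotopyCategory (FiltVect k) (ComplexShape.up ℤ)) n).map_id _))).trans
    (Category.comp_id _)).symm.trans (h2.trans (Category.id_comp _))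
  have e : (fgProperty k).ι.map ((mapFG F).map (shiftIso X n).hom) =
    (F.mapHomotopyCategory (ComplexShape.up ℤ)).map (((fgProperty k).ι.commShiftIso n).hom.app X) ≫
    (F.mapHomotopyCategory (ComplexShape.up ℤ)).map
      (((HomotopyCategory.quotient (FiltVect k) (ComplexShape.up ℤ)).commShiftIso n).inv.app
      X.obj.as) := Functor.map_comp (F.mapHomotopyCategory (ComplexShape.up ℤ)) _ _
  rw [Functor.map_comp, Functor.map_comp, e]
  refine comp_eq_of_squares' h1' h2' ?_ ?_
  · exact ((F.mapHomotopyCategory (ComplexShape.up ℤ)).mapIso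
      (((HomotopyCategory.quotient (FiltVect k) (ComplexShape.up ℤ)).commShiftIso n).app
        X.obj.as)).inv_hom_id
  · exact Iso.hom_inv_id_app _ _

end FGCat

/-! ### Conjugation by `η` and the construction of strict exact triangles -/

namespace FGCat
open FiltVect PersistenceCategory TPC
variable {k : Type u} [Field k]

/-- The map of shift `s` given by a map `X ⟶ Σ⁻ˢ Y` of shift zero. -/
noncomputable def ofConj {s : ℝ} {X Y : FGCat k} (f : X ⟶ shiftObj k (-s) Y) : phom k s X Y :=
  comp (by ring : 0 + -(-s) = s) (level0 f) (eta (-s) Y)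

/-- Once `f` is represented by a chain map, all the `η` involved are identities of underlying
complexes, so the two sides agree by definition. The same device proves most compatibilities with
`η` below. -/
theorem conj_ofConj {s : ℝ} {X Y : FGCat k} (f : X ⟶ shiftObj k (-s) Y) :
    (level0 (k := k)).symm (comp (add_neg_cancel s) (ofConj f) (etaInv (-s) Y)) = f := by
  obtain ⟨f, rfl⟩ := mk_surjective f
  rfl

/-- The map of shift `t - s` given by a map `Σ⁻ˢ X ⟶ Σ⁻ᵗ Y` of shift zero. -/
noncomputable def ofConj₂ {s t : ℝ} {X Y : FGCat k} (f : shiftObj k (-s) X ⟶ shiftObj k (-t) Y) :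
    phom k (t - s) X Y :=
  comp (by ring : -s + t = t - s) (etaInv (-s) X) (ofConj f)

theorem conj_ofConj₂ {s t : ℝ} {X Y : FGCat k} (f : shiftObj k (-s) X ⟶ shiftObj k (-t) Y) :
    (level0 (k := k)).symm (comp (add_neg_cancel t)
      (comp (by ring : -(-s) + (t - s) = t) (eta (-s) X) (ofConj₂ f))
          (etaInv (-t) Y)) = f := by
  obtain ⟨f, rfl⟩ := mk_surjective f
  rfl

/-- The map `D ⟶ Σ⁻ʳ Y` given by a map `Σʳ D ⟶ Y`. -/
noncomputable def lowerHom {r : ℝ} {D Y : FGCat k} (f : shiftObj k r D ⟶ Y) : D ⟶ shiftObj k (-r) Y :=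
  ((zeroFG D).inv ≫ (splitFG (add_neg_cancel r) D).hom : D ⟶ (sigmaFG (-r)).obj ((sigmaFG r).obj D))
    ≫ (sigmaFG (-r)).map f

theorem level0_lowerHom {r : ℝ} {D Y : FGCat k} (f : shiftObj k r D ⟶ Y) :
    level0 (k := k) f = comp (add_neg_cancel (-r)) (comp (add_zero (-r)) (eta (k := k) r D)
      (level0 (lowerHom f))) (eta (k := k) (-r) Y) := by
  obtain ⟨f, rfl⟩ := mk_surjective f
  rfl

/-- The representatives in `C_∞` are obtained by undoing the conjugation with `η`, so that
conjugating them again, as the definition of a strict lift requires, returns the given maps of shift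
zero. -/
theorem hasStrictLift {A B D : FGCat k} {s₁ s₂ r : ℝ} (h₁ : 0 ≤ s₁) (h₂ : s₁ ≤ s₂) (h₃ : s₂ ≤ r)
    {D' : FGCat k} (u : A ⟶ shiftObj k (-s₁) B) (v : shiftObj k (-s₁) B ⟶ D') (w : D' ⟶ A⟦(1 : ℤ)⟧)
    (hT : Triangle.mk u v w ∈ distTriang (FGCat k)) (φ : D' ⟶ shiftObj k (-s₂) D)
    (hφ : IsRIso k r φ) (ψ : shiftObj k r (shiftObj k (-s₂) D) ⟶ D')
    (hψ : ψ ≫ φ = etaPos k r (h₁.trans (h₂.trans h₃)) _) :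
    InftyTriangle.HasStrictLift ⟨A, B, D, toInfty k _ (ofConj u), toInfty k _ (ofConj₂ (v ≫ φ)),
      toInfty k _ (ofConj₂ (lowerHom (ψ ≫ w)))⟩ r := by
  have key : IsStrictExact k r u (v ≫ φ) (lowerHom (ψ ≫ w)) :=
    ⟨h₁.trans (h₂.trans h₃), D', v, w, φ, ψ, hT, hφ, hψ, rfl, level0_lowerHom _⟩
  have h : ∀ u' v' w', u' = u → v' = v ≫ φ → w' = lowerHom (ψ ≫ w) → IsStrictExact k r u' v' w' := by
    rintro _ _ _ rfl rfl rfl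
    exact key
  exact ⟨s₁, s₂, ofConj u, ofConj₂ (v ≫ φ), ofConj₂ (lowerHom (ψ ≫ w)), h₁, h₂, h₃, rfl, rfl, rfl,
    h _ _ _ (conj_ofConj u) (conj_ofConj₂ _) (conj_ofConj₂ _)⟩

end FGCat

/-! ### Acyclicity, level shifts and their compatibility with suspension -/

namespace FGCat
open FiltVect PersistenceCategory TPC
variable {k : Type u} [Field k]

/-- The identity map `Σʳ X ⟶ X`, for `0 ≤ r`. -/
noncomputable def dropFG {r : ℝ} (hr : 0 ≤ r) (X : FGCat k) : (sigmaFG r).obj X ⟶ X :=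
  natMk (dropTo hr) X

theorem dropFG_naturality {r : ℝ} (hr : 0 ≤ r) {X Y : FGCat k} (f : X ⟶ Y) :
    (sigmaFG r).map f ≫ dropFG hr Y = dropFG hr X ≫ f := by
  obtain ⟨f, rfl⟩ := mk_surjective f
  rfl

/-- The image of the identity in `hom^r` is the drop map, so acyclicity becomes an equation in the
level-zero category. -/
theorem isAcyclic_iff {r : ℝ} (X : FGCat k) :
    IsAcyclic k r X ↔ ∃ hr : 0 ≤ r, dropFG hr X = 0 := by
  refine exists_congr fun hr => ?_
  have h : incl (k := k) hr (level0 (k := k) (𝟙 X)) = dropFG hr X := by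
    change lowerFG hr X ≫ (zeroFG X).hom ≫ 𝟙 X ≫ 𝟙 X = dropFG hr X
    rw [Category.comp_id, Category.comp_id]
    rfl
  rw [h]

/-- The identity map `Σʳ' Σᵗ X ⟶ Σᵗ Σʳ X`, for `r ≤ r'`. -/
noncomputable def swapFG {r r' : ℝ} (h : r ≤ r') (t : ℝ) (X : FGCat k) :
    (sigmaFG r').obj ((sigmaFG t).obj X) ⟶ (sigmaFG t).obj ((sigmaFG r).obj X) :=
  lowerFG h _ ≫ (splitFG rfl X).inv ≫ (splitFG (add_comm r t) X).hom

/-- The slack between `r` and `r'` is used in `exists_strictLift_shift`, where a right inverse of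
shift `r` serves in a triangle of weight `r + s`. -/
theorem swapFG_comp_map {r r' t : ℝ} (h : r ≤ r') (hr : 0 ≤ r) {X Y : FGCat k}
    (ψ : (sigmaFG r).obj Y ⟶ X) (φ : X ⟶ Y) (hψ : ψ ≫ φ = dropFG hr Y) :
    (swapFG h t Y ≫ (sigmaFG t).map ψ) ≫ (sigmaFG t).map φ =
      dropFG (hr.trans h) ((sigmaFG t).obj Y) := by
  rw [Category.assoc, ← Functor.map_comp, hψ]
  rfl

theorem isAcyclic_sigma {r r' : ℝ} (h : r ≤ r') (t : ℝ) {X : FGCat k} (hX : IsAcyclic k r X) :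
    IsAcyclic k r' ((sigmaFG t).obj X) := by
  rw [isAcyclic_iff] at hX ⊢
  obtain ⟨hr, hX⟩ := hX
  refine ⟨hr.trans h, ?_⟩
  rw [← swapFG_comp_map h hr (𝟙 _) (dropFG hr X) (Category.id_comp _), hX,
    Functor.map_zero, comp_zero]

theorem isRIso_sigma {r r' : ℝ} (h : r ≤ r') (t : ℝ) {X Y : FGCat k} {φ : X ⟶ Y}
    (hφ : IsRIso k r φ) : IsRIso k r' ((sigmaFG t).map φ) := by
  obtain ⟨K, g, h', hT, hK⟩ := hφ
  exact ⟨_, _, _, (sigmaFG t).map_distinguished _ hT, isAcyclic_sigma h t hK⟩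

/-- `X ≅ Σʳ X` for `r = 0`. -/
noncomputable def ofEqZero {r : ℝ} (h : r = 0) (X : FGCat k) : X ≅ (sigmaFG r).obj X where
  hom := (zeroFG X).inv ≫ lowerFG h.le X
  inv := lowerFG h.ge X ≫ (zeroFG X).hom
  hom_inv_id := rfl
  inv_hom_id := rfl

/-- `Σ⁻ˢ Σˢ X ≅ X`. -/
noncomputable def unshift (s : ℝ) (X : FGCat k) : (sigmaFG (-s)).obj ((sigmaFG s).obj X) ≅ X :=
  (splitFG (add_neg_cancel s) X).symm ≪≫ zeroFG X

theorem unshift_naturality (s : ℝ) {X Y : FGCat k} (f : X ⟶ Y) :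
    (sigmaFG (-s)).map ((sigmaFG s).map f) ≫ (unshift s Y).hom = (unshift s X).hom ≫ f := by
  obtain ⟨f, rfl⟩ := mk_surjective f
  rfl

theorem map_comp_iso_aux {C D : Type*} [Category C] [Category D] (F : C ⥤ D) {X Y Z Z' : C}
    {B B' E E' : D} {a : X ⟶ Y} {m : Y ⟶ Z} {i : Z' ≅ Z} {m' : F.obj Z ⟶ B} {j : B' ≅ B}
    {n : B ⟶ E} {l : E' ≅ E} {t : F.obj Y ⟶ E} {t' : F.obj X ⟶ E'} (h₁ : F.map m ≫ m' ≫ n = t)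
    (h₂ : F.map a ≫ t = t' ≫ l.hom) :
    F.map (a ≫ m ≫ i.inv) ≫ (F.map i.hom ≫ m' ≫ j.inv) ≫ (j.hom ≫ n ≫ l.inv) = t' := by
  have e : F.map i.inv ≫ F.map i.hom = 𝟙 _ := (F.mapIso i).inv_hom_id
  simp only [Functor.map_comp, Category.assoc, Iso.inv_hom_id_assoc, reassoc_of% e]
  rw [reassoc_of% h₁, ← Category.assoc, h₂, Category.assoc, Iso.hom_inv_id, Category.comp_id]

/-- Controls the third map of a triangle translated by `Σ⁻ˢ`: cancelling `Σˢ` before or after the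
suspension must give the same map. On complexes all maps involved are identities, which is the `rfl`
at the end. -/
theorem commShift_unshift (s : ℝ) (X : FGCat k) :
    (sigmaFG (-s)).map (((sigmaFG s).commShiftIso (1 : ℤ)).hom.app X) ≫
      ((sigmaFG (-s)).commShiftIso (1 : ℤ)).hom.app _ ≫ (unshift s X).hom⟦(1 : ℤ)⟧' =
      (unshift s (X⟦(1 : ℤ)⟧)).hom := by
  have h1 := commShiftIso_hom_app (raise s) 1 X
  have h2 := commShiftIso_hom_app (raise (-s)) 1 ((sigmaFG s).obj X)
  have h3 : ((sigmaFG s).commShiftIso (1 : ℤ)).hom.app X = _ := h1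
  have h4 : ((sigmaFG (-s)).commShiftIso (1 : ℤ)).hom.app ((sigmaFG s).obj X) = _ := h2
  have h5 := shift_map_mk (X := (sigmaFG (-s)).obj ((sigmaFG s).obj X)) (Y := X)
    ((NatTrans.mapHomologicalComplex ((raiseAdd (add_neg_cancel s)).inv ≫ raiseZero.hom)
      (ComplexShape.up ℤ)).app X.obj.as) 1
  have h6 : mk (X := (sigmaFG (-s)).obj ((sigmaFG s).obj X)) (Y := X)
    ((NatTrans.mapHomologicalComplex ((raiseAdd (add_neg_cancel s)).inv ≫ raiseZero.hom)
      (ComplexShape.up ℤ)).app X.obj.as) = (unshift s X).hom := rfl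
  rw [h6] at h5
  rw [h3, h4, h5]
  exact map_comp_iso_aux (sigmaFG (-s)) (t := (unshift s (shiftComplex X 1)).hom) rfl
    (unshift_naturality s (shiftIso X 1).hom)

theorem toInfty_congr {X Y : FGCat k} {α β : ℝ} (h : α ≤ β) (f : phom k α X Y) (g : phom k β X Y)
    (hfg : incl h f = g) : toInfty k α f = toInfty k β g := by
  rw [← hfg, toInfty_incl]

end FGCat

/-! ### Triangles of small stable weight -/

theorem TPC.hasStrictLift_shift_mk {k : Type w} [Field k] {C : Type u} [Category.{v} C] [Preadditive C] [Linear k C]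
    [HasZeroObject C] [HasShift C ℤ] [∀ n : ℤ, (shiftFunctor C n).Additive]
    [Pretriangulated C] [IsTriangulated C] [TPC k C] {s r : ℝ} {A B D : C}
    {n₁ : InftyHom k A B} {n₂ : InftyHom k B D} {n₃ : InftyHom k D (A⟦(1 : ℤ)⟧)}
    {m₁ : InftyHom k (shiftObj k s A) B} {m₂ : InftyHom k B D}
    {m₃ : InftyHom k D ((shiftObj k s A)⟦(1 : ℤ)⟧)}
    (h₁ : inftyComp k (toInfty k _ (eta s A)) n₁ = m₁) (h₂ : n₂ = m₂)
    (h₃ : inftyComp k (inftyComp k n₃ (toInfty k _ (etaInv s (A⟦(1 : ℤ)⟧))))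
      (toInfty k _ (PersistenceCategory.level0 (((sigma (k := k) s).commShiftIso (1 : ℤ)).hom.app A))) = m₃)
    (h : InftyTriangle.HasStrictLift ⟨shiftObj k s A, B, D, m₁, m₂, m₃⟩ r) :
    (InftyTriangle.shift s ⟨A, B, D, n₁, n₂, n₃⟩).HasStrictLift r := by
  subst h₁ h₂ h₃
  exact h

namespace FGCat
open FiltVect PersistenceCategory TPC
variable {k : Type u} [Field k]

/-- The maps of shift zero from `Σˢ A`, in terms of the maps from `A` of shift `s`. -/
noncomputable def unshiftHom {s : ℝ} {A B : FGCat k} (u : (sigmaFG s).obj A ⟶ B) :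
    A ⟶ (sigmaFG (-s)).obj B := (unshift s A).inv ≫ (sigmaFG (-s)).map u

/-- This and the next two lemmas identify, in `C_∞`, the three maps of a triangle translated by
`Σ⁻ˢ` and then shifted by `s` at its first object with the maps of the original triangle. -/
theorem toInfty_unshiftHom {s : ℝ} {A B : FGCat k} (u : (sigmaFG s).obj A ⟶ B) :
    inftyComp k (toInfty k _ (eta s A)) (toInfty k _ (ofConj (unshiftHom u))) =
      toInfty k _ (ofConj (u ≫ (ofEqZero neg_zero B).hom : (sigmaFG s).obj A ⟶ shiftObj k (-0) B)) := by
  rw [inftyComp_toInfty k (neg_add_cancel s)]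
  congr 1
  obtain ⟨u, rfl⟩ := mk_surjective u
  rfl

theorem toInfty_ofConj₂_map {s : ℝ} {B D : FGCat k} (v : B ⟶ D) :
    toInfty k _ (ofConj₂ ((sigmaFG (-s)).map v)) =
      toInfty k _ (ofConj₂ ((ofEqZero neg_zero B).inv ≫ v ≫ (ofEqZero neg_zero D).hom :
        shiftObj k (-0) B ⟶ shiftObj k (-0) D)) := by
  obtain ⟨v, rfl⟩ := mk_surjective v
  exact (toInfty_congr (by linarith) _ _ rfl)

theorem toInfty_mor₃ {s r : ℝ} (hs : 0 ≤ s) {D' D X Y : FGCat k}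
    (w : D' ⟶ (sigmaFG s).obj X) (c : (sigmaFG s).obj X ⟶ Y) (ψ : (sigmaFG r).obj D ⟶ D') :
    inftyComp k (inftyComp k (toInfty k _ (ofConj₂ (lowerHom (r := r + s)
      ((swapFG (by linarith) (-s) D ≫ (sigmaFG (-s)).map ψ) ≫
        (sigmaFG (-s)).map w ≫ (unshift s X).hom)))) (toInfty k _ (etaInv s X)))
        (toInfty k _ (level0 c)) =
      toInfty k _ (ofConj₂ (lowerHom (((sigmaFG r).map (ofEqZero neg_zero D).inv ≫ ψ) ≫ w ≫ c))) := by
  rw [inftyComp_toInfty k rfl, inftyComp_toInfty k rfl]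
  obtain ⟨w, rfl⟩ := mk_surjective w
  obtain ⟨ψ, rfl⟩ := mk_surjective ψ
  obtain ⟨c, rfl⟩ := mk_surjective c
  symm
  refine toInfty_congr (by linarith) _ _ ?_
  rfl


theorem comp_inv_aux {C : Type*} [Category C] {V W X Y Z : C} {w : V ⟶ W} {a : W ⟶ X} {b : X ⟶ Y}
    {c : Y ⟶ Z} {c' : Z ⟶ Y} {t : W ⟶ Z} (h : a ≫ b ≫ c = t) (hc : c ≫ c' = 𝟙 Y) :
    (w ≫ t) ≫ c' = 𝟙 V ≫ (w ≫ a) ≫ b := by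
  rw [← h]
  simp [hc]

theorem isRIso_comp_iso {r : ℝ} {X Y Z : FGCat k} {φ : X ⟶ Y} (hφ : IsRIso k r φ) (e : Y ≅ Z) :
    IsRIso k r (φ ≫ e.hom) := by
  obtain ⟨K, g, h, hT, hK⟩ := hφ
  refine ⟨K, e.inv ≫ g, h, isomorphic_distinguished _ hT _
    (Triangle.isoMk _ _ (Iso.refl _) e.symm (Iso.refl _) ?_ ?_ ?_), hK⟩
  · change (φ ≫ e.hom) ≫ e.inv = 𝟙 _ ≫ φ
    simp
  · change (e.inv ≫ g) ≫ 𝟙 _ = e.inv ≫ g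
    simp
  · change h ≫ (𝟙 X)⟦(1 : ℤ)⟧' = 𝟙 _ ≫ h
    simp

/-- The translate by `Σ⁻ˢ` starts at `A` and, with `s₁ = s₂ = s`, is strict exact of weight `r + s`;
this gives exactness in `C_∞`. Its shift by `s` is represented by the untranslated triangle with `s₁
= s₂ = 0`, of weight only `r`. Thus the stable weight does not charge for replacing `A` by `Σˢ A`.
-/
theorem exists_strictLift_shift {s r : ℝ} (hs : 0 ≤ s) (hr : 0 ≤ r) {A B D D' : FGCat k}
    (u : (sigmaFG s).obj A ⟶ B) (v : B ⟶ D') (w : D' ⟶ ((sigmaFG s).obj A)⟦(1 : ℤ)⟧)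
    (hT : Triangle.mk u v w ∈ distTriang (FGCat k)) (φ : D' ⟶ D) (hφ : IsRIso k r φ)
    (ψ : (sigmaFG r).obj D ⟶ D') (hψ : ψ ≫ φ = dropFG hr D) :
    ∃ Δ : InftyTriangle k (FGCat k), Δ.obj₁ = A ∧ Δ.obj₂ = B ∧ Δ.obj₃ = D ∧
      Δ.HasStrictLift (r + s) ∧ (Δ.shift s).HasStrictLift r := by
  let w'' : D' ⟶ (sigmaFG s).obj (A⟦(1 : ℤ)⟧) :=
    w ≫ ((sigmaFG s).commShiftIso (1 : ℤ)).inv.app A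
  have hw : w = w'' ≫ ((sigmaFG s).commShiftIso (1 : ℤ)).hom.app A := by
    rw [Category.assoc, Iso.inv_hom_id_app]
    exact (Category.comp_id _).symm
  have hT₁ : Triangle.mk (unshiftHom u) ((sigmaFG (-s)).map v)
      ((sigmaFG (-s)).map w'' ≫ (unshift s (A⟦(1 : ℤ)⟧)).hom) ∈ distTriang (FGCat k) := by
    refine isomorphic_distinguished _ ((sigmaFG (-s)).map_distinguished _ hT) _
      (Triangle.isoMk _ _ (unshift s A).symm (Iso.refl _) (Iso.refl _) ?_ ?_ ?_)
    · exact (Category.comp_id _)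
    · exact (Category.comp_id _).trans (Category.id_comp _).symm
    · have h := commShift_unshift s A
      have e : (sigmaFG (-s)).map w = (sigmaFG (-s)).map w'' ≫
          (sigmaFG (-s)).map (((sigmaFG s).commShiftIso (1 : ℤ)).hom.app A) := by
        rw [← Functor.map_comp, ← hw]
      change ((sigmaFG (-s)).map w'' ≫ (unshift s (A⟦(1 : ℤ)⟧)).hom) ≫ (unshift s A).inv⟦(1 : ℤ)⟧' =
        𝟙 _ ≫ (sigmaFG (-s)).map w ≫ ((sigmaFG (-s)).commShiftIso (1 : ℤ)).hom.app _
      have h' : (unshift s A).hom⟦(1 : ℤ)⟧' ≫ (unshift s A).inv⟦(1 : ℤ)⟧' = 𝟙 _ :=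
        ((shiftFunctor (FGCat k) (1 : ℤ)).mapIso (unshift s A)).hom_inv_id
      rw [e]
      exact comp_inv_aux h h'
  have L₁ := hasStrictLift (B := B) (D := D) hs le_rfl (by linarith : s ≤ r + s) (unshiftHom u)
    ((sigmaFG (-s)).map v) _ hT₁ ((sigmaFG (-s)).map φ) (isRIso_sigma (by linarith) (-s) hφ)
    (swapFG (by linarith) (-s) D ≫ (sigmaFG (-s)).map ψ) (swapFG_comp_map (by linarith) hr _ _ hψ)
  -- `Σ⁻⁰` is only isomorphic to the identity functor, so the untranslated triangle is first carried
  -- along `ofEqZero`.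
  have hT₀ : Triangle.mk (u ≫ (ofEqZero neg_zero B).hom) ((ofEqZero neg_zero B).inv ≫ v) w ∈
      distTriang (FGCat k) := by
    refine isomorphic_distinguished _ hT _
      (Triangle.isoMk _ _ (Iso.refl _) (ofEqZero neg_zero B).symm (Iso.refl _) ?_ ?_ ?_)
    · change (u ≫ (ofEqZero neg_zero B).hom) ≫ (ofEqZero neg_zero B).inv = 𝟙 _ ≫ u
      simp
    · change ((ofEqZero neg_zero B).inv ≫ v) ≫ 𝟙 _ = (ofEqZero neg_zero B).inv ≫ v
      simp
    · change w ≫ (𝟙 ((sigmaFG s).obj A))⟦(1 : ℤ)⟧' = 𝟙 _ ≫ w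
      simp
  have hψ₀ : ((sigmaFG r).map (ofEqZero neg_zero D).inv ≫ ψ) ≫ φ ≫ (ofEqZero neg_zero D).hom =
      dropFG hr _ := by
    rw [Category.assoc, ← Category.assoc ψ, hψ, ← dropFG_naturality, ← Category.assoc,
      ← Functor.map_comp, Iso.inv_hom_id, CategoryTheory.Functor.map_id, Category.id_comp]
  have L₀ := hasStrictLift (B := B) (D := D) le_rfl le_rfl hr _ _ _ hT₀
    (φ ≫ (ofEqZero neg_zero D).hom) (isRIso_comp_iso hφ _)
    ((sigmaFG r).map (ofEqZero neg_zero D).inv ≫ ψ) hψ₀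
  refine ⟨_, rfl, rfl, rfl, L₁, ?_⟩
  have e₂ : ofConj₂ ((sigmaFG (-s)).map v ≫ (sigmaFG (-s)).map φ) =
      ofConj₂ ((sigmaFG (-s)).map (v ≫ φ)) := by rw [← Functor.map_comp]
  have e₂' : (ofEqZero neg_zero B).inv ≫ (v ≫ φ) ≫ (ofEqZero neg_zero D).hom =
      ((ofEqZero neg_zero B).inv ≫ v) ≫ φ ≫ (ofEqZero neg_zero D).hom := by
    simp only [Category.assoc]
  have h₂ := (congrArg (toInfty k _) e₂).trans ((toInfty_ofConj₂_map (s := s) (v ≫ φ)).trans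
    (congrArg (fun x => toInfty k _ (ofConj₂ x)) e₂'))
  have h₃ := (toInfty_mor₃ hs w'' (((sigmaFG s).commShiftIso (1 : ℤ)).hom.app A) ψ).trans
    (congrArg (fun x => toInfty k _ (ofConj₂ (lowerHom
      (((sigmaFG r).map (ofEqZero neg_zero D).inv ≫ ψ) ≫ x)))) hw.symm)
  exact hasStrictLift_shift_mk (toInfty_unshiftHom u) h₂ h₃ L₀

end FGCat

/-! ### Steps of cone decompositions, and free sums of rays -/

namespace FGCat
open FiltVect PersistenceCategory TPC
variable {k : Type u} [Field k]

theorem exists_infty_triangle {s r : ℝ} (hs : 0 ≤ s) (hr : 0 ≤ r) {A B D : FGCat k}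
    (T : Triangle (FGCat k)) (hT : T ∈ distTriang (FGCat k)) (e₁ : (sigmaFG s).obj A ≅ T.obj₁)
    (e₂ : T.obj₂ ≅ B) (φ : T.obj₃ ⟶ D) (hφ : IsRIso k r φ)
    (ψ : (sigmaFG r).obj D ⟶ T.obj₃) (hψ : ψ ≫ φ = dropFG hr D) :
    ∃ Δ : InftyTriangle k (FGCat k), Δ.obj₁ = A ∧ Δ.obj₂ = B ∧ Δ.obj₃ = D ∧
      Δ.IsExact ∧ Δ.weight ≤ ENNReal.ofReal r := by
  obtain ⟨Δ, h₁, h₂, h₃, h, h'⟩ := exists_strictLift_shift hs hr (e₁.hom ≫ T.mor₁ ≫ e₂.hom)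
    (e₂.inv ≫ T.mor₂) (T.mor₃ ≫ e₁.inv⟦(1 : ℤ)⟧') (isomorphic_distinguished _ hT _
      (Triangle.isoMk _ _ e₁ e₂.symm (Iso.refl _) (by
        change (e₁.hom ≫ T.mor₁ ≫ e₂.hom) ≫ e₂.inv = e₁.hom ≫ T.mor₁
        simp) (by
        change (e₂.inv ≫ T.mor₂) ≫ 𝟙 _ = e₂.inv ≫ T.mor₂
        simp) (by
        change (T.mor₃ ≫ e₁.inv⟦(1 : ℤ)⟧') ≫ e₁.hom⟦(1 : ℤ)⟧' = 𝟙 _ ≫ T.mor₃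
        rw [Category.assoc, ← Functor.map_comp, e₁.inv_hom_id, CategoryTheory.Functor.map_id]
        exact (Category.comp_id _).trans (Category.id_comp _).symm))) φ hφ ψ hψ
  exact ⟨Δ, h₁, h₂, h₃, ⟨_, h⟩, iInf₂_le_of_le s hs (iInf₂_le r h')⟩

/-- All decompositions below are built with this step: only the correction of the cone by `φ` is
paid for, the passage from `A` to `Σˢ A` is not. -/
theorem hasConeDecomposition_snoc {s r : ℝ} (hs : 0 ≤ s) (hr : 0 ≤ r) {A B D : FGCat k}
    {l : List (FGCat k)} {ω : ℝ≥0∞} (h : HasConeDecomposition k l B ω)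
    (T : Triangle (FGCat k)) (hT : T ∈ distTriang (FGCat k)) (e₁ : (sigmaFG s).obj A ≅ T.obj₁)
    (e₂ : T.obj₂ ≅ B) (φ : T.obj₃ ⟶ D) (hφ : IsRIso k r φ)
    (ψ : (sigmaFG r).obj D ⟶ T.obj₃) (hψ : ψ ≫ φ = dropFG hr D) :
    ∃ ω', ω' ≤ ω + ENNReal.ofReal r ∧ HasConeDecomposition k (l ++ [A]) D ω' := by
  obtain ⟨Δ, rfl, rfl, rfl, hΔ, h'⟩ := exists_infty_triangle hs hr T hT e₁ e₂ φ hφ ψ hψ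
  exact ⟨_, add_le_add le_rfl h', .snoc Δ hΔ h⟩

theorem isAcyclic_of_isZero {r : ℝ} (hr : 0 ≤ r) {X : FGCat k} (hX : IsZero X) :
    IsAcyclic k r X := by
  rw [isAcyclic_iff]
  exact ⟨hr, hX.eq_of_tgt _ _⟩

theorem isRIso_of_iso {r : ℝ} (hr : 0 ≤ r) {X Y : FGCat k} (e : X ≅ Y) : IsRIso k r e.hom := by
  have h : IsRIso k r (𝟙 X) :=
    ⟨0, 0, 0, contractible_distinguished X, isAcyclic_of_isZero hr (isZero_zero _)⟩
  simpa using isRIso_comp_iso h e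

/-- A step of weight zero of a cone decomposition. -/
theorem hasConeDecomposition_snoc_iso {s : ℝ} (hs : 0 ≤ s) {A B D : FGCat k}
    {l : List (FGCat k)} {ω : ℝ≥0∞} (h : HasConeDecomposition k l B ω)
    (T : Triangle (FGCat k)) (hT : T ∈ distTriang (FGCat k)) (e₁ : (sigmaFG s).obj A ≅ T.obj₁)
    (e₂ : T.obj₂ ≅ B) (e₃ : T.obj₃ ≅ D) :
    ∃ ω', ω' ≤ ω ∧ HasConeDecomposition k (l ++ [A]) D ω' := by
  obtain ⟨ω', h₁, h₂⟩ := hasConeDecomposition_snoc hs le_rfl h T hT e₁ e₂ e₃.hom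
    (isRIso_of_iso le_rfl e₃) (dropFG le_rfl D ≫ e₃.inv) (by simp)
  exact ⟨ω', by simpa using h₁, h₂⟩

theorem fragDelta_le {F : Set (FGCat k)} {X X' : FGCat k} {l₁ l₂ : List (FGCat k)} {ω : ℝ≥0∞}
    (h₁ : ∀ Z ∈ l₁, Z ∈ F) (h₂ : ∀ Z ∈ l₂, Z ∈ F)
    (h : HasConeDecomposition k (l₁ ++ [X'⟦(-1 : ℤ)⟧] ++ l₂) X ω) : fragDelta k F X X' ≤ ω :=
  iInf₂_le_of_le l₁ l₂ (iInf₂_le_of_le ω h₁ (iInf₂_le_of_le h₂ h le_rfl))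

/-- The sum of `E₁(a)⟦n⟧` over the pairs `(n, a)`. -/
noncomputable abbrev raySum (k : Type u) [Field k] (l : List (ℤ × ℝ)) : FGCat k :=
  barSum (l.map fun p => (p.1, Bar.ray p.2))

/-- `Σᵃ E₁(b) ≅ E₁(a + b)`. -/
noncomputable def raiseLine (a b c : ℝ) (h : b + a = c) : (raise a).obj (line k b) ≅ line k c where
  hom := mkHom (V := raiseObj a (line k b)) (W := line k c) (LinearMap.id : k →ₗ[k] k) fun (x : k) => by
    change (line k c).lev x ≤ (line k b).lev x + a
    by_cases hx : x = 0
    · subst hx; exact ((lev_zero (line k c)).le.trans bot_le)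
    · rw [line_lev c x hx, line_lev b x hx, ← h]
      exact (WithBot.coe_add _ _).le
  inv := mkHom (V := line k c) (W := raiseObj a (line k b)) (LinearMap.id : k →ₗ[k] k) fun (x : k) => by
    change (line k b).lev x + a ≤ (line k c).lev x
    by_cases hx : x = 0
    · subst hx
      rw [show (line k b).lev (0 : k) = ⊥ from lev_zero _]
      exact (WithBot.bot_add _).le.trans bot_le
    · rw [line_lev c x hx, line_lev b x hx, ← h]
      exact (WithBot.coe_add _ _).ge
  hom_inv_id := rfl
  inv_hom_id := rfl

theorem mapFG_E₁ (F : FiltVect k ⥤ FiltVect k) [F.Additive] {a b : ℝ}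
    (e : F.obj (line k a) ≅ line k b) : Nonempty ((mapFG F).obj (E₁ k a) ≅ E₁ k b) := by
  let i : (F.mapHomologicalComplex (ComplexShape.up ℤ)).obj
      ((HomologicalComplex.single (FiltVect k) (ComplexShape.up ℤ) 0).obj (line k a)) ≅ 
      (HomologicalComplex.single (FiltVect k) (ComplexShape.up ℤ) 0).obj (line k b) :=
    (HomologicalComplex.singleMapHomologicalComplex F (ComplexShape.up ℤ) 0).app _ ≪≫
      (HomologicalComplex.single (FiltVect k) (ComplexShape.up ℤ) 0).mapIso e
  exact ⟨(fgProperty k).isoMk ((HomotopyCategory.quotient _ _).mapIso i)⟩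

/-- For `0 ≤ a`, the desuspension of `E₁(a)⟦n⟧` is `Σᵃ` of the member `E₁(0)⟦n - 1⟧` of the family.
Attaching it along the zero map adds the summand `E₁(a)⟦n⟧` at weight zero. -/
theorem build_raySum {l : List (ℤ × ℝ)} (hl : ∀ p ∈ l, 0 ≤ p.2) :
    ∃ L : List (FGCat k), (∀ Z ∈ L, Z ∈ stdFamily k) ∧ HasConeDecomposition k L (raySum k l) 0 := by
  induction l with
  | nil => exact ⟨[], by simp, .nil⟩
  | cons p l ih =>
    obtain ⟨n, a⟩ := p
    obtain ⟨L, hL, h⟩ := ih fun p hp => hl p (List.mem_cons_of_mem _ hp)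
    have ha : 0 ≤ a := hl (n, a) List.mem_cons_self
    obtain ⟨e⟩ := mapFG_E₁ (raise a) (raiseLine (k := k) a 0 a (zero_add a))
    have i : (sigmaFG a).obj ((E₁ k 0)⟦n - 1⟧) ≅ ((E₁ k a)⟦n⟧)⟦(-1 : ℤ)⟧ :=
      ((sigmaFG a).commShiftIso (n - 1)).app _ ≪≫ (shiftFunctor _ (n - 1)).mapIso e ≪≫
        (shiftFunctorAdd' (FGCat k) n (-1) (n - 1) (by ring)).app _
    obtain ⟨ω, hω, h'⟩ := hasConeDecomposition_snoc_iso ha h _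
      (inv_rot_of_distTriang _ (binaryBiproductTriangle_distinguished (raySum k l) ((E₁ k a)⟦n⟧)))
      i (Iso.refl _) (biprod.braiding _ _)
    have hω' : ω = 0 := le_antisymm hω bot_le
    subst hω'
    refine ⟨L ++ [(E₁ k 0)⟦n - 1⟧], fun Z hZ => ?_, h'⟩
    rw [List.mem_append, List.mem_singleton] at hZ
    exact hZ.elim (hL Z) fun h => ⟨n - 1, h⟩

end FGCat

/-! ### Acyclic cones and `r`-isomorphisms -/

namespace FGCat
open FiltVect PersistenceCategory TPC
variable {k : Type u} [Field k]

/-- The degreewise identity behind the contraction `inl ∘ ψ ∘ snd` of the cone of `φ`. The terms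
that contain `δL` and `δK` cancel because `ψ` is a chain map, and the rest is the decomposition `h₃`
of the identity. -/
theorem homotopy_aux' {r : ℝ} (hr : 0 ≤ r) {C C₁ C' K K₁ L L₁ : FiltVect k} (fst : C ⟶ K₁)
    (snd : C ⟶ L) (snd₁ : C₁ ⟶ L₁) (d : C ⟶ C₁) (δL : L ⟶ L₁) (δK : K ⟶ K₁) (inl₁ : K₁ ⟶ C)
    (inl₀ : K ⟶ C') (d' : C' ⟶ C) (inr : L ⟶ C) (φ : K ⟶ L) (φ₁ : K₁ ⟶ L₁)
    (ψ : (raise r).obj L ⟶ K) (ψ₁ : (raise r).obj L₁ ⟶ K₁)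
    (h₁ : d ≫ snd₁ = fst ≫ φ₁ + snd ≫ δL) (h₂ : inl₀ ≫ d' = φ ≫ inr - δK ≫ inl₁)
    (h₃ : fst ≫ inl₁ + snd ≫ inr = 𝟙 C) (h₄ : ψ ≫ φ = dropHom hr L)
    (h₅ : (raise r).map φ₁ ≫ ψ₁ = dropHom hr K₁) (h₆ : (raise r).map δL ≫ ψ₁ = ψ ≫ δK) :
    dropHom hr C =
      (raise r).map d ≫ ((raise r).map snd₁ ≫ ψ₁ ≫ inl₁) +
        ((raise r).map snd ≫ ψ ≫ inl₀) ≫ d' := by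
  have e₂ : ∀ {U V : FiltVect k} (f : U ⟶ V),
      (raise r).map f ≫ dropHom hr V = dropHom hr U ≫ f := fun _ => rfl
  rw [← Category.assoc, ← Functor.map_comp, h₁, Functor.map_add, Functor.map_comp,
    Functor.map_comp, Category.assoc, Category.assoc, h₂, Preadditive.add_comp,
    Preadditive.comp_sub, Preadditive.comp_sub, Category.assoc, Category.assoc,
    ← Category.assoc ((raise r).map φ₁), h₅, ← Category.assoc ((raise r).map δL), h₆,
    ← Category.assoc ψ φ, h₄, Category.assoc, ← Category.assoc _ (dropHom hr K₁), e₂,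
    ← Category.assoc _ (dropHom hr L), e₂, Category.assoc, Category.assoc, add_assoc,
    add_sub_cancel, ← Preadditive.comp_add, h₃]
  exact (Category.comp_id _).symm

open CochainComplex CochainComplex.HomComplex in
theorem exists_homotopy' {r : ℝ} (hr : 0 ≤ r) {K L : CochainComplex (FiltVect k) ℤ} (φ : K ⟶ L)
    (ψ : ((raise r).mapHomologicalComplex (ComplexShape.up ℤ)).obj L ⟶ K)
    (h₁ : ∀ n, ψ.f n ≫ φ.f n = dropHom hr (L.X n))
    (h₂ : ∀ n, (raise r).map (φ.f n) ≫ ψ.f n = dropHom hr (K.X n))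
    (Ψ : ((raise r).mapHomologicalComplex (ComplexShape.up ℤ)).obj (mappingCone φ) ⟶ mappingCone φ)
    (hΨ : ∀ n, Ψ.f n = dropHom hr ((mappingCone φ).X n)) :
    Nonempty (Homotopy Ψ 0) := by
  let h : ∀ i j : ℤ, (((raise (k := k) r).mapHomologicalComplex (ComplexShape.up ℤ)).obj
      (mappingCone φ)).X i ⟶ (mappingCone φ).X j :=
    fun i j => if hij : j + 1 = i then
      (raise r).map ((mappingCone.snd φ).v i i (add_zero i)) ≫ ψ.f i ≫
        (mappingCone.inl φ).v i j (by omega) else 0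
  refine ⟨{ hom := h, zero := fun i j hij => dif_neg hij, comm := fun i => ?_ }⟩
  have hij : (ComplexShape.up ℤ).Rel i (i + 1) := rfl
  have hji : (ComplexShape.up ℤ).Rel (i - 1) i := by simp
  have e1 : h (i + 1) i = (raise r).map ((mappingCone.snd φ).v (i + 1) (i + 1) (add_zero _)) ≫
      ψ.f (i + 1) ≫ (mappingCone.inl φ).v (i + 1) i (by omega) := dif_pos rfl
  have e2 : h i (i - 1) = (raise r).map ((mappingCone.snd φ).v i i (add_zero i)) ≫
      ψ.f i ≫ (mappingCone.inl φ).v i (i - 1) (by omega) := dif_pos (by omega)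
  rw [dNext_eq h hij, prevD_eq h hji, e1, e2, hΨ, HomologicalComplex.zero_f, add_zero]
  exact homotopy_aux' hr ((mappingCone.fst φ).1.v i (i + 1) rfl)
    ((mappingCone.snd φ).v i i (add_zero i)) _ _ (L.d i (i + 1)) (K.d i (i + 1)) _ _ _
    ((mappingCone.inr φ).f i) (φ.f i) (φ.f (i + 1)) (ψ.f i) (ψ.f (i + 1))
    (mappingCone.d_snd_v φ i (i + 1) rfl)
    (mappingCone.inl_v_d φ i (i - 1) (i + 1) (by omega) (by omega))
    (mappingCone.id_X φ i (i + 1) rfl) (h₁ i) (h₂ (i + 1)) (ψ.comm i (i + 1)).symm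

/-- The cone of a filtered chain map with an inverse that raises the level by at most `r` is
`r`-acyclic. -/
theorem isAcyclic_obj₃ {r : ℝ} (hr : 0 ≤ r) {X Y : FGCat k} (φ : X.obj.as ⟶ Y.obj.as)
    (ψ : ((raise r).mapHomologicalComplex (ComplexShape.up ℤ)).obj Y.obj.as ⟶ X.obj.as)
    (h₁ : ∀ n, ψ.f n ≫ φ.f n = dropHom hr (Y.obj.as.X n))
    (h₂ : ∀ n, (raise r).map (φ.f n) ≫ ψ.f n = dropHom hr (X.obj.as.X n))
    {K : FGCat k} {g : Y ⟶ K} {h : K ⟶ X⟦(1 : ℤ)⟧}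
    (mem : Triangle.mk (mk φ) g h ∈ distTriang (FGCat k)) : IsAcyclic k r K := by
  have mem' := (fgProperty k).ι.map_distinguished _ mem
  let e : K.obj ≅ (HomotopyCategory.quotient _ _).obj (CochainComplex.mappingCone φ) :=
    Triangle.π₃.mapIso (isoTriangleOfIso₁₂ _ _ mem'
      (HomotopyCategory.mappingCone_triangleh_distinguished φ)
      (Iso.refl _) (Iso.refl _) ((Category.comp_id _).trans (Category.id_comp _).symm))
  have hfin : {n : ℤ | ¬ IsZero ((CochainComplex.mappingCone φ).X n)}.Finite := by
    have h₁ : {i : ℤ | ¬ IsZero (X.obj.as.X (i + 1))}.Finite :=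
      Set.Finite.preimage (f := fun i : ℤ => i + 1) (fun a _ b _ h => by simpa using h) X.property
    refine (h₁.union Y.property).subset fun i hi => ?_
    simp only [Set.mem_ofPred_eq, CochainComplex.mappingCone.isZero_X_iff, not_and_or] at hi
    exact hi
  refine acyclic_of_iso (Y := ofComplex _ hfin) ((fgProperty k).isoMk e) ⟨hr, ?_⟩
  obtain ⟨H⟩ := exists_homotopy' hr φ ψ h₁ h₂
    ((NatTrans.mapHomologicalComplex (dropTo hr) (ComplexShape.up ℤ)).app
      (CochainComplex.mappingCone φ)) (fun _ => rfl)
  have h0 := HomotopyCategory.eq_of_homotopy _ _ H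
  rw [Functor.map_zero] at h0
  exact ObjectProperty.hom_ext _ h0

theorem isRIso_mk {r : ℝ} (hr : 0 ≤ r) {X Y : FGCat k} (φ : X.obj.as ⟶ Y.obj.as)
    (ψ : ((raise r).mapHomologicalComplex (ComplexShape.up ℤ)).obj Y.obj.as ⟶ X.obj.as)
    (h₁ : ∀ n, ψ.f n ≫ φ.f n = dropHom hr (Y.obj.as.X n))
    (h₂ : ∀ n, (raise r).map (φ.f n) ≫ ψ.f n = dropHom hr (X.obj.as.X n)) :
    IsRIso k r (mk φ) := by
  obtain ⟨K, g, h, mem⟩ := distinguished_cocone_triangle (mk φ)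
  exact ⟨K, g, h, mem, isAcyclic_obj₃ hr φ ψ h₁ h₂ mem⟩

theorem mk_comp_mk_eq_dropFG {r : ℝ} (hr : 0 ≤ r) {X Y : FGCat k} (φ : X.obj.as ⟶ Y.obj.as)
    (ψ : ((raise r).mapHomologicalComplex (ComplexShape.up ℤ)).obj Y.obj.as ⟶ X.obj.as)
    (h₁ : ∀ n, ψ.f n ≫ φ.f n = dropHom hr (Y.obj.as.X n)) :
    mk (X := (sigmaFG r).obj Y) (Y := X) ψ ≫ mk φ = dropFG hr Y := by
  refine (mk_comp _ _).trans (congrArg (mk (X := (sigmaFG r).obj Y) (Y := Y)) ?_)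
  ext1 n
  exact h₁ n

theorem IsAcyclic.biprod {r : ℝ} {X Y : FGCat k} (hX : IsAcyclic k r X) (hY : IsAcyclic k r Y) :
    IsAcyclic k r (X ⊞ Y) := by
  rw [isAcyclic_iff] at *
  obtain ⟨hr, hX⟩ := hX
  obtain ⟨_, hY⟩ := hY
  refine ⟨hr, ?_⟩
  rw [← Category.comp_id (dropFG hr _), ← biprod.total, Preadditive.comp_add,
    ← Category.assoc, ← Category.assoc, ← dropFG_naturality, ← dropFG_naturality, hX, hY]
  simp

theorem comp_iso_aux {C : Type*} [Category C] {X Y Y' Z W W' : C} {a : X ⟶ Y} {m : Y ⟶ Z}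
    {σ : Y' ≅ Z} {n : Z ⟶ W} {ρ : W' ≅ W} {t : Y ⟶ W} {t' : X ⟶ W'} (h₁ : m ≫ n = t)
    (h₂ : a ≫ t = t' ≫ ρ.hom) : (a ≫ m ≫ σ.inv) ≫ (σ.hom ≫ n ≫ ρ.inv) = t' := by
  simp only [Category.assoc, Iso.inv_hom_id_assoc]
  rw [reassoc_of% h₁, ← Category.assoc, h₂, Category.assoc, Iso.hom_inv_id, Category.comp_id]

theorem commShift_dropFG {r : ℝ} (hr : 0 ≤ r) (X : FGCat k) (n : ℤ) :
    ((sigmaFG r).commShiftIso n).hom.app X ≫ (dropFG hr X)⟦n⟧' = dropFG hr (X⟦n⟧) := by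
  have h1 : ((sigmaFG r).commShiftIso n).hom.app X = _ := commShiftIso_hom_app (raise r) n X
  have h2 := shift_map_mk (X := (sigmaFG r).obj X) (Y := X)
    ((NatTrans.mapHomologicalComplex (dropTo hr) (ComplexShape.up ℤ)).app X.obj.as) n
  have h3 := dropFG_naturality hr (shiftIso X n).hom
  have key : mk (X := (sigmaFG r).obj (shiftComplex X n))
      (Y := shiftComplex ((sigmaFG r).obj X) n)
      (((raise r).mapCochainComplexShiftIso n).hom.app X.obj.as) ≫
      mk (X := shiftComplex ((sigmaFG r).obj X) n) (Y := shiftComplex X n)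
        ((shiftFunctor (CochainComplex (FiltVect k) ℤ) n).map
        ((NatTrans.mapHomologicalComplex (dropTo hr) (ComplexShape.up ℤ)).app X.obj.as)) =
      dropFG hr (shiftComplex X n) := rfl
  rw [h1]
  exact (congrArg _ h2).trans (comp_iso_aux key h3)

theorem IsAcyclic.shift {r : ℝ} {X : FGCat k} (hX : IsAcyclic k r X) (n : ℤ) :
    IsAcyclic k r (X⟦n⟧) := by
  rw [isAcyclic_iff] at *
  obtain ⟨hr, hX⟩ := hX
  refine ⟨hr, ?_⟩
  rw [← commShift_dropFG, hX, Functor.map_zero, comp_zero]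

end FGCat

/-! ### Short bars are acyclic; direct sums with trivial differential -/

namespace FGCat
open FiltVect PersistenceCategory TPC
variable {k : Type u} [Field k]

/-- The identity of `k`, from the line at level `b` raised by `r` to the line at level `c ≤ b + r`. -/
noncomputable def lineMapRaise {b c r : ℝ} (h : c ≤ b + r) : (raise r).obj (line k b) ⟶ line k c :=
  (raiseLine (k := k) r b (b + r) rfl).hom ≫ lineMap h

theorem dropHom_iso_aux {b c r : ℝ} (h : b ≤ c) (hr₀ : 0 ≤ r) (hr : c ≤ b + r) {V W : FiltVect k}
    (e₀ : V ≅ line k c) (e₁ : W ≅ line k b) :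
    dropHom hr₀ W = ((raise r).map e₁.hom ≫ lineMapRaise hr ≫ e₀.inv) ≫
        e₀.hom ≫ lineMap h ≫ e₁.inv ∧
      dropHom hr₀ V = (raise r).map (e₀.hom ≫ lineMap h ≫ e₁.inv) ≫
        (raise r).map e₁.hom ≫ lineMapRaise hr ≫ e₀.inv := by
  have hnat : ∀ {U V : FiltVect k} (f : U ⟶ V),
      (raise r).map f ≫ dropHom hr₀ V = dropHom hr₀ U ≫ f := fun _ => rfl
  have h₁ : lineMapRaise (k := k) hr ≫ lineMap h = dropHom hr₀ (line k b) := rfl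
  have h₂ : (raise r).map (lineMap (k := k) h) ≫ lineMapRaise hr = dropHom hr₀ (line k c) := rfl
  constructor
  · simp only [Category.assoc, Iso.inv_hom_id_assoc]
    rw [reassoc_of% h₁, ← Category.assoc, hnat, Category.assoc, e₁.hom_inv_id, Category.comp_id]
  · rw [← Category.assoc, ← Functor.map_comp, Category.assoc, Category.assoc, e₁.inv_hom_id,
      Category.comp_id, Functor.map_comp, Category.assoc, reassoc_of% h₂, ← Category.assoc, hnat,
      Category.assoc, e₀.hom_inv_id, Category.comp_id]

/-- The contraction `x ↦ y` raises the level by `c - b ≤ r`, which is absorbed by raising the source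
by `r`. -/
theorem isAcyclic_E₂ {b c r : ℝ} (h : b ≤ c) (hr : c ≤ b + r) : IsAcyclic k r (E₂ k h) := by
  have hr₀ : 0 ≤ r := by linarith
  rw [isAcyclic_iff]
  refine ⟨hr₀, ?_⟩
  let K := HomologicalComplex.double (c := ComplexShape.up ℤ) (i₀ := -1) (i₁ := 0)
    (lineMap (k := k) h) (by simp)
  have hne : (-1 : ℤ) ≠ 0 := by norm_num
  let e₀ : K.X (-1) ≅ line k c := HomologicalComplex.doubleXIso₀ _ _
  let e₁ : K.X 0 ≅ line k b := HomologicalComplex.doubleXIso₁ _ _ hne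
  have hd : K.d (-1) 0 = e₀.hom ≫ lineMap h ≫ e₁.inv := HomologicalComplex.double_d _ _ hne
  let Ψ : ((raise r).mapHomologicalComplex (ComplexShape.up ℤ)).obj K ⟶ K :=
    (NatTrans.mapHomologicalComplex (dropTo hr₀) (ComplexShape.up ℤ)).app K
  -- In cohomological grading `y` has degree `-1` and `x` degree `0`, so this is the only non-zero
  -- component.
  let H : ∀ i j : ℤ, (((raise (k := k) r).mapHomologicalComplex (ComplexShape.up ℤ)).obj K).X i ⟶
      K.X j := fun i j => if hij : i = 0 ∧ j = -1 then
        (raise r).map ((K.XIsoOfEq hij.1).hom ≫ e₁.hom) ≫ lineMapRaise hr ≫ e₀.inv ≫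
          (K.XIsoOfEq hij.2.symm).hom else 0
  have hH : H 0 (-1) = (raise r).map e₁.hom ≫ lineMapRaise hr ≫ e₀.inv := by
    refine (dif_pos ⟨rfl, rfl⟩).trans ?_
    simp [HomologicalComplex.XIsoOfEq]
    rfl
  have hom : Homotopy Ψ 0 := by
    refine { hom := H, zero := fun i j hij => dif_neg ?_, comm := fun i => ?_ }
    · rintro ⟨rfl, rfl⟩
      exact hij (by simp)
    · rw [HomologicalComplex.zero_f, add_zero]
      by_cases hi : i = 0
      · subst hi
        rw [dNext_eq H (show (ComplexShape.up ℤ).Rel 0 1 by simp),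
          prevD_eq H (show (ComplexShape.up ℤ).Rel (-1) 0 by simp), hH,
          show H 1 0 = 0 from dif_neg (by simp), comp_zero, zero_add, hd]
        exact (dropHom_iso_aux h hr₀ hr e₀ e₁).1
      · by_cases hi' : i = -1
        · subst hi'
          rw [dNext_eq H (show (ComplexShape.up ℤ).Rel (-1) 0 by simp),
            prevD_eq H (show (ComplexShape.up ℤ).Rel (-2) (-1) by simp), hH,
            show H (-1) (-2) = 0 from dif_neg (by simp), zero_comp, add_zero]
          change dropHom hr₀ _ = (raise r).map (K.d (-1) 0) ≫ _
          rw [hd]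
          exact (dropHom_iso_aux h hr₀ hr e₀ e₁).2
        · exact (HomologicalComplex.isZero_double_X _ _ i hi' hi).eq_of_tgt _ _
  have h0 := HomotopyCategory.eq_of_homotopy _ _ hom
  rw [Functor.map_zero] at h0
  exact ObjectProperty.hom_ext _ h0

/-- The levels of all non-zero elements are at least `c`. -/
def LevGE (X : FGCat k) (c : ℝ) : Prop :=
  ∀ (i : ℤ) (x : (X.obj.as.X i).carrier), x ≠ 0 → (c : WithBot ℝ) ≤ (X.obj.as.X i).lev x

theorem finite_zeroDiff {V : ℤ → FiltVect k} {X Y : FGCat k}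
    (h : ∀ i, IsZero (X.obj.as.X i) → IsZero (Y.obj.as.X i) → IsZero (V i)) :
    {n : ℤ | ¬ IsZero (V n)}.Finite := by
  refine (X.property.union Y.property).subset fun i hi => ?_
  by_contra h'
  simp only [Set.mem_union, Set.mem_ofPred_eq, not_or, not_not] at h'
  exact hi (h i h'.1 h'.2)

theorem isZero_prod {V W : FiltVect k} (hV : IsZero V) (hW : IsZero W) :
    IsZero (FiltVect.prod V W) := by
  rw [IsZero.iff_id_eq_zero] at *
  refine hom_ext fun (x : V.carrier × W.carrier) => ?_
  exact Prod.ext (congrArg (fun f => Hom.lin f x.1) hV) (congrArg (fun f => Hom.lin f x.2) hW)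

/-- The chosen `X ⊞ Y` is determined only up to homotopy equivalence, so its differential need not
vanish. The degreewise direct sum is an isomorphic complex whose differential does vanish and whose
levels are known. -/
theorem exists_trivialDifferential_biprod {X Y : FGCat k} (hX : X ∈ trivialDifferential k)
    (hY : Y ∈ trivialDifferential k) : ∃ Z ∈ trivialDifferential k, Nonempty (Z ≅ X ⊞ Y) ∧
      ∀ c, LevGE X c → LevGE Y c → LevGE Z c := by
  let K : CochainComplex (FiltVect k) ℤ :=
    { X := fun i => FiltVect.prod (X.obj.as.X i) (Y.obj.as.X i), d := fun _ _ => 0 }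
  let Z : FGCat k := ofComplex K (finite_zeroDiff fun i => isZero_prod)
  let KX : CochainComplex (FiltVect k) ℤ := X.obj.as
  let KY : CochainComplex (FiltVect k) ℤ := Y.obj.as
  have hX' : ∀ i j, KX.d i j = 0 := hX
  have hY' : ∀ i j, KY.d i j = 0 := hY
  have hK : ∀ i j, K.d i j = 0 := fun _ _ => rfl
  let fst : K ⟶ KX := { f := fun i => (bicone (KX.X i) (KY.X i)).fst,
                        comm' := fun i j _ => by rw [hX', hK]; exact comp_zero.trans zero_comp.symm }
  let snd : K ⟶ KY := { f := fun i => (bicone (KX.X i) (KY.X i)).snd,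
                        comm' := fun i j _ => by rw [hY', hK]; exact comp_zero.trans zero_comp.symm }
  let inl : KX ⟶ K := { f := fun i => (bicone (KX.X i) (KY.X i)).inl,
                        comm' := fun i j _ => by rw [hX', hK]; exact comp_zero.trans zero_comp.symm }
  let inr : KY ⟶ K := { f := fun i => (bicone (KX.X i) (KY.X i)).inr,
                        comm' := fun i j _ => by rw [hY', hK]; exact comp_zero.trans zero_comp.symm }
  let b : BinaryBicone X Y :=
    { pt := Z
      fst := mk (X := Z) fst
      snd := mk (X := Z) snd
      inl := mk (Y := Z) inl
      inr := mk (Y := Z) inr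
      inl_fst := rfl
      inl_snd := rfl
      inr_fst := rfl
      inr_snd := rfl }
  have htot : fst ≫ inl + snd ≫ inr = 𝟙 K := by
    ext1 i
    refine hom_ext fun (x : (KX.X i).carrier × (KY.X i).carrier) => ?_
    change ((x.1, (0 : (KY.X i).carrier)) + ((0 : (KX.X i).carrier), x.2) :
      (KX.X i).carrier × (KY.X i).carrier) = x
    exact (Prod.mk_add_mk _ _ _ _).trans (by rw [add_zero, zero_add])
  have hb : b.fst ≫ b.inl + b.snd ≫ b.inr = 𝟙 b.pt :=
    (congrArg (mk (X := Z) (Y := Z)) htot).trans (mk_id Z)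
  refine ⟨Z, fun _ _ => rfl, ⟨biprod.uniqueUpToIso X Y (isBinaryBilimitOfTotal b hb)⟩,
    fun c h₁ h₂ i x hx => ?_⟩
  by_cases h : (Prod.fst x) = 0
  · have h' : Prod.snd x ≠ 0 := fun h' => hx (Prod.ext h h')
    exact (h₂ i x.2 h').trans (le_max_right _ _)
  · exact (h₁ i x.1 h).trans (le_max_left _ _)

end FGCat

/-! ### Clipping negative levels -/

namespace FiltVect
variable {k : Type u} [Field k]

theorem monotone_map_max : Monotone (WithBot.map (max (0 : ℝ))) :=
  WithBot.monotone_map_iff.2 fun _ _ h => max_le_max le_rfl h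

/-- Raising all negative levels to zero. -/
abbrev clipObj (V : FiltVect k) : FiltVect k where
  carrier := V.carrier
  lev x := (V.lev x).map (max 0)
  lev_eq_bot_iff x := by rw [WithBot.map_eq_bot_iff, lev_eq_bot_iff]
  lev_smul c x hc := by rw [V.lev_smul c x hc]
  lev_add_le x y := by
    rw [← monotone_map_max.map_max]
    exact monotone_map_max (V.lev_add_le x y)

/-- Raising all negative levels to zero, as a functor. -/
def clip : FiltVect k ⥤ FiltVect k where
  obj V := clipObj V
  map {V W} f := mkHom (V := clipObj V) (W := clipObj W) (Hom.lin (V := V) (W := W) f) fun x =>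
    monotone_map_max (le_lev f x)

instance : (clip (k := k)).Additive where
  map_add := rfl

theorem le_map_max (x : WithBot ℝ) : x ≤ x.map (max 0) := by
  cases x with
  | bot => exact bot_le
  | coe x => exact WithBot.coe_le_coe.2 (le_max_right _ _)

/-- The identity map from the clipped space to the space. -/
def unclip : clip (k := k) ⟶ 𝟭 _ where
  app V := mkHom (V := clipObj V) (W := V) LinearMap.id fun _ => le_map_max _
  naturality _ _ _ := rfl

/-- The identity map from a space raised by `r` to the clipped space, if all levels are at least
`-r`. -/
def toClip {r : ℝ} (hr : 0 ≤ r) (V : FiltVect k)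
    (h : ∀ x, x ≠ 0 → ((-r : ℝ) : WithBot ℝ) ≤ V.lev x) : (raise r).obj V ⟶ clip.obj V :=
  mkHom (V := raiseObj r V) (W := clipObj V) LinearMap.id fun x => by
    change (V.lev x).map (max 0) ≤ V.lev x + r
    by_cases hx : x = 0
    · subst hx
      rw [lev_zero]
      exact bot_le
    · have h' := h x hx
      have h'' : V.lev x ≠ ⊥ := fun h => hx ((V.lev_eq_bot_iff x).1 h)
      obtain ⟨t, ht⟩ := WithBot.ne_bot_iff_exists.1 h''
      rw [← ht] at h' ⊢
      have := WithBot.coe_le_coe.1 h'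
      exact WithBot.coe_le_coe.2 (max_le (by linarith) (by linarith))

/-- Clipping a line. -/
noncomputable def clipLine (a : ℝ) : clip.obj (line k a) ≅ line k (max 0 a) := by
  have h : ∀ x : k, (clipObj (line k a)).lev x = (line k (max 0 a)).lev x := fun x => by
    change ((line k a).lev x).map (max 0) = _
    by_cases hx : x = 0
    · subst hx
      rw [show (line k a).lev (0 : k) = ⊥ from lev_zero _,
        show (line k (max 0 a)).lev (0 : k) = ⊥ from lev_zero _]
      rfl
    · rw [line_lev a x hx, line_lev _ x hx]
      rfl
  exact
  { hom := mkHom (V := clipObj (line k a)) (W := line k (max 0 a)) (LinearMap.id : k →ₗ[k] k)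
      fun x => (h x).ge
    inv := mkHom (V := line k (max 0 a)) (W := clipObj (line k a)) (LinearMap.id : k →ₗ[k] k)
      fun x => (h x).le
    hom_inv_id := rfl
    inv_hom_id := rfl }

theorem lev_iso {V W : FiltVect k} (e : V ≅ W) (x : V.carrier) :
    W.lev (Hom.lin e.hom x) = V.lev x := by
  refine (le_lev e.hom x).antisymm ?_
  have h : Hom.lin e.inv (Hom.lin e.hom x) = x :=
    congrArg (fun f => Hom.lin f x) e.hom_inv_id
  conv_lhs => rw [← h]
  exact le_lev e.inv _

theorem iso_ne_zero {V W : FiltVect k} (e : V ≅ W) {x : V.carrier} (hx : x ≠ 0) :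
    Hom.lin e.hom x ≠ 0 := by
  intro h
  rw [← W.lev_eq_bot_iff, lev_iso, V.lev_eq_bot_iff] at h
  exact hx h

theorem eq_zero_of_isZero {V : FiltVect k} (hV : IsZero V) (x : V.carrier) : x = 0 :=
  congrArg (fun f => Hom.lin f x) ((IsZero.iff_id_eq_zero V).1 hV)

end FiltVect

/-! ### Complexes in a single degree and functors applied to sums of rays -/

namespace FGCat
open FiltVect PersistenceCategory TPC
variable {k : Type u} [Field k]

/-- `E₁(a)⟦n⟧`, as a complex concentrated in a single degree. -/
noncomputable def single (k : Type u) [Field k] (n : ℤ) (a : ℝ) : FGCat k :=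
  ofComplex ((HomologicalComplex.single (FiltVect k) (ComplexShape.up ℤ) n).obj (line k a)) <| by
    refine (Set.finite_singleton n).subset fun i hi => ?_
    by_contra h
    exact hi (HomologicalComplex.isZero_single_obj_X _ _ _ _ h)

/-- The complex concentrated in degree `-n` is the shift of `E₁(a)`. -/
noncomputable def singleIso (n : ℤ) (a : ℝ) : (E₁ k a)⟦n⟧ ≅ single k (-n) a :=
  shiftIso (E₁ k a) n ≪≫ (fgProperty k).isoMk ((HomotopyCategory.quotient _ _).mapIso
    (((CochainComplex.singleFunctors (FiltVect k)).shiftIso n (-n) 0 (by ring)).app (line k a)))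

theorem single_mem (n : ℤ) (a : ℝ) : single k n a ∈ trivialDifferential k := fun _ _ => rfl

theorem single_lev {n : ℤ} {V : FiltVect k} {i : ℤ}
    (x : (((HomologicalComplex.single (FiltVect k) (ComplexShape.up ℤ) n).obj V).X i).carrier)
    (hx : x ≠ 0) : ∃ y : V.carrier, y ≠ 0 ∧ V.lev y =
      (((HomologicalComplex.single (FiltVect k) (ComplexShape.up ℤ) n).obj V).X i).lev x := by
  by_cases h : i = n
  · subst h
    exact ⟨_, iso_ne_zero (HomologicalComplex.singleObjXSelf (ComplexShape.up ℤ) i V) hx, lev_iso _ _⟩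
  · exact absurd (eq_zero_of_isZero (HomologicalComplex.isZero_single_obj_X _ _ _ _ h) x) hx

theorem levGE_single (n : ℤ) {a c : ℝ} (h : c ≤ a) : LevGE (single k n a) c := fun i x hx => by
  obtain ⟨y, hy, h'⟩ := single_lev (n := n) (V := line k a) x hx
  refine le_trans ?_ h'.le
  rw [line_lev a y hy]
  exact WithBot.coe_le_coe.2 h

/-- `LevGE` is not invariant under isomorphism in `FGCat k`, so a bound on levels requires this
explicit model of a sum of rays. -/
theorem exists_trivialDifferential_raySum (l : List (ℤ × ℝ)) :
    ∃ X ∈ trivialDifferential k, Nonempty (X ≅ raySum k l) ∧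
      ∀ c : ℝ, (∀ p ∈ l, c ≤ p.2) → LevGE X c := by
  induction l with
  | nil =>
    have h0 : ∀ i, IsZero ((0 : CochainComplex (FiltVect k) ℤ).X i) := fun i =>
      (HomologicalComplex.eval (FiltVect k) (ComplexShape.up ℤ) i).map_isZero (isZero_zero _)
    have hZ : IsZero ((HomotopyCategory.quotient (FiltVect k) (ComplexShape.up ℤ)).obj 0) :=
      Functor.map_isZero _ (isZero_zero _)
    refine ⟨ofComplex 0 ?_, fun i j => (h0 i).eq_of_src _ _, ⟨?_⟩, fun c _ i x hx => ?_⟩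
    · convert Set.finite_empty
      ext i
      simp [h0 i]
    · exact IsZero.iso (IsZero.of_full_of_faithful_of_isZero (fgProperty k).ι _ hZ) (isZero_zero _)
    · exact absurd (eq_zero_of_isZero (h0 i) x) hx
  | cons p l ih =>
    obtain ⟨X, hX, ⟨e⟩, h⟩ := ih
    obtain ⟨Z, hZ, ⟨e'⟩, h'⟩ := exists_trivialDifferential_biprod (single_mem (-p.1) p.2) hX
    refine ⟨Z, hZ, ⟨e' ≪≫ biprod.mapIso (singleIso p.1 p.2).symm e⟩, fun c hc => h' c ?_ ?_⟩
    · exact levGE_single _ (hc p List.mem_cons_self)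
    · exact h c fun p hp => hc p (List.mem_cons_of_mem _ hp)

theorem map_biprod {C D : Type*} [Category C] [Category D] [Preadditive C] [Preadditive D]
    [HasBinaryBiproducts C] [HasBinaryBiproducts D] (F : C ⥤ D) [F.Additive] (X Y : C) :
    Nonempty (F.obj (X ⊞ Y) ≅ F.obj X ⊞ F.obj Y) :=
  have := preservesBinaryBiproducts_of_preservesBiproducts F
  ⟨F.mapBiprod X Y⟩

theorem mapFG_raySum (F : FiltVect k ⥤ FiltVect k) [F.Additive] (g : ℝ → ℝ)
    (hF : ∀ a, Nonempty (F.obj (line k a) ≅ line k (g a))) (l : List (ℤ × ℝ)) :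
    Nonempty ((mapFG F).obj (raySum k l) ≅ raySum k (l.map fun p => (p.1, g p.2))) := by
  induction l with
  | nil => exact ⟨(Functor.map_isZero _ (isZero_zero _)).iso (isZero_zero _)⟩
  | cons p l ih =>
    obtain ⟨e⟩ := ih
    obtain ⟨i⟩ := mapFG_E₁ F (hF p.2).some
    exact ⟨(map_biprod (mapFG F) _ _).some ≪≫ biprod.mapIso (((mapFG F).commShiftIso p.1).app _ ≪≫
      (shiftFunctor _ p.1).mapIso i) e⟩

theorem shift_raySum (m : ℤ) (l : List (ℤ × ℝ)) :
    Nonempty ((raySum k l)⟦m⟧ ≅ raySum k (l.map fun p => (p.1 + m, p.2))) := by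
  induction l with
  | nil => exact ⟨(Functor.map_isZero (shiftFunctor (FGCat k) m) (isZero_zero _)).iso (isZero_zero _)⟩
  | cons p l ih =>
    obtain ⟨e⟩ := ih
    exact ⟨(map_biprod (shiftFunctor (FGCat k) m) _ _).some ≪≫
      biprod.mapIso ((shiftFunctorAdd (FGCat k) p.1 m).symm.app _) e⟩

end FGCat

/-! ### Upper bounds for the fragmentation distance -/

namespace FGCat
open FiltVect PersistenceCategory TPC
variable {k : Type u} [Field k]

/-- Clipping moves the start of each ray to `max 0 a`, so that `build_raySum` applies. -/
theorem build_of_iso_clip {X : FGCat k} {l : List (ℤ × ℝ)} (e : X ≅ raySum k l) :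
    ∃ (L : List (FGCat k)) (l' : List (ℤ × ℝ)), (∀ Z ∈ L, Z ∈ stdFamily k) ∧
      HasConeDecomposition k L (raySum k l') 0 ∧
        Nonempty ((mapFG clip).obj X ≅ raySum k l') := by
  obtain ⟨i⟩ := mapFG_raySum (k := k) clip (max 0) (fun a => ⟨clipLine a⟩) l
  obtain ⟨L, hL, h⟩ := build_raySum (k := k) (l := l.map fun p => (p.1, max 0 p.2)) (by
    intro p hp; obtain ⟨q, -, rfl⟩ := List.mem_map.1 hp; exact le_max_left _ _)
  exact ⟨L, _, hL, h, ⟨(mapFG clip).mapIso e ≪≫ i⟩⟩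

/-- The clipped complex is free. The mandatory entry `T⁻¹ 0` is inserted by a trivial triangle,
whose cone is then replaced by `X` along `unclip`; this is an `r`-isomorphism because its inverse
raises levels by at most `r`. -/
theorem fragDelta_zero_right_le {X : FGCat k} {l : List (ℤ × ℝ)} (e : X ≅ raySum k l) {r : ℝ}
    (hr : 0 ≤ r) (hX : LevGE X (-r)) :
    fragDelta k (stdFamily k) X 0 ≤ ENNReal.ofReal r := by
  obtain ⟨L, l', hL, h, ⟨i⟩⟩ := build_of_iso_clip e
  let K : CochainComplex (FiltVect k) ℤ := X.obj.as
  let φ : (clip.mapHomologicalComplex (ComplexShape.up ℤ)).obj K ⟶ K :=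
    (NatTrans.mapHomologicalComplex unclip (ComplexShape.up ℤ)).app K
  let ψ : ((raise r).mapHomologicalComplex (ComplexShape.up ℤ)).obj K ⟶
      (clip.mapHomologicalComplex (ComplexShape.up ℤ)).obj K :=
    { f := fun n => toClip hr (K.X n) (hX n), comm' := fun _ _ _ => rfl }
  have hA : IsZero ((sigmaFG (k := k) 0).obj ((0 : FGCat k)⟦(-1 : ℤ)⟧)) :=
    Functor.map_isZero _ (Functor.map_isZero (shiftFunctor (FGCat k) (-1 : ℤ)) (isZero_zero _))
  obtain ⟨ω, hω, h'⟩ := hasConeDecomposition_snoc le_rfl hr h _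
    (contractible_distinguished₁ ((mapFG clip).obj X)) (hA.iso (isZero_zero _)) i
    (mk (X := (mapFG clip).obj X) (Y := X) φ)
    (isRIso_mk (X := (mapFG clip).obj X) (Y := X) hr φ ψ (fun _ => rfl) (fun _ => rfl))
    (mk (X := (sigmaFG r).obj X) (Y := (mapFG clip).obj X) ψ)
    (mk_comp_mk_eq_dropFG (X := (mapFG clip).obj X) (Y := X) hr φ ψ (fun _ => rfl))
  rw [zero_add] at hω
  exact (fragDelta_le hL (l₂ := []) (by simp) (by simpa using h')).trans hω

theorem isRIso_to_zero {r : ℝ} {X : FGCat k} (hX : IsAcyclic k r X) :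
    IsRIso k r (0 : X ⟶ 0) :=
  ⟨_, _, _, rot_of_distTriang _ (contractible_distinguished X), IsAcyclic.shift hX 1⟩

/-- Here `T⁻¹ X` is attached to its own clipped version along `Σʳ T⁻¹ X → clip (T⁻¹ X)`. The cone is
`r`-acyclic, so its map to `0` is an `r`-isomorphism. -/
theorem fragDelta_zero_left_le {X : FGCat k} {l : List (ℤ × ℝ)} (e : X ≅ raySum k l) {r : ℝ}
    (hr : 0 ≤ r) (hX : LevGE X (-r)) :
    fragDelta k (stdFamily k) 0 X ≤ ENNReal.ofReal r := by
  let X' := shiftComplex X (-1)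
  obtain ⟨j⟩ := shift_raySum (k := k) (-1) l
  obtain ⟨L, l', hL, h, ⟨i⟩⟩ := build_of_iso_clip ((shiftIso X (-1)).symm ≪≫
    (shiftFunctor (FGCat k) (-1 : ℤ)).mapIso e ≪≫ j)
  let K : CochainComplex (FiltVect k) ℤ := X'.obj.as
  let φ : (clip.mapHomologicalComplex (ComplexShape.up ℤ)).obj K ⟶ K :=
    (NatTrans.mapHomologicalComplex unclip (ComplexShape.up ℤ)).app K
  let ψ : ((raise r).mapHomologicalComplex (ComplexShape.up ℤ)).obj K ⟶
      (clip.mapHomologicalComplex (ComplexShape.up ℤ)).obj K :=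
    { f := fun n => toClip hr (K.X n) (hX (n + -1)), comm' := fun _ _ _ => rfl }
  obtain ⟨D, g, t, mem⟩ := distinguished_cocone_triangle
    (mk (X := (sigmaFG r).obj X') (Y := (mapFG clip).obj X') ψ)
  have hD : IsAcyclic k r D := isAcyclic_obj₃ (X := (sigmaFG r).obj X') (Y := (mapFG clip).obj X')
    hr ψ (((raise r).mapHomologicalComplex (ComplexShape.up ℤ)).map φ) (fun _ => rfl)
    (fun _ => rfl) mem
  obtain ⟨ω, hω, h'⟩ := hasConeDecomposition_snoc hr hr h _ mem
    ((sigmaFG r).mapIso (shiftIso X (-1))) i 0 (isRIso_to_zero hD) 0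
    ((isZero_zero (FGCat k)).eq_of_tgt _ _)
  rw [zero_add] at hω
  exact (fragDelta_le hL (l₂ := []) (by simp) (by simpa using h')).trans hω

theorem fragDist_zero_le {X : FGCat k} {l : List (ℤ × ℝ)} (e : X ≅ raySum k l) {r : ℝ}
    (hr : 0 ≤ r) (hX : LevGE X (-r)) : fragDist k (stdFamily k) X 0 ≤ ENNReal.ofReal r :=
  max_le (fragDelta_zero_right_le e hr hX) (fragDelta_zero_left_le e hr hX)

theorem isRIso_inl {r : ℝ} (X : FGCat k) {U : FGCat k} (hU : IsAcyclic k r U) :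
    IsRIso k r (biprod.inl : X ⟶ X ⊞ U) :=
  ⟨_, _, _, binaryBiproductTriangle_distinguished X U, hU⟩

theorem isRIso_iso_comp {r : ℝ} {A B D : FGCat k} {φ : B ⟶ D} (hφ : IsRIso k r φ) (e : A ≅ B) :
    IsRIso k r (e.hom ≫ φ) := by
  obtain ⟨K, g, h, mem, hK⟩ := hφ
  refine ⟨K, g, h ≫ e.inv⟦(1 : ℤ)⟧', isomorphic_distinguished _ mem _
    (Triangle.isoMk _ _ e (Iso.refl _) (Iso.refl _) ?_ ?_ ?_), hK⟩
  · exact Category.comp_id _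
  · exact (Category.comp_id _).trans (Category.id_comp _).symm
  · refine Eq.trans ?_ (Category.id_comp _).symm
    change (h ≫ e.inv⟦(1 : ℤ)⟧') ≫ e.hom⟦(1 : ℤ)⟧' = h
    rw [Category.assoc, ← Functor.map_comp, e.inv_hom_id, CategoryTheory.Functor.map_id,
      Category.comp_id]

theorem isRIso_fst {r : ℝ} (X : FGCat k) {U : FGCat k} (hU : IsAcyclic k r U) :
    IsRIso k r (biprod.fst : X ⊞ U ⟶ X) := by
  have h : IsRIso k r (biprod.snd : U ⊞ X ⟶ X) :=
    ⟨_, _, _, rot_of_distTriang _ (binaryBiproductTriangle_distinguished U X), IsAcyclic.shift hU 1⟩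
  have e : (biprod.fst : X ⊞ U ⟶ X) = (biprod.braiding X U).hom ≫ biprod.snd := by simp
  rw [e]
  exact isRIso_iso_comp h _

/-- The drop map kills the `r`-acyclic summand, so composing it with the projection to `X` loses
nothing. This yields the right `r`-inverse of `biprod.inl`. -/
theorem drop_inl {r : ℝ} {X U : FGCat k} (hU : IsAcyclic k r U) :
    ∃ hr : 0 ≤ r, (dropFG hr (X ⊞ U) ≫ biprod.fst) ≫ biprod.inl = dropFG hr (X ⊞ U) := by
  rw [isAcyclic_iff] at hU
  obtain ⟨hr, hU⟩ := hU
  refine ⟨hr, ?_⟩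
  have h : dropFG hr (X ⊞ U) ≫ (biprod.snd : X ⊞ U ⟶ U) = 0 := by
    rw [← dropFG_naturality, hU, comp_zero]
  conv_rhs => rw [← Category.comp_id (dropFG hr _), ← biprod.total, Preadditive.comp_add,
    ← Category.assoc, ← Category.assoc, h, zero_comp, add_zero]

theorem drop_fst {r : ℝ} (hr : 0 ≤ r) (X U : FGCat k) :
    (dropFG hr X ≫ biprod.inl) ≫ (biprod.fst : X ⊞ U ⟶ X) = dropFG hr X := by
  rw [Category.assoc, biprod.inl_fst, Category.comp_id]

/-- Attaching `T⁻¹ Y` to the free object `P` along the zero map gives `P ⊞ Y`; the acyclic summand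
`U` is then added by an `r`-isomorphism. -/
theorem fragDelta_add_le {r : ℝ} {P Y U : FGCat k} {L : List (FGCat k)}
    (hL : ∀ Z ∈ L, Z ∈ stdFamily k) (h : HasConeDecomposition k L P 0) (hU : IsAcyclic k r U) :
    fragDelta k (stdFamily k) ((P ⊞ Y) ⊞ U) Y ≤ ENNReal.ofReal r := by
  obtain ⟨hr, hdrop⟩ := drop_inl (X := P ⊞ Y) hU
  obtain ⟨ω, hω, h'⟩ := hasConeDecomposition_snoc le_rfl hr h _
    (inv_rot_of_distTriang _ (binaryBiproductTriangle_distinguished P Y))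
    (zeroFG _) (Iso.refl _) _ (isRIso_inl _ hU) _ hdrop
  rw [zero_add] at hω
  exact (fragDelta_le hL (l₂ := []) (by simp) (by simpa using h')).trans hω

/-- In this direction the desuspension of `P` is built first. Attaching `T⁻¹ X` along the projection
onto it, up to sign, cancels `P` and leaves `Y ⊞ U`, and projecting away `U` is an `r`-isomorphism.
-/
theorem fragDelta_le_of_iso {r : ℝ} {X P P' Y U : FGCat k} {L : List (FGCat k)}
    (hL : ∀ Z ∈ L, Z ∈ stdFamily k) (h : HasConeDecomposition k L P' 0) (e : P⟦(-1 : ℤ)⟧ ≅ P')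
    (hU : IsAcyclic k r U) (e' : X ≅ (P ⊞ Y) ⊞ U) :
    fragDelta k (stdFamily k) Y X ≤ ENNReal.ofReal r := by
  obtain ⟨hr, -⟩ := id hU
  let i : X ≅ (Y ⊞ U) ⊞ P := e' ≪≫ biprod.associator P Y U ≪≫ biprod.braiding P (Y ⊞ U)
  obtain ⟨ω, hω, h'⟩ := hasConeDecomposition_snoc (A := X⟦(-1 : ℤ)⟧) le_rfl hr h _
    (inv_rot_of_distTriang _ (inv_rot_of_distTriang _
      (binaryBiproductTriangle_distinguished (Y ⊞ U) P)))
    (zeroFG _ ≪≫ (shiftFunctor (FGCat k) (-1 : ℤ)).mapIso i) e _ (isRIso_fst Y hU) _ (drop_fst hr _ _)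
  rw [zero_add] at hω
  exact (fragDelta_le hL (l₂ := []) (by simp) (by simpa using h')).trans hω

end FGCat

/-! ### Dimensions of the filtration steps -/

namespace FiltVect
variable {k : Type u} [Field k]

/-- The subspace of the elements of level at most `t`. -/
def fil (t : ℝ) (V : FiltVect k) : Submodule k V.carrier where
  carrier := {x | V.lev x ≤ t}
  add_mem' hx hy := (V.lev_add_le _ _).trans (max_le hx hy)
  zero_mem' := by simp [lev_zero]
  smul_mem' c x hx := (V.lev_smul_le c x).trans hx

/-- The linear map induced on the subspaces of level at most `t`. -/
def filMap (t : ℝ) {V W : FiltVect k} (f : V ⟶ W) : fil t V →ₗ[k] fil t W :=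
  (Hom.lin f).restrict fun x hx => (le_lev f x).trans hx

theorem filMap_comp (t : ℝ) {U V W : FiltVect k} (f : U ⟶ V) (g : V ⟶ W) (x : fil t U) :
    filMap t (f ≫ g) x = filMap t g (filMap t f x) := rfl

theorem filMap_add (t : ℝ) {V W : FiltVect k} (f g : V ⟶ W) (x : fil t V) :
    filMap t (f + g) x = filMap t f x + filMap t g x := rfl

theorem filMap_id (t : ℝ) {V : FiltVect k} (x : fil t V) : filMap t (𝟙 V) x = x := rfl

theorem filMap_zero (t : ℝ) {V W : FiltVect k} (x : fil t V) : filMap t (0 : V ⟶ W) x = 0 := rfl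

/-- The dimension of the subspace of the elements of level at most `t`. -/
noncomputable def filDim (t : ℝ) (V : FiltVect k) : ℤ := Module.finrank k (fil t V)

theorem filDim_of_isZero (t : ℝ) {V : FiltVect k} (hV : IsZero V) : filDim t V = 0 := by
  have : Subsingleton (fil t V) := ⟨fun x y => Subtype.ext <| by
    rw [eq_zero_of_isZero hV x.1, eq_zero_of_isZero hV y.1]⟩
  simp [filDim, Module.finrank_zero_of_subsingleton]

theorem filDim_split (t : ℝ) {U V W : FiltVect k} (i : U ⟶ V) (p : V ⟶ U) (j : W ⟶ V) (q : V ⟶ W)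
    (hip : i ≫ p = 𝟙 U) (hjq : j ≫ q = 𝟙 W) (hiq : i ≫ q = 0) (hjp : j ≫ p = 0)
    (h : p ≫ i + q ≫ j = 𝟙 V) : filDim t V = filDim t U + filDim t W := by
  let e : fil t V ≃ₗ[k] fil t U × fil t W :=
    LinearEquiv.ofLinearMap ((filMap t p).prod (filMap t q)) ((filMap t i).coprod (filMap t j))
      (LinearMap.ext fun x => by
        refine Prod.ext ?_ ?_
        · change filMap t p (filMap t i x.1 + filMap t j x.2) = x.1
          rw [map_add, ← filMap_comp, ← filMap_comp, hip, hjp, filMap_id, filMap_zero, add_zero]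
        · change filMap t q (filMap t i x.1 + filMap t j x.2) = x.2
          rw [map_add, ← filMap_comp, ← filMap_comp, hiq, hjq, filMap_id, filMap_zero, zero_add])
      (LinearMap.ext fun x => by
        change filMap t i (filMap t p x) + filMap t j (filMap t q x) = x
        rw [← filMap_comp, ← filMap_comp, ← filMap_add, h, filMap_id])
  rw [filDim, e.finrank_eq, Module.finrank_prod, Nat.cast_add]
  rfl

theorem filDim_iso (t : ℝ) {V W : FiltVect k} (e : V ≅ W) : filDim t V = filDim t W := by
  have := filDim_split t e.inv e.hom (0 : zero ⟶ V) 0 e.inv_hom_id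
    (hom_ext fun _ => rfl) comp_zero zero_comp (by simp)
  rw [this, filDim_of_isZero t (V := zero) ((IsZero.iff_id_eq_zero _).2 (hom_ext fun _ => rfl)),
    add_zero]

theorem filDim_biprod (t : ℝ) (V W : FiltVect k) :
    filDim t (V ⊞ W : FiltVect k) = filDim t V + filDim t W :=
  filDim_split t biprod.inl biprod.fst biprod.inr biprod.snd (by simp) (by simp) (by simp) (by simp)
    biprod.total

theorem filDim_line (t a : ℝ) : filDim t (line k a) = if a ≤ t then 1 else 0 := by
  split_ifs with h
  · have : fil t (line k a) = ⊤ := by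
      refine eq_top_iff.2 fun (x : k) _ => ?_
      by_cases hx : x = 0
      · subst hx; exact zero_mem _
      · exact (line_lev a x hx).trans_le (WithBot.coe_le_coe.2 h)
    rw [filDim, this, finrank_top]
    exact congrArg _ (Module.finrank_self k)
  · have : fil t (line k a) = ⊥ := by
      refine eq_bot_iff.2 fun (x : k) hx' => ?_
      by_contra hx
      exact h (WithBot.coe_le_coe.1 ((line_lev a x hx).symm.trans_le hx'))
    rw [filDim, this, finrank_bot]
    rfl

end FiltVect

/-! ### Euler characteristics of the parts of bounded level -/

namespace FGCat
open FiltVect PersistenceCategory TPC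
variable {k : Type u} [Field k]

/-- The Euler characteristic of the subcomplex of the elements of level at most `t`. -/
noncomputable def eulerComplex (t : ℝ) (K : CochainComplex (FiltVect k) ℤ) : ℤ :=
  ∑ᶠ i : ℤ, (i.negOnePow : ℤ) * filDim t (K.X i)

theorem finite_support_euler (t : ℝ) {K : CochainComplex (FiltVect k) ℤ}
    (hK : {n : ℤ | ¬ IsZero (K.X n)}.Finite) :
    (Function.support fun i : ℤ => (i.negOnePow : ℤ) * filDim t (K.X i)).Finite := by
  refine hK.subset fun i hi h => hi ?_
  change _ * _ = _
  rw [filDim_of_isZero t h, mul_zero]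

theorem finsum_negOnePow_shift (z : ℤ → ℤ) :
    ∑ᶠ i : ℤ, (i.negOnePow : ℤ) * z (i + 1) = - ∑ᶠ i : ℤ, (i.negOnePow : ℤ) * z i := by
  rw [← finsum_neg_distrib]
  conv_rhs => rw [← finsum_comp_equiv (Equiv.addRight (1 : ℤ))]
  refine finsum_congr fun i => ?_
  change _ = -(((i + 1).negOnePow : ℤ) * z (i + 1))
  rw [Int.negOnePow_succ]
  simp

/-- A filtered contraction restricts to the elements of level at most `t`, so that subcomplex is
exact. Each dimension is then the sum of the dimensions `z` of two consecutive spaces of cycles, and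
the alternating sum telescopes. -/
theorem eulerComplex_of_homotopy (t : ℝ) {K : CochainComplex (FiltVect k) ℤ}
    (hK : {n : ℤ | ¬ IsZero (K.X n)}.Finite) (h : Homotopy (𝟙 K) 0) : eulerComplex t K = 0 := by
  let z : ℤ → ℤ := fun i => Module.finrank k (LinearMap.ker (filMap t (K.d i (i + 1))))
  have hz : ∀ i, filDim t (K.X i) = z i + z (i + 1) := fun i => by
    have e : LinearMap.range (filMap t (K.d i (i + 1))) =
        LinearMap.ker (filMap t (K.d (i + 1) (i + 1 + 1))) := by
      refine le_antisymm ?_ fun x hx => ?_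
      · rintro _ ⟨x, rfl⟩
        rw [LinearMap.mem_ker, ← filMap_comp, K.d_comp_d, filMap_zero]
      · have hc := h.comm (i + 1)
        rw [dNext_eq h.hom (show (ComplexShape.up ℤ).Rel (i + 1) (i + 1 + 1) from rfl),
          prevD_eq h.hom (show (ComplexShape.up ℤ).Rel i (i + 1) from rfl),
          HomologicalComplex.zero_f, add_zero, HomologicalComplex.id_f] at hc
        refine ⟨filMap t (h.hom (i + 1) i) x, ?_⟩
        rw [← filMap_comp]
        conv_rhs => rw [← filMap_id t x, hc, filMap_add, filMap_comp, LinearMap.mem_ker.1 hx,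
          map_zero, zero_add]
    have := LinearMap.finrank_range_add_finrank_ker (filMap t (K.d i (i + 1)))
    rw [e] at this
    rw [filDim, ← this, Nat.cast_add, add_comm]
  have hf : (Function.support fun i : ℤ => (i.negOnePow : ℤ) * z i).Finite := by
    refine hK.subset fun i hi h => hi ?_
    have h1 := hz i
    rw [filDim_of_isZero t h] at h1
    have h2 : 0 ≤ z i := Nat.cast_nonneg _
    have h3 : 0 ≤ z (i + 1) := Nat.cast_nonneg _
    change _ * z i = 0
    rw [show z i = 0 by omega, mul_zero]
  have hf' : (Function.support fun i : ℤ => (i.negOnePow : ℤ) * z (i + 1)).Finite := by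
    refine hK.subset fun i hi h => hi ?_
    have h1 := hz i
    rw [filDim_of_isZero t h] at h1
    have h2 : 0 ≤ z i := Nat.cast_nonneg _
    have h3 : 0 ≤ z (i + 1) := Nat.cast_nonneg _
    change _ * z (i + 1) = 0
    rw [show z (i + 1) = 0 by omega, mul_zero]
  have : eulerComplex t K = ∑ᶠ i : ℤ, ((i.negOnePow : ℤ) * z i + (i.negOnePow : ℤ) * z (i + 1)) :=
    finsum_congr fun i => by rw [hz, mul_add]
  rw [this, finsum_add_distrib hf hf', finsum_negOnePow_shift, add_neg_cancel]

theorem finite_mappingCone {K L : CochainComplex (FiltVect k) ℤ} (f : K ⟶ L)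
    (hK : {n : ℤ | ¬ IsZero (K.X n)}.Finite) (hL : {n : ℤ | ¬ IsZero (L.X n)}.Finite) :
    {n : ℤ | ¬ IsZero ((CochainComplex.mappingCone f).X n)}.Finite := by
  have h₁ : {i : ℤ | ¬ IsZero (K.X (i + 1))}.Finite :=
    Set.Finite.preimage (f := fun i : ℤ => i + 1) (fun a _ b _ h => by simpa using h) hK
  refine (h₁.union hL).subset fun i hi => ?_
  simp only [Set.mem_ofPred_eq, CochainComplex.mappingCone.isZero_X_iff, not_and_or] at hi
  exact hi

theorem eulerComplex_mappingCone (t : ℝ) {K L : CochainComplex (FiltVect k) ℤ} (f : K ⟶ L)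
    (hK : {n : ℤ | ¬ IsZero (K.X n)}.Finite) (hL : {n : ℤ | ¬ IsZero (L.X n)}.Finite) :
    eulerComplex t L = eulerComplex t K + eulerComplex t (CochainComplex.mappingCone f) := by
  have h : ∀ i, filDim t ((CochainComplex.mappingCone f).X i) =
      filDim t (K.X (i + 1)) + filDim t (L.X i) := fun i =>
    (filDim_iso t (HomologicalComplex.homotopyCofiber.XIsoBiprod f i (i + 1) rfl)).trans
      (filDim_biprod t _ _)
  have e : eulerComplex t (CochainComplex.mappingCone f) =
      ∑ᶠ i : ℤ, ((i.negOnePow : ℤ) * filDim t (K.X (i + 1)) + (i.negOnePow : ℤ) * filDim t (L.X i)) :=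
    finsum_congr fun i => by rw [h, mul_add]
  have hf' : (Function.support fun i : ℤ => (i.negOnePow : ℤ) * filDim t (K.X (i + 1))).Finite := by
    refine (Set.Finite.preimage (f := fun i : ℤ => i + 1) (fun a _ b _ h => by simpa using h)
      hK).subset fun i hi h => hi ?_
    change _ * _ = (0 : ℤ)
    rw [filDim_of_isZero t h, mul_zero]
  rw [e, finsum_add_distrib hf' (finite_support_euler t hL),
    finsum_negOnePow_shift (fun i => filDim t (K.X i))]
  change _ = eulerComplex t K + (-eulerComplex t K + eulerComplex t L)
  ring

/-- The cone of a homotopy equivalence is contractible, so its Euler characteristic vanishes. -/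
theorem eulerComplex_congr (t : ℝ) {K L : CochainComplex (FiltVect k) ℤ}
    (hK : {n : ℤ | ¬ IsZero (K.X n)}.Finite) (hL : {n : ℤ | ¬ IsZero (L.X n)}.Finite)
    (e : (HomotopyCategory.quotient _ (ComplexShape.up ℤ)).obj K ≅
      (HomotopyCategory.quotient _ (ComplexShape.up ℤ)).obj L) :
    eulerComplex t K = eulerComplex t L := by
  obtain ⟨f, hf⟩ := (HomotopyCategory.quotient _ _).map_surjective e.hom
  have hz : IsZero ((HomotopyCategory.quotient _ (ComplexShape.up ℤ)).obj
      (CochainComplex.mappingCone f)) :=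
    Triangle.isZero₃_of_isIso₁ _ (HomotopyCategory.mappingCone_triangleh_distinguished f) (by
      change IsIso ((HomotopyCategory.quotient _ _).map f)
      rw [hf]
      infer_instance)
  have h0 : (HomotopyCategory.quotient _ (ComplexShape.up ℤ)).map
      (𝟙 (CochainComplex.mappingCone f)) =
      (HomotopyCategory.quotient _ (ComplexShape.up ℤ)).map 0 := hz.eq_of_src _ _
  have := eulerComplex_of_homotopy t (finite_mappingCone f hK hL)
    (HomotopyCategory.homotopyOfEq _ _ h0)
  rw [eulerComplex_mappingCone t f hK hL, this, add_zero]

/-- The Euler characteristic of the part of level at most `t`. -/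
noncomputable def euler (t : ℝ) (X : FGCat k) : ℤ := eulerComplex t X.obj.as

theorem euler_triangle (t : ℝ) {T : Triangle (FGCat k)} (hT : T ∈ distTriang (FGCat k)) :
    euler t T.obj₂ = euler t T.obj₁ + euler t T.obj₃ := by
  obtain ⟨f, hf⟩ := (HomotopyCategory.quotient _ _).map_surjective
    (X := T.obj₁.obj.as) (Y := T.obj₂.obj.as) T.mor₁.hom
  have i := Triangle.π₃.mapIso (isoTriangleOfIso₁₂ _ _ ((fgProperty k).ι.map_distinguished _ hT)
    (HomotopyCategory.mappingCone_triangleh_distinguished f) (Iso.refl _) (Iso.refl _)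
    ((Category.comp_id _).trans (hf.symm.trans (Category.id_comp _).symm)))
  rw [euler, eulerComplex_mappingCone t f T.obj₁.property T.obj₂.property, euler, euler]
  congr 1
  exact (eulerComplex_congr t T.obj₃.property
    (finite_mappingCone f T.obj₁.property T.obj₂.property) i).symm

theorem euler_single (t : ℝ) (n : ℤ) (a : ℝ) :
    euler t (single k n a) = (n.negOnePow : ℤ) * if a ≤ t then 1 else 0 := by
  refine (finsum_eq_single _ n fun i hi => ?_).trans ?_
  · rw [filDim_of_isZero t, mul_zero]
    exact HomologicalComplex.isZero_single_obj_X _ _ _ _ hi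
  · rw [← filDim_line (k := k)]
    congr 1
    exact filDim_iso t (HomologicalComplex.singleObjXSelf (ComplexShape.up ℤ) n (line k a))

/-- The Euler characteristics of the parts of level at most `t`, on the Grothendieck group. -/
noncomputable def eulerHom (t : ℝ) : K0 (FGCat k) →+ ℤ :=
  K0.lift (euler t) fun _ hT => euler_triangle t hT

@[simp] theorem eulerHom_cls (t : ℝ) (X : FGCat k) : eulerHom t (K0.cls X) = euler t X :=
  K0.lift_cls _ _ X

theorem eulerHom_E₁ (t a : ℝ) : eulerHom t (K0.cls (E₁ k a)) = if a ≤ t then 1 else 0 := by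
  rw [eulerHom_cls]
  exact (euler_single t 0 a).trans (by simp)

end FGCat

/-! ### Kernels and split lines in filtered spaces -/

namespace FiltVect
variable {k : Type u} [Field k]

theorem isZero_of_forall_eq_zero {V : FiltVect k} (h : ∀ x : V.carrier, x = 0) : IsZero V :=
  (IsZero.iff_id_eq_zero V).2 (hom_ext fun x => h x)

/-- The kernel, with the induced filtration. -/
abbrev kerObj {V W : FiltVect k} (f : V ⟶ W) : FiltVect k where
  carrier := LinearMap.ker (Hom.lin f)
  lev x := V.lev x.1
  lev_eq_bot_iff x := by rw [lev_eq_bot_iff]; exact Submodule.coe_eq_zero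
  lev_smul c x hc := V.lev_smul c x.1 hc
  lev_add_le x y := V.lev_add_le x.1 y.1

/-- The inclusion of the kernel. -/
def kerIncl {V W : FiltVect k} (f : V ⟶ W) : kerObj f ⟶ V :=
  mkHom (V := kerObj f) (LinearMap.ker (Hom.lin f)).subtype fun _ => le_rfl

/-- A filtered map whose composition with `f` vanishes, as a map to the kernel. -/
def kerLift {U V W : FiltVect k} (f : V ⟶ W) (g : U ⟶ V) (h : g ≫ f = 0) : U ⟶ kerObj f :=
  mkHom (W := kerObj f) ((Hom.lin g).codRestrict _ fun x => congrArg (fun f => Hom.lin f x) h)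
    fun x => le_lev g x

theorem kerLift_incl {U V W : FiltVect k} (f : V ⟶ W) (g : U ⟶ V) (h : g ≫ f = 0) :
    kerLift f g h ≫ kerIncl f = g := rfl

theorem kerIncl_comp {V W : FiltVect k} (f : V ⟶ W) : kerIncl f ≫ f = 0 :=
  hom_ext fun x => x.2

theorem kerIncl_cancel {U V W : FiltVect k} (f : V ⟶ W) {g g' : U ⟶ kerObj f}
    (h : g ≫ kerIncl f = g' ≫ kerIncl f) : g = g' :=
  hom_ext fun x => Subtype.ext (congrArg (fun f => Hom.lin f x) h)

/-- Every non-zero element of level `a` spans a line at level `a`, which is a direct summand. -/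
theorem exists_split_line {V : FiltVect k} {x : V.carrier} (hx : x ≠ 0) :
    ∃ (a : ℝ) (i : line k a ⟶ V) (p : V ⟶ line k a), i ≫ p = 𝟙 _ := by
  obtain ⟨a, ha⟩ := WithBot.ne_bot_iff_exists.1 (mt (V.lev_eq_bot_iff x).1 hx)
  let W : Submodule k V.carrier :=
    { carrier := {y | V.lev y < V.lev x}
      add_mem' := fun hy hz => (V.lev_add_le _ _).trans_lt (max_lt hy hz)
      zero_mem' := by
        change V.lev 0 < _
        rw [lev_zero, ← ha]
        exact WithBot.bot_lt_coe a
      smul_mem' := fun c y hy => (V.lev_smul_le c y).trans_lt hy }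
  -- A functional that vanishes on all elements of level below that of `x`, but not at `x`. Where it
  -- is non-zero the level is at least `a`, so as a map to the line at level `a` it does not raise
  -- levels.
  obtain ⟨p, hp, hW⟩ := Submodule.exists_le_ker_of_notMem (p := W) (v := x) (lt_irrefl (V.lev x))
  let p' : V.carrier →ₗ[k] k := (p x)⁻¹ • p
  have hp' : p' x = 1 := inv_mul_cancel₀ hp
  refine ⟨a, mkHom (V := line k a) (LinearMap.toSpanSingleton k _ x) fun (c : k) => ?_,
    mkHom (W := line k a) p' fun y => ?_, hom_ext fun (c : k) => ?_⟩
  · by_cases hc : c = 0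
    · subst hc
      exact ((congrArg V.lev (zero_smul k x)).trans V.lev_zero).le.trans bot_le
    · rw [line_lev a c hc, ha]
      exact V.lev_smul_le c x
  · by_cases hy : p' y = 0
    · rw [hy]
      exact (line k a).lev_zero.le.trans bot_le
    · rw [line_lev a _ hy, ha]
      by_contra h
      refine hy ?_
      change (p x)⁻¹ * p y = 0
      rw [LinearMap.mem_ker.1 (hW (not_le.1 h)), mul_zero]
  · change p' (c • x) = c
    rw [map_smul, hp', smul_eq_mul, mul_one]

end FiltVect

/-! ### The Grothendieck group of filtered complexes -/

namespace FGCat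
open FiltVect PersistenceCategory TPC
variable {k : Type u} [Field k]

section

variable {A K : CochainComplex (FiltVect k) ℤ} (f : A ⟶ K) (r : ∀ i, K.X i ⟶ A.X i)

/-- The projection of `K` along `A`. -/
def splitEnd (i : ℤ) : K.X i ⟶ K.X i := 𝟙 _ - r i ≫ f.f i

variable {r}

theorem splitEnd_retraction (hr : ∀ i, f.f i ≫ r i = 𝟙 _) (i : ℤ) : splitEnd f r i ≫ r i = 0 := by
  rw [splitEnd, Preadditive.sub_comp, Category.assoc, hr, Category.comp_id, Category.id_comp,
    sub_self]

theorem incl_splitEnd (hr : ∀ i, f.f i ≫ r i = 𝟙 _) (i : ℤ) : f.f i ≫ splitEnd f r i = 0 := by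
  rw [splitEnd, Preadditive.comp_sub, ← Category.assoc, hr, Category.comp_id, Category.id_comp,
    sub_self]

/-- The differential maps the image of `A` to itself, so after projection it ignores the
`A`-component of its argument. Hence the projected differential squares to zero and `splitProj` is a
chain map. -/
theorem splitEnd_comm (hr : ∀ i, f.f i ≫ r i = 𝟙 _) (i j : ℤ) :
    splitEnd f r i ≫ K.d i j ≫ splitEnd f r j = K.d i j ≫ splitEnd f r j := by
  conv_lhs => rw [splitEnd]
  rw [Preadditive.sub_comp, Category.assoc, f.comm_assoc, incl_splitEnd f hr, comp_zero, comp_zero,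
    sub_zero, Category.id_comp]

end

theorem kerIncl_splitEnd {A K : CochainComplex (FiltVect k) ℤ} (f : A ⟶ K)
    (r : ∀ i, K.X i ⟶ A.X i) (i : ℤ) : kerIncl (r i) ≫ splitEnd f r i = kerIncl (r i) := by
  rw [splitEnd, Preadditive.comp_sub, ← Category.assoc, kerIncl_comp, zero_comp, sub_zero]
  exact Category.comp_id _

/-- The complement of a degreewise split subcomplex. -/
def splitCokernel {A K : CochainComplex (FiltVect k) ℤ} (f : A ⟶ K) (r : ∀ i, K.X i ⟶ A.X i)
    (hr : ∀ i, f.f i ≫ r i = 𝟙 _) : CochainComplex (FiltVect k) ℤ where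
  X i := kerObj (r i)
  d i j := kerLift (r j) (kerIncl (r i) ≫ K.d i j ≫ splitEnd f r j) (by
    rw [Category.assoc, Category.assoc, splitEnd_retraction f hr, comp_zero, comp_zero])
  shape i j hij := kerIncl_cancel _ (by
    rw [kerLift_incl, K.shape i j hij, zero_comp, comp_zero, zero_comp])
  d_comp_d' i j l _ _ := kerIncl_cancel _ (by
    change kerIncl (r i) ≫ K.d i j ≫ splitEnd f r j ≫ K.d j l ≫ splitEnd f r l = 0
    rw [splitEnd_comm f hr, K.d_comp_d_assoc, zero_comp, comp_zero])

/-- The projection to the complement of a degreewise split subcomplex. -/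
def splitProj {A K : CochainComplex (FiltVect k) ℤ} (f : A ⟶ K) (r : ∀ i, K.X i ⟶ A.X i)
    (hr : ∀ i, f.f i ≫ r i = 𝟙 _) : K ⟶ splitCokernel f r hr where
  f i := kerLift (r i) (splitEnd f r i) (splitEnd_retraction f hr i)
  comm' i j _ := kerIncl_cancel _ (splitEnd_comm f hr i j)

theorem finite_splitCokernel {A K : CochainComplex (FiltVect k) ℤ} (f : A ⟶ K)
    (r : ∀ i, K.X i ⟶ A.X i) (hr : ∀ i, f.f i ≫ r i = 𝟙 _)
    (hK : {n : ℤ | ¬ IsZero (K.X n)}.Finite) :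
    {n : ℤ | ¬ IsZero ((splitCokernel f r hr).X n)}.Finite := by
  refine hK.subset fun i hi h => hi ?_
  exact isZero_of_forall_eq_zero fun x => Subtype.ext (eq_zero_of_isZero h _)

/-- A degreewise split sequence of complexes gives an exact triangle of the homotopy category.
Comparison with an exact triangle on `f` in `FGCat k` identifies the cone of `f` with the
complement. -/
theorem cls_splitCokernel {A K : CochainComplex (FiltVect k) ℤ} (f : A ⟶ K)
    (r : ∀ i, K.X i ⟶ A.X i) (hr : ∀ i, f.f i ≫ r i = 𝟙 _)
    (hA : {n : ℤ | ¬ IsZero (A.X n)}.Finite) (hK : {n : ℤ | ¬ IsZero (K.X n)}.Finite) :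
    K0.cls (ofComplex K hK) = K0.cls (ofComplex A hA) +
      K0.cls (ofComplex (splitCokernel f r hr) (finite_splitCokernel f r hr hK)) := by
  let S : ShortComplex (CochainComplex (FiltVect k) ℤ) :=
    ShortComplex.mk f (splitProj f r hr) (by
      ext1 i
      exact kerIncl_cancel (r i) (incl_splitEnd f hr i))
  let σ : ∀ n, (S.map (HomologicalComplex.eval (FiltVect k) (ComplexShape.up ℤ) n)).Splitting :=
    fun n =>
    { r := r n
      s := kerIncl (r n)
      f_r := hr n
      s_g := kerIncl_cancel (r n) (kerIncl_splitEnd f r n)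
      id := add_sub_cancel (r n ≫ f.f n) (𝟙 (K.X n)) }
  have hT := (HomotopyCategory.distinguished_iff_iso_trianglehOfDegreewiseSplit _).2
    ⟨S, σ, ⟨Iso.refl _⟩⟩
  obtain ⟨Z, g, h, mem⟩ := distinguished_cocone_triangle
    (mk (X := ofComplex A hA) (Y := ofComplex K hK) f)
  let e : Z.obj ≅ (HomotopyCategory.quotient _ _).obj (splitCokernel f r hr) :=
    Triangle.π₃.mapIso (isoTriangleOfIso₁₂ _ _ ((fgProperty k).ι.map_distinguished _ mem) hT
      (Iso.refl _) (Iso.refl _) ((Category.comp_id _).trans (Category.id_comp _).symm))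
  refine (K0.cls_triangle mem).trans (congrArg _ (K0.cls_iso
    (Y := ofComplex (splitCokernel f r hr) (finite_splitCokernel f r hr hK))
    ((fgProperty k).isoMk e)))

theorem cls_single (n : ℤ) (a : ℝ) :
    K0.cls (single k n a) = n.negOnePow • K0.cls (E₁ k a) := by
  have := K0.cls_iso (singleIso (k := k) (-n) a)
  rw [neg_neg] at this
  rw [← this, K0.cls_shift, Int.negOnePow_neg]

/-- Induction on the total dimension, which is a finite sum because the complex vanishes outside
`s`. In the highest non-zero cohomological degree every element is a cycle, so a line split off
there is a subcomplex. Its class is that of some `E₁ k a` up to sign, and the complement is smaller.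
-/
theorem cls_ofComplex_mem (s : Finset ℤ) (N : ℕ) : ∀ (K : CochainComplex (FiltVect k) ℤ)
    (hK : {n : ℤ | ¬ IsZero (K.X n)}.Finite), (∀ i ∉ s, IsZero (K.X i)) →
    ∑ i ∈ s, Module.finrank k (K.X i).carrier ≤ N →
    K0.cls (ofComplex K hK) ∈ AddSubgroup.closure (Set.range fun a => K0.cls (E₁ k a)) := by
  induction N with
  | zero =>
    intro K hK hs hN
    have hz : ∀ i, IsZero (K.X i) := fun i => by
      by_cases hi : i ∈ s
      · have := (Finset.sum_eq_zero_iff.1 (Nat.le_zero.1 hN)) i hi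
        have := Module.finrank_zero_iff.1 this
        exact isZero_of_forall_eq_zero fun x => Subsingleton.elim _ _
      · exact hs i hi
    have : IsZero (ofComplex K hK) := by
      rw [IsZero.iff_id_eq_zero, ← mk_id]
      have h : (𝟙 K : K ⟶ K) = 0 := by
        ext1 i
        exact (hz i).eq_of_src _ _
      exact (congrArg (mk (X := ofComplex K hK) (Y := ofComplex K hK)) h).trans
        (ObjectProperty.hom_ext _ ((HomotopyCategory.quotient _ _).map_zero _ _))
    rw [K0.cls_of_isZero this]
    exact zero_mem _
  | succ N ih =>
    intro K hK hs hN
    by_cases hne : {n : ℤ | ¬ IsZero (K.X n)}.Nonempty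
    · obtain ⟨n, hn, hmax⟩ := hK.exists_maximal hne
      have hn1 : IsZero (K.X (n + 1)) := by
        by_contra h
        have := hmax h (by lia)
        lia
      obtain ⟨x, hx⟩ : ∃ x : (K.X n).carrier, x ≠ 0 := by
        by_contra! h
        exact hn (isZero_of_forall_eq_zero h)
      obtain ⟨a, i, p, hip⟩ := exists_split_line hx
      let A := (HomologicalComplex.single (FiltVect k) (ComplexShape.up ℤ) n).obj (line k a)
      let f : A ⟶ K := HomologicalComplex.mkHomFromSingle i fun j hj => by
        obtain rfl : n + 1 = j := hj
        exact hn1.eq_of_tgt _ _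
      let r : ∀ j, K.X j ⟶ A.X j := fun j =>
        if hj : j = n then (K.XIsoOfEq hj).hom ≫ p ≫
          (HomologicalComplex.singleObjXIsoOfEq (ComplexShape.up ℤ) n (line k a) j hj).inv else 0
      have hr : ∀ j, f.f j ≫ r j = 𝟙 _ := fun j => by
        by_cases hj : j = n
        · subst hj
          simp only [f, r, HomologicalComplex.mkHomFromSingle_f, dif_pos]
          rw [HomologicalComplex.XIsoOfEq_rfl, Iso.refl_hom, Category.id_comp, Category.assoc,
            reassoc_of% hip]
          exact Iso.hom_inv_id _
        · exact (HomologicalComplex.isZero_single_obj_X _ _ _ _ hj).eq_of_src _ _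
      have hA : {n : ℤ | ¬ IsZero (A.X n)}.Finite := (single k n a).property
      rw [cls_splitCokernel f r hr hA hK]
      refine add_mem ?_ (ih _ _ (fun j hj => ?_) ?_)
      · change K0.cls (single k n a) ∈ _
        rw [cls_single]
        rcases Int.even_or_odd n with hn | hn
        · rw [Int.negOnePow_even n hn, one_smul]
          exact AddSubgroup.subset_closure ⟨a, rfl⟩
        · rw [Int.negOnePow_odd n hn, Units.neg_smul, one_smul]
          exact neg_mem (AddSubgroup.subset_closure ⟨a, rfl⟩)
      · exact isZero_of_forall_eq_zero fun x => Subtype.ext (eq_zero_of_isZero (hs j hj) _)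
      · refine Nat.lt_succ_iff.1 (lt_of_lt_of_le (Finset.sum_lt_sum (fun j _ => ?_)
          ⟨n, ?_, ?_⟩) hN)
        · exact Submodule.finrank_le _
        · by_contra h
          exact hn (hs n h)
        · refine Submodule.finrank_lt (s := LinearMap.ker (Hom.lin (r n))) fun h => ?_
          have h0 : r n = 0 := hom_ext fun y => LinearMap.mem_ker.1 (h.ge (Submodule.mem_top (x := y)))
          have h1 := hr n
          rw [h0, comp_zero] at h1
          have h2 : IsZero (line k a) := ((IsZero.iff_id_eq_zero _).2 h1.symm).of_iso
            (HomologicalComplex.singleObjXSelf (ComplexShape.up ℤ) n (line k a)).symm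
          exact one_ne_zero (α := k) (eq_zero_of_isZero h2 (1 : k))
    · refine ih K hK hs ?_
      rw [Set.not_nonempty_iff_eq_empty] at hne
      refine (Finset.sum_eq_zero fun i _ => ?_).le.trans (Nat.zero_le _)
      have hi : IsZero (K.X i) := by
        by_contra h
        exact (hne ▸ (show i ∈ {n : ℤ | ¬ IsZero (K.X n)} from h) : i ∈ (∅ : Set ℤ))
      exact Module.finrank_zero_iff.2 ⟨fun x y => by
        rw [eq_zero_of_isZero hi x, eq_zero_of_isZero hi y]⟩

theorem closure_cls_E₁ : AddSubgroup.closure (Set.range fun a => K0.cls (E₁ k a)) = ⊤ := by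
  refine eq_top_iff.2 fun x _ => ?_
  obtain ⟨X, rfl⟩ := K0.exists_cls_eq x
  refine cls_ofComplex_mem X.property.toFinset _ X.obj.as X.property (fun i hi => ?_) le_rfl
  by_contra h
  exact hi (X.property.mem_toFinset.2 h)

/-- The map that sends `t^a` to the class of `E₁(a)`. -/
noncomputable def fromPoly (k : Type u) [Field k] : (ℝ →₀ ℤ) →+ K0 (FGCat k) :=
  Finsupp.liftAddHom fun a => (smulAddHom ℤ (K0 (FGCat k))).flip (K0.cls (E₁ k a))

theorem fromPoly_single (a : ℝ) (n : ℤ) :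
    fromPoly k (Finsupp.single a n) = n • K0.cls (E₁ k a) := by
  simp [fromPoly]

theorem eulerHom_fromPoly (t : ℝ) (p : ℝ →₀ ℤ) :
    eulerHom t (fromPoly k p) = p.sum fun a n => if a ≤ t then n else 0 := by
  rw [fromPoly, Finsupp.liftAddHom_apply, Finsupp.sum, map_sum]
  refine Finset.sum_congr rfl fun a _ => ?_
  change eulerHom t (p a • K0.cls (E₁ k a)) = _
  rw [map_zsmul, eulerHom_E₁]
  simp

/-- At the lowest exponent the Euler characteristic sees only the lowest coefficient, so the Euler
characteristics detect every non-zero polynomial. -/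
theorem eulerHom_fromPoly_of_min {p : ℝ →₀ ℤ} {a : ℝ} (ha : ∀ b ∈ p.support, a ≤ b) :
    eulerHom a (fromPoly k p) = p a := by
  rw [eulerHom_fromPoly, Finsupp.sum, Finset.sum_eq_single a]
  · simp
  · intro b hb hba
    exact if_neg fun h => hba (le_antisymm h (ha b hb))
  · intro h
    simpa using h

theorem fromPoly_injective : Function.Injective (fromPoly k) := by
  rw [injective_iff_map_eq_zero]
  intro p hp
  by_contra h
  obtain ⟨a, ha, hmin⟩ := p.support.exists_minimal (Finsupp.support_nonempty_iff.2 h)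
  have h1 := eulerHom_fromPoly_of_min (k := k) (p := p) (a := a) fun b hb =>
    (le_total a b).elim id fun h => hmin hb h
  rw [hp, map_zero] at h1
  exact Finsupp.mem_support_iff.1 ha h1.symm

theorem fromPoly_surjective : Function.Surjective (fromPoly k) := by
  rw [← AddMonoidHom.range_eq_top, eq_top_iff, ← closure_cls_E₁, AddSubgroup.closure_le]
  rintro _ ⟨a, rfl⟩
  exact ⟨Finsupp.single a 1, by rw [fromPoly_single, one_smul]⟩

/-- The coefficients of a class in the basis of the classes of the `E₁(a)`. -/
noncomputable def toPoly (k : Type u) [Field k] : K0 (FGCat k) ≃+ (ℝ →₀ ℤ) :=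
  (AddEquiv.ofBijective (fromPoly k) ⟨fromPoly_injective, fromPoly_surjective⟩).symm

theorem toPoly_E₁ (a : ℝ) : toPoly k (K0.cls (E₁ k a)) = Finsupp.single a 1 := by
  rw [toPoly, AddEquiv.symm_apply_eq]
  exact ((fromPoly_single a 1).trans (one_smul _ _)).symm

theorem fromPoly_toPoly (x : K0 (FGCat k)) : fromPoly k (toPoly k x) = x :=
  (toPoly k).symm_apply_apply x

/-- A class is determined by its Euler characteristics. -/
theorem ext_eulerHom {x y : K0 (FGCat k)} (h : ∀ t, eulerHom t x = eulerHom t y) : x = y := by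
  rw [← sub_eq_zero, ← fromPoly_toPoly (x - y)]
  by_contra h0
  have hp : toPoly k (x - y) ≠ 0 := fun h => h0 (by rw [h, map_zero])
  obtain ⟨a, ha, hmin⟩ := (toPoly k (x - y)).support.exists_minimal
    (Finsupp.support_nonempty_iff.2 hp)
  have h1 := eulerHom_fromPoly_of_min (k := k) (p := toPoly k (x - y)) (a := a) fun b hb =>
    (le_total a b).elim id fun h => hmin hb h
  rw [fromPoly_toPoly, map_sub, h, sub_self] at h1
  exact Finsupp.mem_support_iff.1 ha h1.symm

end FGCat

/-! ### The augmentation and the bottleneck distance -/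

namespace FGCat
open FiltVect PersistenceCategory TPC
variable {k : Type u} [Field k]

theorem euler_E₂ (t : ℝ) {b c : ℝ} (h : b ≤ c) :
    euler t (E₂ k h) = (if b ≤ t then 1 else 0) - if c ≤ t then 1 else 0 := by
  have hne : (-1 : ℤ) ≠ 0 := by norm_num
  have h0 : filDim t ((E₂ k h).obj.as.X 0) = if b ≤ t then 1 else 0 := by
    rw [← filDim_line (k := k)]
    exact filDim_iso t (HomologicalComplex.doubleXIso₁ (lineMap (k := k) h) (by simp) hne)
  have h1 : filDim t ((E₂ k h).obj.as.X (-1)) = if c ≤ t then 1 else 0 := by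
    rw [← filDim_line (k := k)]
    exact filDim_iso t (HomologicalComplex.doubleXIso₀ (lineMap (k := k) h) (by simp))
  refine (finsum_eq_sum_of_support_subset (s := {0, -1}) _ fun i hi => ?_).trans ?_
  · by_contra h'
    simp only [Finset.coe_insert, Finset.coe_singleton, Set.mem_insert_iff,
      Set.mem_singleton_iff, not_or] at h'
    refine hi ?_
    change _ * _ = (0 : ℤ)
    rw [filDim_of_isZero t, mul_zero]
    exact HomologicalComplex.isZero_double_X (lineMap (k := k) h) (by simp) i h'.2 h'.1
  · rw [Finset.sum_pair (by norm_num), h0, h1]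
    rw [Int.negOnePow_zero, Int.negOnePow_neg, Int.negOnePow_one, Units.val_neg, Units.val_one, one_mul,
      neg_one_mul, sub_eq_add_neg]

/-- The Euler characteristics agree. This relation lets finite bars move exponents. -/
theorem cls_E₂ {b c : ℝ} (h : b ≤ c) :
    K0.cls (E₂ k h) = K0.cls (E₁ k b) - K0.cls (E₁ k c) :=
  ext_eulerHom fun t => by
    rw [map_sub, eulerHom_E₁, eulerHom_E₁, eulerHom_cls, euler_E₂]

/-- The augmentation, which sends the class of every `E₁(a)` to one. -/
noncomputable def augmentation (k : Type u) [Field k] : K0 (FGCat k) →+ ℤ :=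
  (Finsupp.liftAddHom fun _ => AddMonoidHom.id ℤ).comp (toPoly k).toAddMonoidHom

theorem augmentation_E₁ (a : ℝ) : augmentation k (K0.cls (E₁ k a)) = 1 := by
  change Finsupp.liftAddHom (fun _ : ℝ => AddMonoidHom.id ℤ) (toPoly k (K0.cls (E₁ k a))) = 1
  rw [toPoly_E₁]
  simp

theorem augmentation_E₂ {b c : ℝ} (h : b ≤ c) : augmentation k (K0.cls (E₂ k h)) = 0 := by
  rw [cls_E₂, map_sub, augmentation_E₁, augmentation_E₁, sub_self]

theorem cls_barSum (l : List (ℤ × Bar)) : K0.cls (barSum (k := k) l) =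
    (l.map fun p => (p.1.negOnePow : ℤ) • K0.cls (p.2.toComplex k)).sum := by
  induction l with
  | nil => exact K0.cls_zero
  | cons p l ih =>
    rw [List.map_cons, List.sum_cons, ← ih]
    exact (K0.cls_biprod _ _).trans (congrArg (· + _) (K0.cls_shift _ _))

theorem cls_barSum_append (l l' : List (ℤ × Bar)) :
    K0.cls (barSum (k := k) (l ++ l')) = K0.cls (barSum l) + K0.cls (barSum l') := by
  rw [cls_barSum, cls_barSum, cls_barSum, List.map_append, List.sum_append]

theorem cls_barSum_shift (l : List (ℤ × Bar)) :
    K0.cls (barSum (k := k) (l.map fun p => (p.1 + 1, p.2))) = -K0.cls (barSum l) := by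
  induction l with
  | nil => rw [List.map_nil, barSum, K0.cls_zero, neg_zero]
  | cons p l ih =>
    rw [cls_barSum, cls_barSum] at ih ⊢
    rw [List.map_cons, List.map_cons, List.map_cons, List.sum_cons, List.sum_cons, ih, neg_add,
      Int.negOnePow_succ, Units.val_neg, neg_smul]

/-- The contribution of a bar to the augmentation. -/
def barSign (p : ℤ × Bar) : ℤ :=
  match p with
  | (n, .ray _) => n.negOnePow
  | (_, .fin _ _ _) => 0

theorem augmentation_of_hasBarcode {X : FGCat k} {B : Barcode} (h : HasBarcode X B) :
    augmentation k (K0.cls X) = (B.map barSign).sum := by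
  obtain ⟨l, rfl, ⟨e⟩⟩ := h
  rw [K0.cls_iso e, cls_barSum, map_list_sum, List.map_map, Multiset.map_coe, Multiset.sum_coe]
  refine congrArg List.sum (List.map_congr_left fun p _ => ?_)
  obtain ⟨n, I⟩ := p
  change augmentation k ((n.negOnePow : ℤ) • K0.cls (I.toComplex k)) = _
  rw [map_zsmul]
  cases I with
  | ray a => exact (congrArg _ (augmentation_E₁ a)).trans (mul_one _)
  | fin b c h => exact (congrArg _ (augmentation_E₂ h.le)).trans (mul_zero _)

/-- The modulus up to which the augmentation is invariant under matchings. -/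
def matchModulus (graded : Bool) : ℕ := if graded then 0 else 2

/-- Short bars are finite and contribute nothing. Matched rays contribute equal signs, or signs that
are equal modulo two if degrees are ignored; since `ZMod 0` is `ℤ`, the graded case is an exact
equality. -/
theorem sum_barSign_of_isMatching {graded : Bool} {τ : ℝ} {B D : Barcode}
    (h : IsMatching graded τ B D) :
    ((B.map barSign).sum : ZMod (matchModulus graded)) = ((D.map barSign).sum : ℤ) := by
  obtain ⟨Bs, Bl, Ds, Dl, rfl, rfl, hB, hD, hrel⟩ := h
  have hs : ∀ S : Barcode, (∀ x ∈ S, x.2.IsShort τ) → (S.map barSign).sum = 0 := fun S hS => by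
    refine Multiset.sum_eq_zero fun n hn => ?_
    obtain ⟨⟨m, I⟩, hp, rfl⟩ := Multiset.mem_map.1 hn
    cases I with
    | ray a => exact (hS _ hp).elim
    | fin b c h => rfl
  rw [Multiset.map_add, Multiset.sum_add, Multiset.map_add, Multiset.sum_add, hs _ hB, hs _ hD,
    zero_add, zero_add]
  clear hB hD
  induction hrel with
  | zero => rfl
  | @cons x y Bl Dl hxy _ ih =>
    rw [Multiset.map_cons, Multiset.sum_cons, Multiset.map_cons, Multiset.sum_cons, Int.cast_add,
      Int.cast_add, ih]
    congr 1
    obtain ⟨m, I⟩ := x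
    obtain ⟨n, J⟩ := y
    obtain ⟨hg, hc⟩ := hxy
    cases I with
    | ray a =>
      cases J with
      | ray b =>
        cases graded with
        | true =>
          obtain rfl : m = n := hg rfl
          rfl
        | false =>
          have : ∀ i : ℤ, ((i.negOnePow : ℤ) : ZMod 2) = 1 := fun i => by
            rcases Int.even_or_odd i with hi | hi
            · rw [Int.negOnePow_even i hi]; rfl
            · rw [Int.negOnePow_odd i hi]; rfl
          exact (this m).trans (this n).symm
      | fin _ _ _ => exact hc.elim
    | fin _ _ _ =>
      cases J with
      | ray _ => exact hc.elim
      | fin _ _ _ => rfl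

/-- The classes of the sums of short bars. -/
def shortClasses (k : Type u) [Field k] (τ : ℝ) : AddSubgroup (K0 (FGCat k)) where
  carrier := {z | ∃ l : List (ℤ × Bar), (∀ p ∈ l, p.2.IsShort τ) ∧ K0.cls (barSum l) = z}
  zero_mem' := ⟨[], by simp, K0.cls_zero⟩
  add_mem' := by
    rintro _ _ ⟨l, hl, rfl⟩ ⟨l', hl', rfl⟩
    refine ⟨l ++ l', fun p hp => ?_, cls_barSum_append l l'⟩
    exact (List.mem_append.1 hp).elim (hl p) (hl' p)
  -- Suspension changes the sign of a class and leaves the lengths of the bars alone.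
  neg_mem' := by
    rintro _ ⟨l, hl, rfl⟩
    refine ⟨_, fun p hp => ?_, cls_barSum_shift l⟩
    obtain ⟨q, hq, rfl⟩ := List.mem_map.1 hp
    exact hl q hq

theorem cls_sub_mem_shortClasses {τ b c : ℝ} (h : |b - c| ≤ 2 * τ) :
    K0.cls (E₁ k b) - K0.cls (E₁ k c) ∈ shortClasses k τ := by
  have key : ∀ b c : ℝ, b < c → c - b ≤ 2 * τ →
      K0.cls (E₁ k b) - K0.cls (E₁ k c) ∈ shortClasses k τ := fun b c hbc h => by
    refine ⟨[(0, .fin b c hbc)], fun p hp => ?_, ?_⟩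
    · obtain rfl := List.mem_singleton.1 hp
      exact h
    · rw [cls_barSum]
      simp only [List.map_cons, List.map_nil, List.sum_cons, List.sum_nil, Int.negOnePow_zero,
        Units.val_one, one_smul, add_zero]
      exact cls_E₂ hbc.le
  rcases lt_trichotomy b c with hbc | rfl | hbc
  · exact key b c hbc (by rw [abs_le] at h; linarith)
  · rw [sub_self]
    exact zero_mem _
  · rw [← neg_sub]
    exact neg_mem (key c b hbc ((le_abs_self _).trans h))

/-- Walk from level `0` to level `a` in `N` equal steps of length at most `2τ`; each step is zero
or, up to sign, the class of a short bar. -/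
theorem cls_sub_cls_zero_mem {τ : ℝ} (hτ : 0 < τ) (a : ℝ) :
    K0.cls (E₁ k a) - K0.cls (E₁ k 0) ∈ shortClasses k τ := by
  obtain ⟨N, hN⟩ := exists_nat_gt (|a| / (2 * τ))
  have hN0 : (0 : ℝ) < N := lt_of_le_of_lt (by positivity) hN
  have h : ∀ j : ℕ, K0.cls (E₁ k (j * (a / N))) - K0.cls (E₁ k 0) ∈ shortClasses k τ := fun j => by
    induction j with
    | zero =>
      rw [Nat.cast_zero, zero_mul, sub_self]
      exact zero_mem _
    | succ j ih =>
      rw [← sub_add_sub_cancel _ (K0.cls (E₁ k (j * (a / N))))]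
      refine add_mem (cls_sub_mem_shortClasses ?_) ih
      rw [Nat.cast_succ, add_mul, one_mul, add_sub_cancel_left, abs_div, Nat.abs_cast,
        div_le_iff₀ hN0]
      rw [div_lt_iff₀ (by positivity)] at hN
      linarith
  have := h N
  rwa [mul_div_cancel₀ _ hN0.ne'] at this

theorem sub_augmentation_mem {τ : ℝ} (hτ : 0 < τ) (x : K0 (FGCat k)) :
    x - augmentation k x • K0.cls (E₁ k 0) ∈ shortClasses k τ := by
  have hx : x ∈ AddSubgroup.closure (Set.range fun a => K0.cls (E₁ k a)) := by
    rw [closure_cls_E₁]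
    trivial
  induction hx using AddSubgroup.closure_induction with
  | mem x hx =>
    obtain ⟨a, rfl⟩ := hx
    rw [augmentation_E₁, one_smul]
    exact cls_sub_cls_zero_mem hτ a
  | zero => simp
  | add x y _ _ hx hy =>
    rw [map_add, add_smul, add_sub_add_comm]
    exact add_mem hx hy
  | neg x _ hx =>
    rw [map_neg, neg_smul, ← neg_sub']
    exact neg_mem hx

/-- `p` half-lines starting at level zero in degree zero and `q` ones in degree one. -/
def zeroRays (p q : ℕ) : List (ℤ × Bar) :=
  List.replicate p (0, .ray 0) ++ List.replicate q (1, .ray 0)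

theorem mem_zeroRays {p q : ℕ} {x : ℤ × Bar} (h : x ∈ zeroRays p q) : x.2 = .ray 0 := by
  rcases List.mem_append.1 h with h | h
  · rw [List.eq_of_mem_replicate h]
  · rw [List.eq_of_mem_replicate h]

theorem cls_zeroRays (p q : ℕ) :
    K0.cls (barSum (k := k) (zeroRays p q)) = ((p : ℤ) - q) • K0.cls (E₁ k 0) := by
  rw [zeroRays, cls_barSum_append, cls_barSum, cls_barSum, List.map_replicate, List.map_replicate,
    List.sum_replicate, List.sum_replicate]
  change p • (((0 : ℤ).negOnePow : ℤ) • K0.cls (E₁ k 0)) +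
    q • (((1 : ℤ).negOnePow : ℤ) • K0.cls (E₁ k 0)) = _
  rw [Int.negOnePow_zero, Int.negOnePow_one, sub_smul]
  simp [sub_eq_add_neg]

/-- A bijection needs the same number of rays on both sides, which congruent augmentations do not
provide by themselves. -/
theorem exists_zeroRays {graded : Bool} {m m' : ℤ}
    (h : (m : ZMod (matchModulus graded)) = m') : ∃ p q p' q' : ℕ, (p : ℤ) - q = m ∧
      (p' : ℤ) - q' = m' ∧ p + q = p' + q' ∧ (graded = true → p = p' ∧ q = q') := by
  rw [ZMod.intCast_eq_intCast_iff_dvd_sub] at h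
  obtain ⟨d, hd, hg⟩ : ∃ d : ℤ, m' - m = 2 * d ∧ (graded = true → d = 0) := by
    cases graded with
    | true => exact ⟨0, (zero_dvd_iff.1 h).trans (mul_zero 2).symm, fun _ => rfl⟩
    | false =>
      obtain ⟨d, hd⟩ := h
      exact ⟨d, hd, fun h => (Bool.false_ne_true h).elim⟩
  -- Moving `d` rays from degree one to degree zero keeps their number and changes the signed count
  -- by `2 * d = m' - m`. The extra `|m| + |d|` in each degree keeps all counts non-negative.
  refine ⟨(|m| + |d| + m).toNat, (|m| + |d|).toNat, (|m| + |d| + m + d).toNat,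
    (|m| + |d| - d).toNat, ?_⟩
  have h1 := neg_abs_le m
  have h2 := neg_abs_le d
  have h3 := le_abs_self d
  have h4 := abs_nonneg m
  refine ⟨by lia, by lia, by lia, fun h => ?_⟩
  rw [hg h]
  simp

theorem bottleneckDist_eq_top {graded : Bool} {X Y : FGCat k}
    (h : (augmentation k (K0.cls X) : ZMod (matchModulus graded)) ≠
      (augmentation k (K0.cls Y) : ℤ)) : bottleneckDist graded X Y = ⊤ := by
  simp only [bottleneckDist, iInf_eq_top]
  intro B D hB hD τ hτ hm
  refine (h ?_).elim
  rw [augmentation_of_hasBarcode hB, augmentation_of_hasBarcode hD, sum_barSign_of_isMatching hm]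

theorem inducedDist_bottleneckDist_eq_top {graded : Bool} {x y : K0 (FGCat k)}
    (h : (augmentation k x : ZMod (matchModulus graded)) ≠ (augmentation k y : ℤ)) :
    inducedDist (bottleneckDist graded) x y = ⊤ := by
  simp only [inducedDist, iInf_eq_top]
  rintro X Y rfl rfl
  exact bottleneckDist_eq_top h

/-- For every `τ`, both classes are represented by rays at level zero and bars of length at most
`2τ`. The rays are matched with each other, and all finite bars are left out. -/
theorem inducedDist_bottleneckDist_eq_zero {graded : Bool} {x y : K0 (FGCat k)}
    (h : (augmentation k x : ZMod (matchModulus graded)) = (augmentation k y : ℤ)) :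
    inducedDist (bottleneckDist graded) x y = 0 := by
  rw [← nonpos_iff_eq_zero]
  refine ENNReal.le_of_forall_pos_le_add fun τ hτ _ => ?_
  rw [zero_add]
  have hτ' : (0 : ℝ) < τ := hτ
  obtain ⟨p, q, p', q', hm, hm', hlen, hg⟩ := exists_zeroRays h
  obtain ⟨l, hl, hlx⟩ := sub_augmentation_mem hτ' x
  obtain ⟨l', hl', hly⟩ := sub_augmentation_mem hτ' y
  have hx : K0.cls (barSum (zeroRays p q ++ l)) = x := by
    rw [cls_barSum_append, cls_zeroRays, hlx, hm, add_sub_cancel]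
  have hy : K0.cls (barSum (zeroRays p' q' ++ l')) = y := by
    rw [cls_barSum_append, cls_zeroRays, hly, hm', add_sub_cancel]
  rw [← hx, ← hy]
  refine (inducedDist_le _ _ _).trans ?_
  · refine iInf_le_of_le _ (iInf_le_of_le _ (iInf_le_of_le ⟨_, rfl, ⟨Iso.refl _⟩⟩
      (iInf_le_of_le ⟨_, rfl, ⟨Iso.refl _⟩⟩ (iInf_le_of_le (τ : ℝ) (iInf_le_of_le hτ'
      (iInf_le_of_le ⟨l, zeroRays p q, l', zeroRays p' q', ?_, ?_, hl, hl', ?_⟩ ?_))))))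
    · rw [Multiset.coe_add]
      exact Multiset.coe_eq_coe.2 List.perm_append_comm
    · rw [Multiset.coe_add]
      exact Multiset.coe_eq_coe.2 List.perm_append_comm
    · have hclose : ∀ x ∈ zeroRays p q, ∀ y ∈ zeroRays p' q', x.2.IsClose τ y.2 := by
        intro x hx y hy
        rw [mem_zeroRays hx, mem_zeroRays hy]
        change |(0 : ℝ) - 0| ≤ τ
        simp
      cases graded with
      | true =>
        obtain ⟨rfl, rfl⟩ := hg rfl
        exact Multiset.rel_refl_of_refl_on fun x hx => ⟨fun _ => rfl, hclose x hx x hx⟩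
      | false =>
        refine Multiset.rel_of_forall (fun x y hx hy => ⟨fun h => (Bool.false_ne_true h).elim,
          hclose x hx y hy⟩) ?_
        simpa [zeroRays] using hlen
    · rw [ENNReal.ofReal_coe_nnreal]

/-- The distance is `0` or `∞` according to whether the augmentations agree modulo `matchModulus
graded`. That is an equivalence relation, so no triangle inequality for the bottleneck distance of
objects is called for. -/
theorem isPseudoMetric_bottleneck (graded : Bool) :
    IsPseudoMetric (inducedDist (bottleneckDist (k := k) graded)) where
  self x := inducedDist_bottleneckDist_eq_zero rfl
  symm x y := by
    by_cases h : (augmentation k x : ZMod (matchModulus graded)) = (augmentation k y : ℤ)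
    · rw [inducedDist_bottleneckDist_eq_zero h, inducedDist_bottleneckDist_eq_zero h.symm]
    · rw [inducedDist_bottleneckDist_eq_top h,
        inducedDist_bottleneckDist_eq_top fun h' => h h'.symm]
  triangle x y z := by
    by_cases h : (augmentation k x : ZMod (matchModulus graded)) = (augmentation k y : ℤ)
    · by_cases h' : (augmentation k y : ZMod (matchModulus graded)) = (augmentation k z : ℤ)
      · rw [inducedDist_bottleneckDist_eq_zero (h.trans h')]
        exact zero_le
      · rw [inducedDist_bottleneckDist_eq_top h', add_top]
        exact le_top
    · rw [inducedDist_bottleneckDist_eq_top h, top_add]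
      exact le_top

theorem inducedDist_bottleneck_eq_zero_or_top (graded : Bool) (x y : K0 (FGCat k)) :
    inducedDist (bottleneckDist graded) x y = 0 ∨ inducedDist (bottleneckDist graded) x y = ⊤ := by
  by_cases h : (augmentation k x : ZMod (matchModulus graded)) = (augmentation k y : ℤ)
  · exact .inl (inducedDist_bottleneckDist_eq_zero h)
  · exact .inr (inducedDist_bottleneckDist_eq_top h)

theorem inducedDist_bottleneck_E₁_zero (graded : Bool) :
    inducedDist (bottleneckDist graded) (K0.cls (E₁ k 0)) 0 = ⊤ := by
  refine inducedDist_bottleneckDist_eq_top ?_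
  rw [augmentation_E₁, map_zero]
  cases graded with
  | true => exact one_ne_zero (α := ℤ)
  | false => exact one_ne_zero (α := ZMod 2)

end FGCat

/-! ### Representatives by rays, and the vanishing of the induced fragmentation distance -/

namespace FGCat
open FiltVect PersistenceCategory TPC
variable {k : Type u} [Field k]

theorem cls_raySum (l : List (ℤ × ℝ)) : K0.cls (raySum k l) =
    (l.map fun p => (p.1.negOnePow : ℤ) • K0.cls (E₁ k p.2)).sum := by
  rw [cls_barSum, List.map_map]
  rfl

theorem exists_raySum_smul (n : ℤ) (a : ℝ) : ∃ l : List (ℤ × ℝ), (∀ p ∈ l, p.2 = a) ∧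
    K0.cls (raySum k l) = n • K0.cls (E₁ k a) := by
  refine ⟨List.replicate n.toNat (0, a) ++ List.replicate (-n).toNat (1, a), fun p hp => ?_, ?_⟩
  · rcases List.mem_append.1 hp with h | h
    · rw [List.eq_of_mem_replicate h]
    · rw [List.eq_of_mem_replicate h]
  · rw [cls_raySum, List.map_append, List.sum_append, List.map_replicate, List.map_replicate,
      List.sum_replicate, List.sum_replicate, Int.negOnePow_zero, Int.negOnePow_one]
    conv_rhs => rw [← Int.toNat_sub_toNat_neg n, sub_smul]
    rw [natCast_zsmul, natCast_zsmul, Units.val_one, Units.val_neg, Units.val_one, one_smul, neg_smul,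
      one_smul, smul_neg, sub_eq_add_neg]

theorem exists_raySum (x : K0 (FGCat k)) : ∃ l : List (ℤ × ℝ),
    (∀ p ∈ l, p.2 ∈ (toPoly k x).support) ∧ K0.cls (raySum k l) = x := by
  have key : ∀ (s : Finset ℝ) (f : ℝ → ℤ), ∃ l : List (ℤ × ℝ), (∀ p ∈ l, p.2 ∈ s) ∧
      K0.cls (raySum k l) = ∑ a ∈ s, f a • K0.cls (E₁ k a) := by
    classical
    intro s f
    induction s using Finset.induction_on with
    | empty => exact ⟨[], by simp, K0.cls_zero⟩
    | insert a s ha ih =>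
      obtain ⟨l, hl, h⟩ := ih
      obtain ⟨l', hl', h'⟩ := exists_raySum_smul (k := k) (f a) a
      refine ⟨l' ++ l, fun p hp => ?_, ?_⟩
      · rcases List.mem_append.1 hp with hp | hp
        · exact Finset.mem_insert.2 (.inl (hl' p hp))
        · exact Finset.mem_insert_of_mem (hl p hp)
      · rw [Finset.sum_insert ha, ← h, ← h', cls_raySum, cls_raySum, cls_raySum, List.map_append,
          List.sum_append]
  obtain ⟨l, hl, h⟩ := key (toPoly k x).support (toPoly k x)
  refine ⟨l, hl, h.trans ?_⟩
  conv_rhs => rw [← fromPoly_toPoly x, fromPoly, Finsupp.liftAddHom_apply]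
  rfl

theorem isAcyclic_barSum {τ : ℝ} (hτ : 0 ≤ τ) {l : List (ℤ × Bar)}
    (hl : ∀ p ∈ l, p.2.IsShort τ) : IsAcyclic k (2 * τ) (barSum (k := k) l) := by
  induction l with
  | nil => exact isAcyclic_of_isZero (by positivity) (isZero_zero _)
  | cons p l ih =>
    refine IsAcyclic.biprod (IsAcyclic.shift ?_ p.1) (ih fun q hq => hl q (List.mem_cons_of_mem _ hq))
    have h := hl p List.mem_cons_self
    obtain ⟨n, I⟩ := p
    cases I with
    | ray a => exact h.elim
    | fin b c hbc =>
      have h' : c - b ≤ 2 * τ := h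
      exact isAcyclic_E₂ hbc.le (by linarith)

/-- By `sub_augmentation_mem`, `x` is the class of `(P ⊞ Y) ⊞ U` with `P` a sum of shifts of `E₁(0)`
and `U` a sum of short bars. Both `P` and its desuspension are free, so each direction of the
distance to `Y` costs at most `τ`. -/
theorem inducedDist_fragDist (x y : K0 (FGCat k)) :
    inducedDist (fragDist k (stdFamily k)) x y = 0 := by
  rw [← nonpos_iff_eq_zero]
  refine ENNReal.le_of_forall_pos_le_add fun τ hτ _ => ?_
  rw [zero_add]
  -- Shortness with parameter `τ / 2` means length at most `τ`, which makes `U` a `τ`-acyclic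
  -- object.
  have hτ' : (0 : ℝ) < τ / 2 := half_pos hτ
  obtain ⟨Y, rfl⟩ := K0.exists_cls_eq y
  obtain ⟨l, hl, hU⟩ := sub_augmentation_mem hτ' (x - K0.cls Y)
  obtain ⟨l', hl', hP⟩ := exists_raySum_smul (k := k) (augmentation k (x - K0.cls Y)) 0
  have hac : IsAcyclic k (τ : ℝ) (barSum (k := k) l) := by
    have := isAcyclic_barSum (k := k) hτ'.le hl
    rwa [mul_div_cancel₀ _ (two_ne_zero' ℝ)] at this
  have hx : K0.cls ((raySum k l' ⊞ Y) ⊞ barSum l) = x := by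
    rw [K0.cls_biprod, K0.cls_biprod, hU, hP]
    abel
  obtain ⟨L, hL, h⟩ := build_raySum (k := k) (l := l') fun p hp => (hl' p hp).ge
  obtain ⟨j⟩ := shift_raySum (k := k) (-1) l'
  obtain ⟨L', hL', h'⟩ := build_raySum (k := k) (l := l'.map fun p => (p.1 + -1, p.2)) fun p hp => by
    obtain ⟨q, hq, rfl⟩ := List.mem_map.1 hp
    exact (hl' q hq).ge
  rw [← hx, ← ENNReal.ofReal_coe_nnreal]
  exact (inducedDist_le _ _ _).trans
    (max_le (fragDelta_add_le hL h hac) (fragDelta_le_of_iso hL' h' j hac (Iso.refl _)))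

end FGCat

/-! ### The lower bound for the fragmentation distance, and the norm -/

namespace FGCat
open FiltVect PersistenceCategory TPC
variable {k : Type u} [Field k]

/-- All cycles of level less than `c` are boundaries, of elements of any level. -/
def CyclesBound (X : FGCat k) (c : ℝ) : Prop :=
  ∀ (n : ℤ) (x : (X.obj.as.X n).carrier), Hom.lin (X.obj.as.d n (n + 1)) x = 0 →
    (X.obj.as.X n).lev x < c → ∃ y, Hom.lin (X.obj.as.d (n - 1) n) y = x

theorem CyclesBound.mono {X : FGCat k} {c c' : ℝ} (hX : CyclesBound X c) (h : c' ≤ c) :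
    CyclesBound X c' := fun n x hx hc => hX n x hx (hc.trans_le (WithBot.coe_le_coe.2 h))

theorem LevGE.eq_zero {X : FGCat k} {c : ℝ} (hX : LevGE X c) {n : ℤ} {x : (X.obj.as.X n).carrier}
    (hx : (X.obj.as.X n).lev x < c) : x = 0 := by
  by_contra h
  exact not_lt.2 (hX n x h) hx

theorem LevGE.cyclesBound {X : FGCat k} {c : ℝ} (hX : LevGE X c) : CyclesBound X c :=
  fun _ _ _ hc => ⟨0, by rw [map_zero, LevGE.eq_zero hX hc]⟩

theorem lin_of_homotopy {r : ℝ} (hr : 0 ≤ r) {U V V₁ V₀ : FiltVect k} (a : (raise r).obj V ⟶ U)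
    (b : U ⟶ V) (d : V ⟶ V₁) (h₁ : (raise r).obj V₁ ⟶ V) (h₀ : (raise r).obj V ⟶ V₀) (d' : V₀ ⟶ V)
    (h : a ≫ b = (raise r).map d ≫ h₁ + h₀ ≫ d' + dropHom hr V) (x : V.carrier)
    (hx : Hom.lin d x = 0) :
    Hom.lin b (Hom.lin a x) = Hom.lin d' (Hom.lin h₀ x) + x := by
  have e : Hom.lin b (Hom.lin a x) =
      Hom.lin h₁ (Hom.lin d x) + Hom.lin d' (Hom.lin h₀ x) + x :=
    congrArg (fun f : (raise r).obj V ⟶ V => Hom.lin f x) h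
  rw [hx] at e
  exact e.trans (congrArg (· + _) ((congrArg (· + _) (map_zero (Hom.lin h₁))).trans (zero_add _)))

theorem lin_eq_zero_of_comm {r : ℝ} {U U₁ V V₁ : FiltVect k} (a : (raise r).obj V ⟶ U)
    (b : U ⟶ U₁) (d : V ⟶ V₁) (a₁ : (raise r).obj V₁ ⟶ U₁) (h : a ≫ b = (raise r).map d ≫ a₁)
    (x : V.carrier) (hx : Hom.lin d x = 0) : Hom.lin b (Hom.lin a x) = 0 := by
  have e : Hom.lin b (Hom.lin a x) = Hom.lin a₁ (Hom.lin d x) :=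
    congrArg (fun f : (raise r).obj V ⟶ U₁ => Hom.lin f x) h
  rw [hx] at e
  exact e.trans (map_zero (Hom.lin a₁))

/-- A cycle of `Y` of level below `c - r` is sent by `ψ` to a cycle of level below `c`, hence to a
boundary. Its image under `φ` bounds as well and is homologous to the original cycle, because `φ ∘
ψ` is homotopic to the drop map. -/
theorem CyclesBound.of_drop {X Y : FGCat k} {c r : ℝ} (hX : CyclesBound X c) (hr : 0 ≤ r)
    (φ : X ⟶ Y) (ψ : (sigmaFG r).obj Y ⟶ X) (h : ψ ≫ φ = dropFG hr Y) :
    CyclesBound Y (c - r) := by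
  intro n x hx hc
  obtain ⟨φ, rfl⟩ := mk_surjective φ
  obtain ⟨ψ, rfl⟩ := mk_surjective ψ
  have h' := congrArg (fun f => f.hom) ((mk_comp ψ φ).symm.trans h)
  have H := HomotopyCategory.homotopyOfEq _ _ h'
  have hcomm := H.comm n
  rw [dNext_eq H.hom (show (ComplexShape.up ℤ).Rel n (n + 1) from rfl),
    prevD_eq H.hom (show (ComplexShape.up ℤ).Rel (n - 1) n by simp)] at hcomm
  have e := lin_of_homotopy hr (ψ.f n) (φ.f n) _ _ _ _ hcomm x hx
  have hψ : Hom.lin (X.obj.as.d n (n + 1)) (Hom.lin (ψ.f n) x) = 0 :=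
    lin_eq_zero_of_comm (ψ.f n) (X.obj.as.d n (n + 1)) (Y.obj.as.d n (n + 1)) (ψ.f (n + 1))
      (ψ.comm n (n + 1)) x hx
  obtain ⟨y, hy⟩ := hX n (Hom.lin (ψ.f n) x) hψ ((le_lev (ψ.f n) x).trans_lt (by
    change (Y.obj.as.X n).lev x + (r : WithBot ℝ) < c
    by_cases h0 : (Y.obj.as.X n).lev x = ⊥
    · rw [h0, WithBot.bot_add]
      exact WithBot.bot_lt_coe c
    · obtain ⟨t, ht⟩ := WithBot.ne_bot_iff_exists.1 h0
      rw [← ht] at hc ⊢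
      have := WithBot.coe_lt_coe.1 hc
      exact WithBot.coe_lt_coe.2 (by linarith)))
  have h2 : Hom.lin (Y.obj.as.d (n - 1) n) (Hom.lin (φ.f (n - 1)) y) =
      Hom.lin (φ.f n) (Hom.lin (X.obj.as.d (n - 1) n) y) :=
    congrArg (fun f => Hom.lin f y) (φ.comm (n - 1) n)
  exact ⟨Hom.lin (φ.f (n - 1)) y - Hom.lin (H.hom n (n - 1)) x, (map_sub _ _ _).trans
    (sub_eq_iff_eq_add'.2 (h2.trans ((congrArg (Hom.lin (φ.f n)) hy).trans e)))⟩

theorem CyclesBound.of_iso {X Y : FGCat k} {c : ℝ} (hX : CyclesBound X c) (e : X ≅ Y) :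
    CyclesBound Y c := by
  have h := CyclesBound.of_drop hX le_rfl e.hom ((zeroFG Y).hom ≫ e.inv) (by
    rw [Category.assoc, e.inv_hom_id, Category.comp_id]
    rfl)
  rwa [sub_zero] at h

theorem CyclesBound.sigma {X : FGCat k} {c : ℝ} (hX : CyclesBound X c) (t : ℝ) :
    CyclesBound ((sigmaFG t).obj X) (c + t) := fun n x hx hc => by
  refine hX n x hx ?_
  have hc' : (X.obj.as.X n).lev x + (t : WithBot ℝ) < ((c + t : ℝ) : WithBot ℝ) := hc
  rw [WithBot.coe_add] at hc'
  exact lt_of_add_lt_add_right hc'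

theorem LevGE.sigma {X : FGCat k} {c t : ℝ} (hX : LevGE X c) (ht : 0 ≤ t) :
    LevGE ((sigmaFG t).obj X) c := fun n x hx => by
  refine (hX n x hx).trans ?_
  change (X.obj.as.X n).lev x ≤ (X.obj.as.X n).lev x + (t : WithBot ℝ)
  exact le_add_of_nonneg_right (WithBot.coe_le_coe.2 ht)

/-- The `A`-component of an element of level below `c ≤ 0` vanishes, so a cycle of such level comes
from `B`, where it already bounds. -/
theorem cyclesBound_mappingCone {A B : FGCat k} {c : ℝ} (hA : LevGE A 0) (hB : CyclesBound B c)
    (hc : c ≤ 0) (f : A.obj.as ⟶ B.obj.as) :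
    CyclesBound (ofComplex _ (finite_mappingCone f A.property B.property)) c := by
  intro n x hx hx'
  let C := CochainComplex.mappingCone f
  have hfst : Hom.lin ((CochainComplex.mappingCone.fst f).1.v n (n + 1) rfl) x = 0 :=
    LevGE.eq_zero hA ((le_lev _ x).trans_lt (hx'.trans_le (WithBot.coe_le_coe.2 hc)))
  let b : (B.obj.as.X n).carrier :=
    Hom.lin ((CochainComplex.mappingCone.snd f).v n n (add_zero n)) x
  have hb : Hom.lin (B.obj.as.d n (n + 1)) b = 0 := by
    have h : Hom.lin ((CochainComplex.mappingCone.snd f).v (n + 1) (n + 1) (add_zero _))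
        (Hom.lin (C.d n (n + 1)) x) =
        Hom.lin (f.f (n + 1)) (Hom.lin ((CochainComplex.mappingCone.fst f).1.v n (n + 1) rfl) x) +
        Hom.lin (B.obj.as.d n (n + 1)) b :=
      congrArg (fun g => Hom.lin g x) (CochainComplex.mappingCone.d_snd_v f n (n + 1) rfl)
    have hx0 : Hom.lin (C.d n (n + 1)) x = 0 := hx
    rw [hx0, hfst, map_zero, map_zero, zero_add] at h
    exact h.symm
  have hxb : x = Hom.lin ((CochainComplex.mappingCone.inr f).f n) b := by
    have h : Hom.lin ((CochainComplex.mappingCone.inl f).v (n + 1) n (by lia))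
        (Hom.lin ((CochainComplex.mappingCone.fst f).1.v n (n + 1) rfl) x) +
        Hom.lin ((CochainComplex.mappingCone.inr f).f n) b = x :=
      congrArg (fun g => Hom.lin g x) (CochainComplex.mappingCone.id_X f n (n + 1) rfl)
    rw [hfst, map_zero, zero_add] at h
    exact h.symm
  obtain ⟨β, hβ⟩ := hB n b hb ((le_lev _ x).trans_lt hx')
  refine ⟨Hom.lin ((CochainComplex.mappingCone.inr f).f (n - 1)) β, ?_⟩
  refine (congrArg (fun g => Hom.lin g β) ((CochainComplex.mappingCone.inr f).comm (n - 1) n)).trans ?_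
  rw [hxb]
  exact congrArg _ hβ

theorem cyclesBound_obj₃ {T : Triangle (FGCat k)} (hT : T ∈ distTriang (FGCat k)) {A : FGCat k}
    {c : ℝ} (e : A ≅ T.obj₁) (hA : LevGE A 0) (hB : CyclesBound T.obj₂ c) (hc : c ≤ 0) :
    CyclesBound T.obj₃ c := by
  obtain ⟨f, hf⟩ := mk_surjective (e.hom ≫ T.mor₁)
  have i := Triangle.π₃.mapIso (isoTriangleOfIso₁₂ _ _
    (HomotopyCategory.mappingCone_triangleh_distinguished f)
    ((fgProperty k).ι.map_distinguished _ hT) ((fgProperty k).ι.mapIso e) (Iso.refl _)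
    ((Category.comp_id _).trans (congrArg (fun g => g.hom) hf)))
  exact CyclesBound.of_iso (cyclesBound_mappingCone hA hB hc f) ((fgProperty k).isoMk i)

/-- The object is isomorphic to a complex without elements of negative level. -/
def IsNonneg (X : FGCat k) : Prop := ∃ A : FGCat k, Nonempty (A ≅ X) ∧ LevGE A 0

theorem exists_levGE_of_isZero {X : FGCat k} (hX : IsZero X) (c : ℝ) :
    ∃ A : FGCat k, Nonempty (A ≅ X) ∧ LevGE A c := by
  obtain ⟨A, -, ⟨e⟩, h⟩ := exists_trivialDifferential_raySum (k := k) []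
  exact ⟨A, ⟨e ≪≫ (isZero_zero (FGCat k)).iso hX⟩, h c (by simp)⟩

theorem isNonneg_of_mem_stdFamily {X : FGCat k} (hX : X ∈ stdFamily k) : IsNonneg X := by
  obtain ⟨n, rfl⟩ := hX
  exact ⟨_, ⟨(singleIso n 0).symm⟩, levGE_single _ le_rfl⟩

/-- The threshold is `c - s₁` for `Σ^{-s₁}` of the second object and for the cone `D'`, drops by `r`
along `φ`, and rises by `s₂` when `Σ^{-s₂}` is undone; as `s₁ ≤ s₂`, the result is at least `c - r`.
The stabilization does no harm, because `Σˢ` with `0 ≤ s` creates no negative levels in the first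
object. -/
theorem cyclesBound_of_hasStrictLift {Δ : InftyTriangle k (FGCat k)} {s r c : ℝ} (hs : 0 ≤ s)
    (h : (Δ.shift s).HasStrictLift r) (hA : IsNonneg Δ.obj₁) (hB : CyclesBound Δ.obj₂ c)
    (hc : c ≤ 0) : 0 ≤ r ∧ CyclesBound Δ.obj₃ (c - r) := by
  obtain ⟨s₁, s₂, u, v, w, h1, h2, h3, -, -, -, hr, D', v', w', φ, ψ, mem, -, hψ, -, -⟩ := h
  obtain ⟨A, ⟨e⟩, hA⟩ := hA
  refine ⟨hr, ?_⟩
  have hD' : CyclesBound D' (c + -s₁) :=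
    cyclesBound_obj₃ mem ((sigmaFG s).mapIso e) (LevGE.sigma hA hs) (CyclesBound.sigma hB (-s₁))
      (by linarith)
  have hdrop : ψ ≫ φ = dropFG hr _ := hψ.trans (by
    rfl)
  have hD := CyclesBound.sigma (CyclesBound.of_drop hD' hr φ ψ hdrop) s₂
  have i : (sigmaFG s₂).obj ((sigmaFG (-s₂)).obj Δ.obj₃) ≅ Δ.obj₃ :=
    (splitFG (neg_add_cancel s₂) Δ.obj₃).symm ≪≫ zeroFG _
  exact CyclesBound.mono (CyclesBound.of_iso hD i) (by linarith)

/-- Weights are infima that need not be attained. The strict inequality `ω < W` leaves room to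
choose, at each step, an actual strict lift of some weight `r`, and to pass `W - r` on to the
preceding steps. -/
theorem cyclesBound_of_hasConeDecomposition {l : List (FGCat k)} {X : FGCat k} {ω : ℝ≥0∞}
    (h : HasConeDecomposition k l X ω) (hl : ∀ Z ∈ l, IsNonneg Z) {W : ℝ} (hW : 0 ≤ W)
    (hω : ω < ENNReal.ofReal W) : CyclesBound X (-W) := by
  induction h generalizing W with
  | nil =>
    obtain ⟨A, ⟨e⟩, hA⟩ := exists_levGE_of_isZero (isZero_zero (FGCat k)) (-W)
    exact CyclesBound.of_iso (LevGE.cyclesBound hA) e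
  | @snoc l ω Δ hΔ h ih =>
    have hw : Δ.weight < ENNReal.ofReal W - ω := lt_tsub_iff_left.2 hω
    simp only [InftyTriangle.weight, InftyTriangle.unstableWeight, iInf_lt_iff] at hw
    obtain ⟨s, hs, r, hr, hlt⟩ := hw
    have hlt' : ω < ENNReal.ofReal W - ENNReal.ofReal r :=
      lt_tsub_iff_right.2 (lt_tsub_iff_left.1 hlt)
    have hr0 : 0 ≤ r := by
      obtain ⟨_, _, _, _, _, _, _, _, _, _, _, hr, _⟩ := hr
      exact hr
    rw [← ENNReal.ofReal_sub _ hr0] at hlt'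
    have hpos : 0 < W - r := by
      by_contra hn
      rw [ENNReal.ofReal_of_nonpos (not_lt.1 hn)] at hlt'
      exact not_lt_bot hlt'
    have := (cyclesBound_of_hasStrictLift hs hr (hl _ (by simp))
      (ih (fun Z hZ => hl Z (by simp [hZ])) hpos.le hlt') (by linarith)).2
    exact CyclesBound.mono this (by linarith)

/-- With trivial differential every element is a cycle and only `0` is a boundary, so `CyclesBound X
(-W)` excludes non-zero elements of level below `-W`. It applies because all attached objects,
including `T⁻¹ 0`, are without negative levels up to isomorphism. -/
theorem le_fragDelta_zero {X : FGCat k} (hX : X ∈ trivialDifferential k) {n : ℤ}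
    {x : (X.obj.as.X n).carrier} (hx : x ≠ 0) {a : ℝ} (ha : (X.obj.as.X n).lev x ≤ a) :
    ENNReal.ofReal (-a) ≤ fragDelta k (stdFamily k) X 0 := by
  refine le_iInf fun l₁ => le_iInf fun l₂ => le_iInf fun ω => le_iInf fun h₁ => le_iInf fun h₂ =>
    le_iInf fun h => ?_
  by_contra hlt
  obtain ⟨W, hW, hWa⟩ := ENNReal.lt_iff_exists_nnreal_btwn.1 (not_le.1 hlt)
  rw [← ENNReal.ofReal_coe_nnreal] at hW hWa
  have hWa' : (W : ℝ) < -a := (ENNReal.ofReal_lt_ofReal_iff_of_nonneg W.2).1 hWa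
  have hb := cyclesBound_of_hasConeDecomposition h (fun Z hZ => ?_) W.2 hW
  · obtain ⟨y, hy⟩ := hb n x (by rw [hX]; rfl) (ha.trans_lt (WithBot.coe_lt_coe.2 (lt_neg_of_lt_neg hWa')))
    rw [hX] at hy
    exact hx hy.symm
  · simp only [List.mem_append, List.mem_singleton] at hZ
    rcases hZ with (hZ | rfl) | hZ
    · exact isNonneg_of_mem_stdFamily (h₁ Z hZ)
    · exact exists_levGE_of_isZero
        (Functor.map_isZero (shiftFunctor (FGCat k) (-1 : ℤ)) (isZero_zero _)) 0
    · exact isNonneg_of_mem_stdFamily (h₂ Z hZ)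

theorem exists_lev_le_of_euler_ne_zero {X : FGCat k} {t : ℝ} (h : euler t X ≠ 0) :
    ∃ (n : ℤ) (x : (X.obj.as.X n).carrier), x ≠ 0 ∧ (X.obj.as.X n).lev x ≤ t := by
  by_contra! hx
  refine h ((finsum_congr fun n => ?_).trans finsum_zero)
  have : fil t (X.obj.as.X n) = ⊥ := by
    refine eq_bot_iff.2 fun x hx' => ?_
    by_contra h0
    exact not_lt.2 hx' (hx n x h0)
  rw [filDim, this, finrank_bot, Nat.cast_zero, mul_zero]

/-- The norm of `∑ nᵢ t^{aᵢ}` is the maximum of the numbers `-aᵢ` and `0`. -/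
theorem strongNorm_eq (x : K0 (FGCat k)) :
    strongNorm (fragDist k (stdFamily k)) (trivialDifferential k) x =
      (toPoly k x).support.sup fun a => ENNReal.ofReal (-a) := by
  refine le_antisymm ?_ ?_
  · obtain ⟨l, hl, rfl⟩ := exists_raySum x
    have hfin : ((toPoly k (K0.cls (raySum k l))).support.sup fun a => ENNReal.ofReal (-a)) ≠ ⊤ :=
      ((Finset.sup_lt_iff ENNReal.zero_lt_top).2 fun _ _ => ENNReal.ofReal_lt_top).ne
    obtain ⟨X, hX, ⟨e⟩, hlev⟩ := exists_trivialDifferential_raySum (k := k) l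
    rw [← ENNReal.ofReal_toReal hfin]
    conv_lhs => rw [← K0.cls_iso e]
    refine (strongNorm_le _ hX).trans (fragDist_zero_le e ENNReal.toReal_nonneg
      (hlev _ fun p hp => ?_))
    rw [neg_le, ← ENNReal.ofReal_le_ofReal_iff ENNReal.toReal_nonneg, ENNReal.ofReal_toReal hfin]
    exact Finset.le_sup (f := fun a => ENNReal.ofReal (-a)) (hl p hp)
  · refine Finset.sup_le fun b hb => le_iInf fun X => le_iInf fun hX => le_iInf fun hXx => ?_
    subst hXx
    -- At the smallest exponent `a` the Euler characteristic equals the coefficient of `t^a`, which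
    -- is not zero. So every representative has a non-zero element of level at most `a`, to which
    -- `le_fragDelta_zero` applies.
    obtain ⟨a, ha, hmin⟩ := (toPoly k (K0.cls X)).support.exists_minimal ⟨b, hb⟩
    have hmin' : ∀ c ∈ (toPoly k (K0.cls X)).support, a ≤ c := fun c hc =>
      (le_total a c).elim id fun h => hmin hc h
    have h1 := eulerHom_fromPoly_of_min (k := k) hmin'
    rw [fromPoly_toPoly, eulerHom_cls] at h1
    obtain ⟨n, y, hy, hya⟩ := exists_lev_le_of_euler_ne_zero (X := X) (t := a) (by
      rw [h1]
      exact Finsupp.mem_support_iff.1 ha)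
    exact (ENNReal.ofReal_le_ofReal (neg_le_neg (hmin' b hb))).trans
      ((le_fragDelta_zero hX hy hya).trans (le_max_left _ _))

/-- Read off from `strongNorm_eq`: negation preserves the support, and the support of a sum lies in
the union of the supports. The norm of a sum is even at most the maximum of the norms. -/
theorem isGroupSeminorm_strongNorm :
    IsGroupSeminorm (strongNorm (fragDist k (stdFamily k)) (trivialDifferential k)) where
  zero := by
    rw [strongNorm_eq, map_zero]
    rfl
  neg x := by rw [strongNorm_eq, strongNorm_eq, map_neg, Finsupp.support_neg]
  add_le x y := by
    classical
    rw [strongNorm_eq, strongNorm_eq, strongNorm_eq, map_add]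
    refine (Finset.sup_mono Finsupp.support_add).trans ?_
    rw [Finset.sup_union]
    exact max_le le_self_add le_add_self

theorem strongNorm_fragDist_ne_top (x : K0 (FGCat k)) :
    strongNorm (fragDist k (stdFamily k)) (trivialDifferential k) x ≠ ⊤ := by
  rw [strongNorm_eq]
  exact ((Finset.sup_lt_iff ENNReal.zero_lt_top).2 fun _ _ => ENNReal.ofReal_lt_top).ne

theorem strongNorm_E₁ (a : ℝ) : strongNorm (fragDist k (stdFamily k)) (trivialDifferential k)
    (K0.cls (E₁ k a)) = ENNReal.ofReal (-a) := by
  rw [strongNorm_eq, toPoly_E₁, Finsupp.support_single _ one_ne_zero, Finset.sup_singleton]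

theorem exists_trivialDifferential_cls (x : K0 (FGCat k)) :
    ∃ X ∈ trivialDifferential k, K0.cls X = x := by
  obtain ⟨l, -, rfl⟩ := exists_raySum x
  obtain ⟨X, hX, ⟨e⟩, -⟩ := exists_trivialDifferential_raySum (k := k) l
  exact ⟨X, hX, K0.cls_iso e⟩

/-- The coefficients of a class, as a Laurent polynomial with real exponents. -/
noncomputable def laurentEquiv (k : Type u) [Field k] : K0 (FGCat k) ≃+ AddMonoidAlgebra ℤ ℝ :=
  (toPoly k).trans
    { toFun := AddMonoidAlgebra.ofCoeff
      invFun := AddMonoidAlgebra.coeff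
      left_inv := fun _ => rfl
      right_inv := fun _ => rfl
      map_add' := fun _ _ => rfl }

theorem laurentEquiv_E₁ (a : ℝ) :
    laurentEquiv k (K0.cls (E₁ k a)) = AddMonoidAlgebra.single a 1 :=
  congrArg AddMonoidAlgebra.ofCoeff (toPoly_E₁ a)

end FGCat

theorem proposition7p2 (k : Type u) [Field k] :
    (∀ (C : Type w) [Category.{v} C] [Preadditive C] [Linear k C] [HasZeroObject C]
      [HasShift C ℤ] [∀ n : ℤ, (shiftFunctor C n).Additive] [Pretriangulated C]
      [IsTriangulated C] [TPC k C] (sum : C → C → C) (d : C → C → ℝ≥0∞),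
      IsDirectSum sum → IsPseudoMetric d →
      (∀ X X' Y Y' : C, d (sum X X') (sum Y Y') ≤ d X Y + d X' Y') →
      (IsPseudoMetric (inducedDist d) ∧
        (∀ x y z : K0 C, inducedDist d (x + z) (y + z) = inducedDist d x y) ∧
        ((∀ X Y : C, d X Y ≠ ⊤) → ∀ x y : K0 C, inducedDist d x y ≠ ⊤)) ∧
      (∀ S : Set C, (∀ X ∈ S, ∀ Y ∈ S, sum X Y ∈ S) → (∀ x : K0 C, ∃ X ∈ S, K0.cls X = x) →
        d (sum 0 0) 0 = 0 →
        (∀ x y : K0 C, strongNorm d S (x + y) ≤ strongNorm d S x + strongNorm d S y) ∧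
        ((0 : C) ∈ S → strongNorm d S 0 = 0) ∧
        ((∀ X ∈ S, X⟦(1 : ℤ)⟧ ∈ S ∧ d (X⟦(1 : ℤ)⟧) 0 = d X 0) →
          ∀ x : K0 C, strongNorm d S (-x) = strongNorm d S x) ∧
        ((∀ X Y : C, d X Y ≠ ⊤) → ∀ x : K0 C, strongNorm d S x ≠ ⊤))) ∧
    (∃ lam : K0 (FGCat k) ≃+ AddMonoidAlgebra ℤ ℝ,
      (∀ a : ℝ, lam (K0.cls (FGCat.E₁ k a)) = AddMonoidAlgebra.single a 1) ∧
      (∀ graded : Bool,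
        IsPseudoMetric (inducedDist (FGCat.bottleneckDist (k := k) graded)) ∧
        (∀ x y : K0 (FGCat k), inducedDist (FGCat.bottleneckDist graded) x y = 0 ∨
          inducedDist (FGCat.bottleneckDist graded) x y = ⊤) ∧
        inducedDist (FGCat.bottleneckDist graded) (K0.cls (FGCat.E₁ k 0)) 0 = ⊤) ∧
      (∀ x y : K0 (FGCat k),
        inducedDist (TPC.fragDist k (FGCat.stdFamily k)) x y = 0) ∧
      ((∀ X ∈ FGCat.trivialDifferential k, ∀ Y ∈ FGCat.trivialDifferential k,
          ∃ Z ∈ FGCat.trivialDifferential k, Nonempty (Z ≅ X ⊞ Y)) ∧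
        (∀ x : K0 (FGCat k), ∃ X ∈ FGCat.trivialDifferential k, K0.cls X = x) ∧
        IsGroupSeminorm (strongNorm (TPC.fragDist k (FGCat.stdFamily k))
          (FGCat.trivialDifferential k)) ∧
        (∀ x : K0 (FGCat k), strongNorm (TPC.fragDist k (FGCat.stdFamily k))
          (FGCat.trivialDifferential k) x ≠ ⊤) ∧
        (∀ a : ℝ, a < 0 → strongNorm (TPC.fragDist k (FGCat.stdFamily k))
          (FGCat.trivialDifferential k) (lam.symm (AddMonoidAlgebra.single a 1)) =
            ENNReal.ofReal |a|))) := by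
  refine ⟨?_, FGCat.laurentEquiv k, FGCat.laurentEquiv_E₁, ?_, FGCat.inducedDist_fragDist, ?_,
    FGCat.exists_trivialDifferential_cls, FGCat.isGroupSeminorm_strongNorm,
    FGCat.strongNorm_fragDist_ne_top, ?_⟩
  · intro C _ _ _ _ _ _ _ _ _ sum d hs hd hadd
    exact ⟨⟨isPseudoMetric_inducedDist hs hd hadd, inducedDist_add_right hs hd hadd,
      inducedDist_ne_top⟩, fun S hS hS' h0 => ⟨strongNorm_add_le hs hd hadd hS h0,
      strongNorm_zero hd, strongNorm_neg, strongNorm_ne_top hS'⟩⟩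
  · exact fun graded => ⟨FGCat.isPseudoMetric_bottleneck graded,
      FGCat.inducedDist_bottleneck_eq_zero_or_top graded,
      FGCat.inducedDist_bottleneck_E₁_zero graded⟩
  · intro X hX Y hY
    obtain ⟨Z, hZ, e, -⟩ := FGCat.exists_trivialDifferential_biprod hX hY
    exact ⟨Z, hZ, e⟩
  · intro a ha
    rw [← FGCat.laurentEquiv_E₁ (k := k), AddEquiv.symm_apply_apply, FGCat.strongNorm_E₁, abs_of_neg ha]
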